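/- **Smale Horseshoe Theorem.** Let $\mathcal H$ be a real Hilbert space and consider the evolution equation $\partial_t u=\mathcal L u+\mathcal N(u)$, with $\mathcal L$ a (possibly unbounded) linear operator in $\mathcal H$. Solutions are continuous curves $u:\mathbb R\to\mathcal H$ satisfying the equation tested against every element of the domain of $\mathcal L^*$. Assume (A1)–(A4): * **(A1)** $\mathcal N(0)=0$; the (complexified) spectrum of $\mathcal L$ consists of eigenvalues and equals $\{-\alpha\pm i\beta,\ \gamma,\ \lambda_j^-\ (j\in S^-),\ \lambda_j^+\ (1\le j\le N)\}$ with $S^-\subset\mathbb N$, $N<\infty$, $\alpha,\beta,\gamma>0$, $\pm\mathrm{Re}\,\lambda_j^\pm>0$, $\alpha<\gamma$, $\alpha<\lambda^-=\inf_j(-\mathrm{Re}\,\lambda_j^-)$ and $\gamma<\lambda^+=\inf_j\mathrm{Re}\,\lambda_j^+$ (an infimum over an empty family may be replaced by any real number satisfying the stated inequality). * **(A2)** For every $u_0\in\mathcal H$ there is a unique solution $t\mapsto F^t(u_0)$, $t\in\mathbb R$, with $F^0(u_0)=u_0$, and every $F^t$ is $C^2$. * **(A3)** There are linear coordinates $(x,y,z,v^+,v^-)$,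 $x,y,z\in\mathbb R$, $v^+\in\mathbb R^N$, $v^-\in V$ ($V$ a Hilbert space), on $\mathcal H$ in which $\mathcal L$ acts as $(x,y,z,v^+,v^-)\mapsto(-\alpha x-\beta y,\ \beta x-\alpha y,\ \gamma z,\ L^+v^+,\ L^-v^-)$, where $L^-$ generates a strongly continuous semigroup, $\|e^{L^+t}\|\le c^+e^{\lambda^+t}$ as $t\to-\infty$ and $\|e^{L^-t}\|\le c^-e^{-\lambda^-t}$ as $t\to+\infty$. There are a $C^2$ diffeomorphism $\mathcal R$ of $\mathcal H$ with $\mathcal R(0)=0$ and an open neighbourhood $\Omega$ of $0$ such that the conjugated evolution operator $\mathcal RF^t\mathcal R^{-1}$ coincides with $e^{\mathcal Lt}$, $t\ge0$, along orbit segments that stay in $\Omega$. From now on $F^t$ denotes the conjugated evolution operator in these coordinates. * **(A4)** $h$ is an orbit of $F^t$ with $h(t)\to0$ as $t\to\pm\infty$, tangent at $0$ to the $(x,y)$-plane as $t\to+\infty$ and to the positive $z$-axis as $t\to-\infty$. At each point $v$ of $h$, the tangent spaces at $v$ of the unstable and stable manifolds $W^u$, $W^s$ of $0$ satisfy $\dim(\mathscr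 T_vW^u\cap\mathscr T_vW^s)=1$. For $\eta>0$ let $\Sigma_0=\{y=0,\ \eta e^{-2\pi\alpha/\beta}<x<\eta,\ 0<z<\eta,\ \|v^\pm\|<\eta\}$, and let $\Sigma_0^+$ be defined in the same way with $-\eta<z<\eta$. Suppose that $w^{(+)}=(x_*,0,0,0,v_*^-)$ is a point of $h$ in $\Sigma_0^+$ and that $T>0$ is such that $w^{(-)}=F^{-T}(w^{(+)})=(0,0,\eta,v_*^+,0)$, where the forward orbit of $w^{(+)}$ and the backward orbit of $w^{(-)}$ stay in $\Omega$. Let $\Sigma_1=F^{-T}(\Sigma_0^+)\cap\Omega$. For $w\in\Sigma_0$ let $t_*(w)$ be the smallest $t>0$ with $F^t(w)\in\Sigma_1$, where it exists; put $P_0^1(w)=F^{t_*(w)}(w)$ and let $P(w)=F^T(P_0^1(w))$, defined where $P(w)\in\Sigma_0$, be the Poincaré map. Let $D=DF^T(w^{(-)})$. Let $\Delta_1$ (resp. $\Delta_2$) be $x_*$ times the determinant of the endomorphism of $\mathbb R\times\mathbb R\times\mathbb R^N$ that sends $(s,\hat z,\hat v)$ to the $(y,z,v^+)$-components of $D(s,0,\hat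 z,\hat v,0)$ (resp. $D(0,s,\hat z,\hat v,0)$); thus $\Delta_1\cos\beta t+\Delta_2\sin\beta t=0$ is the condition for solvability, in $(\hat z,\hat v)$, of the leading order fixed point system: the $y$, $z$ and $v^+$ components of $D(x_*\cos\beta t,x_*\sin\beta t,\hat z,\hat v,0)$ vanish. Assume * **(A5)** $\Delta_1$ and $\Delta_2$ are not both zero. Let $\varphi=\arctan(\Delta_1/\Delta_2)$ ($\varphi=\pi/2$ if $\Delta_2=0$). Then, provided $\eta$ is sufficiently small, $\Sigma_0\subset\Omega$, there are fixed points $p_\ell$ of $P$ ($\ell$ large) with $p_\ell\to w^{(+)}$ and return times $T^{(\ell)}=t_*(p_\ell)=\frac1\beta(\ell\pi-\varphi)+o(1)$, and for every such sequence the following holds. Assume * **(A6)** for all large $\ell$, with $t=T^{(2\ell)}$: the vectors of $\{y=z=0,\ v^+=0\}$, together with the vectors $D\sigma$, where $\sigma$ runs over the vectors tangent to $\Sigma_1$ at $w^{(-)}$ (that is, the $y$-component of $D\sigma$ is $0$) with zero $v^-$-component whose $(x,y)$-component is a multiple of the tangent $(-\alpha\cos\beta t-\beta\sin\beta t,\ -\alpha\sin\beta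 t+\beta\cos\beta t)$ of the spiral $e^{-\alpha t}(\cos\beta t,\sin\beta t)$, span the hyperplane $\{y=0\}$. Let $S_\ell$ be the slab of those $w\in\Sigma_0$, with $P_0^1(w)$ defined, for which $\eta e^{-\gamma(T^{(2\ell+2)}-\pi/2\beta)}\le z(w)\le\eta e^{-\gamma(T^{(2\ell)}-\pi/2\beta)}$ and each of $|x(w)-x_*|$, $\|v^-(P_0^1(w))\|$, $\|v^+(P_0^1(w))-v_*^+\|$ is at most $\eta e^{-\frac12\alpha T^{(2\ell)}}$. Then for every sufficiently large integer $\ell$ there is a compact Cantor set (nonempty, perfect, totally disconnected) $\Lambda_\ell\subset S_\ell$ contained in the domain of $P$ with $P(\Lambda_\ell)=\Lambda_\ell$, and there is a homeomorphism $\phi_\ell:\{0,1\}^{\mathbb Z}\to\Lambda_\ell$ with $P\circ\phi_\ell=\phi_\ell\circ\chi$, where $\{0,1\}^{\mathbb Z}$ carries the product topology and $\chi(a)_k=a_{k+1}$ is the shift. -/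

import Mathlib

open Set Filter Topology

noncomputable section

namespace Silnikov

/-! ### Unbounded operators, semigroups, evolution equations -/

section Operators

variable {H : Type*} [NormedAddCommGroup H] [InnerProductSpace ℝ H]

/-- `μ = a + i b` is an eigenvalue of (the complexification of) the real operator `L`:
`L (u + i w) = μ (u + i w)` for some `u + i w ≠ 0`. -/
def IsEigenvalue (L : H →ₗ.[ℝ] H) (μ : ℂ) : Prop :=
  ∃ u w : H, (u, w) ≠ 0 ∧ (u, μ.re • u - μ.im • w) ∈ L.graph ∧
    (w, μ.im • u + μ.re • w) ∈ L.graph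

/-- `μ = a + i b` is in the resolvent set of (the complexification of) `L`: the operator
`μ - L : D(L) → H` (complexified) is bijective with bounded inverse `R`. -/
def InResolventSet (L : H →ₗ.[ℝ] H) (μ : ℂ) : Prop :=
  ∃ R : (H × H) →L[ℝ] (H × H), ∀ u w f g : H,
    ((u, μ.re • u - μ.im • w - f) ∈ L.graph ∧ (w, μ.im • u + μ.re • w - g) ∈ L.graph) ↔
      R (f, g) = (u, w)

/-- The (complex) spectrum of a possibly unbounded real operator. -/
def opSpectrum (L : H →ₗ.[ℝ] H) : Set ℂ := {μ | ¬ InResolventSet L μ}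

/-- `S t`, `t ≥ 0`, is a strongly continuous semigroup of bounded operators with infinitesimal
generator `A`; that is, `S t = e ^ (A t)` for `t ≥ 0`. -/
structure IsSemigroupGeneratedBy (S : ℝ → H →L[ℝ] H) (A : H →ₗ.[ℝ] H) : Prop where
  zero : S 0 = ContinuousLinearMap.id ℝ H
  add : ∀ s t : ℝ, 0 ≤ s → 0 ≤ t → S (s + t) = (S s).comp (S t)
  continuousOn : ∀ v : H, ContinuousOn (fun t => S t v) (Ici 0)
  generator : ∀ v w : H, (v, w) ∈ A.graph ↔
    Tendsto (fun t : ℝ => t⁻¹ • (S t v - v)) (𝓝[>] 0) (𝓝 w)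

variable [CompleteSpace H]

/-- `u ∈ C⁰(ℝ, H)` solves `∂ₜ u = L u + 𝒩(u)` on the whole time line (weakly, i.e. tested with
the elements `φ` of the domain of the adjoint of `L`). The nonlinear term may lose derivatives:
`𝒩(u)` is a functional on the test vectors. An `H`-valued nonlinearity `G` is the case
`𝒩 u φ = ⟪G u, φ⟫`. -/
def IsSolution (L : H →ₗ.[ℝ] H) (Nl : H → (L.adjoint.domain →ₗ[ℝ] ℝ)) (u : ℝ → H) : Prop :=
  Continuous u ∧ ∀ (φ : L.adjoint.domain) (s t : ℝ),
    IntervalIntegrable (fun r => Nl (u r) φ) MeasureTheory.volume s t ∧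
    inner ℝ (u t) (φ : H) - inner ℝ (u s) (φ : H) =
      ∫ r in s..t, (inner ℝ (u r) (L.adjoint φ) + Nl (u r) φ)

/-- (A1): `u = 0` is a stationary point, and `L` has only point spectrum, consisting of
`-α ± iβ`, `γ`, the `μm j` (`j ∈ Sm`) with negative real part and finitely many `μp j` with
positive real part. The infimum over an empty family imposes no restriction besides the
stated inequality. -/
structure A1 {N : ℕ} (L : H →ₗ.[ℝ] H) (Nl : H → (L.adjoint.domain →ₗ[ℝ] ℝ))
    (α β γ lamMinus lamPlus : ℝ) (Sm : Set ℕ) (μm : ℕ → ℂ) (μp : Fin N → ℂ) : Prop where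
  stationary : Nl 0 = 0
  α_pos : 0 < α
  β_pos : 0 < β
  γ_pos : 0 < γ
  α_lt_γ : α < γ
  re_neg : ∀ j ∈ Sm, (μm j).re < 0
  re_pos : ∀ j, 0 < (μp j).re
  inf_minus : Sm.Nonempty → IsGLB ((fun j => -(μm j).re) '' Sm) lamMinus
  inf_plus : 0 < N → IsGLB (range fun j => (μp j).re) lamPlus
  α_lt : α < lamMinus
  γ_lt : γ < lamPlus
  spectrum_eq : opSpectrum L =
    {(⟨-α, β⟩ : ℂ), (⟨-α, -β⟩ : ℂ), (⟨γ, 0⟩ : ℂ)} ∪ μm '' Sm ∪ range μp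
  point_spectrum : ∀ μ ∈ opSpectrum L, IsEigenvalue L μ

/-- (A2): global well-posedness in `H`, with evolution operator `F t` that is `C²` in the
initial datum. -/
structure A2 (L : H →ₗ.[ℝ] H) (Nl : H → (L.adjoint.domain →ₗ[ℝ] ℝ)) (F : ℝ → H → H) :
    Prop where
  solution : ∀ u₀, IsSolution L Nl (fun t => F t u₀)
  initial : ∀ u₀, F 0 u₀ = u₀
  unique : ∀ u : ℝ → H, IsSolution L Nl u → ∀ t, u t = F t (u 0)
  smooth : ∀ t, ContDiff ℝ 2 (F t)

end Operators

/-! ### Normal form coordinates -/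

/-- The space of coordinates `(x, y, z, v⁺, v⁻)`, with `v⁺ ∈ ℝᴺ` and `v⁻ ∈ V`. -/
abbrev Coord (N : ℕ) (V : Type*) : Type _ := ℝ × ℝ × ℝ × EuclideanSpace ℝ (Fin N) × V

variable {N : ℕ} {V : Type*}

/-- the `x` coordinate -/
def cx (w : Coord N V) : ℝ := w.1
/-- the `y` coordinate -/
def cy (w : Coord N V) : ℝ := w.2.1
/-- the `z` coordinate -/
def cz (w : Coord N V) : ℝ := w.2.2.1
/-- the `v⁺` coordinate -/
def cp (w : Coord N V) : EuclideanSpace ℝ (Fin N) := w.2.2.2.1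
/-- the `v⁻` coordinate -/
def cm (w : Coord N V) : V := w.2.2.2.2

variable [NormedAddCommGroup V] [InnerProductSpace ℝ V]

/-- The solution operator `e ^ (L t)`, `t ≥ 0`, of the linear system
`ẋ = -αx - βy`, `ẏ = βx - αy`, `ż = γz`, `∂ₜv⁺ = L⁺v⁺`, `∂ₜv⁻ = L⁻v⁻`, where
`S t = e ^ (L⁻ t)`. -/
def linFlow (α β γ : ℝ) (Lp : EuclideanSpace ℝ (Fin N) →L[ℝ] EuclideanSpace ℝ (Fin N))
    (S : ℝ → V →L[ℝ] V) (t : ℝ) (w : Coord N V) : Coord N V :=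
  (Real.exp (-α * t) * (Real.cos (β * t) * cx w - Real.sin (β * t) * cy w),
   Real.exp (-α * t) * (Real.sin (β * t) * cx w + Real.cos (β * t) * cy w),
   Real.exp (γ * t) * cz w,
   NormedSpace.exp (t • Lp) (cp w),
   S t (cm w))

section NormalForm

variable {H : Type*} [NormedAddCommGroup H] [InnerProductSpace ℝ H]

/-- The evolution operator `R ∘ F t ∘ R⁻¹` conjugated by the diffeomorphism `R`, written in the
coordinates `κ`. -/
def conjFlow (F : ℝ → H → H) (R : H ≃ H) (κ : H ≃L[ℝ] Coord N V) (t : ℝ) (w : Coord N V) :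
    Coord N V :=
  κ (R (F t (R.symm (κ.symm w))))

/-- (A3): `C²` linearization. In the coordinates `κ` the operator `L` is block diagonal, and
after the `C²` change of variables `R` the evolution is the linear one,
`∂ₜ ũ = L ũ`, as long as it stays in the neighbourhood `Ω` of `0`. -/
structure A3 (L : H →ₗ.[ℝ] H) (F : ℝ → H → H) (α β γ lamMinus lamPlus : ℝ)
    (κ : H ≃L[ℝ] Coord N V) (R : H ≃ H)
    (Lp : EuclideanSpace ℝ (Fin N) →L[ℝ] EuclideanSpace ℝ (Fin N))
    (Lm : V →ₗ.[ℝ] V) (S : ℝ → V →L[ℝ] V) (Ω : Set (Coord N V)) : Prop where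
  R_zero : R 0 = 0
  R_smooth : ContDiff ℝ 2 R
  R_symm_smooth : ContDiff ℝ 2 R.symm
  normal_form : ∀ u w : H, (u, w) ∈ L.graph ↔
    cx (κ w) = -α * cx (κ u) - β * cy (κ u) ∧
    cy (κ w) = β * cx (κ u) - α * cy (κ u) ∧
    cz (κ w) = γ * cz (κ u) ∧
    cp (κ w) = Lp (cp (κ u)) ∧
    (cm (κ u), cm (κ w)) ∈ Lm.graph
  semigroup : IsSemigroupGeneratedBy S Lm
  bound_plus : ∃ c : ℝ, ∀ᶠ t in atBot, ‖NormedSpace.exp (t • Lp)‖ ≤ c * Real.exp (lamPlus * t)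
  bound_minus : ∃ c : ℝ, ∀ᶠ t in atTop, ‖S t‖ ≤ c * Real.exp (-lamMinus * t)
  Ω_open : IsOpen Ω
  zero_mem : (0 : Coord N V) ∈ Ω
  linear : ∀ (w : Coord N V) (t : ℝ), 0 ≤ t →
    (∀ s ∈ Icc 0 t, conjFlow F R κ s w ∈ Ω) →
    conjFlow F R κ t w = linFlow α β γ Lp S t w

end NormalForm

/-! ### The homoclinic orbit -/

/-- The tangent space at `v` of the stable (`l = atTop`) or unstable (`l = atBot`) manifold of
`0`: it consists of the velocities at `v` of the `C¹` curves `c` in that manifold (continuous in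
the topology of the immersed manifold, i.e. `Φ t (c s) → 0` locally uniformly in `s`). -/
def tangentSpaceOf (Φ : ℝ → Coord N V → Coord N V) (l : Filter ℝ) (v : Coord N V) :
    Submodule ℝ (Coord N V) :=
  Submodule.span ℝ {τ | ∃ (c : ℝ → Coord N V) (ε : ℝ), 0 < ε ∧ ContDiff ℝ 1 c ∧ c 0 = v ∧
    HasDerivAt c τ 0 ∧ TendstoUniformlyOn (fun t s => Φ t (c s)) (fun _ => 0) l (Ioo (-ε) ε)}

/-- (A4): `h` is a Silnikov homoclinic orbit asymptotic to `0`, tangent at `0` to the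
`(x, y)`-plane as `t → +∞` and to the positive `z`-axis as `t → -∞`, along which the tangent
spaces of the unstable and stable manifolds of `0` meet in a line. -/
structure A4 (Φ : ℝ → Coord N V → Coord N V) (h : ℝ → Coord N V) : Prop where
  orbit : ∀ t, h t = Φ t (h 0)
  tendsto_atTop : Tendsto h atTop (𝓝 0)
  tendsto_atBot : Tendsto h atBot (𝓝 0)
  tangent_atTop : (fun t => (cz (h t), cp (h t), cm (h t))) =o[atTop]
    (fun t => (cx (h t), cy (h t)))
  tangent_atBot : (fun t => (cx (h t), cy (h t), cp (h t), cm (h t))) =o[atBot]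
    (fun t => cz (h t))
  pos_atBot : ∀ᶠ t in atBot, 0 < cz (h t)
  dim_eq_one : ∀ t, Module.finrank ℝ
    ↥(tangentSpaceOf Φ atBot (h t) ⊓ tangentSpaceOf Φ atTop (h t)) = 1

/-! ### Poincaré sections and the Poincaré map -/

/-- The Poincaré section `Σ₀`. -/
def Sigma0 (α β η : ℝ) : Set (Coord N V) :=
  {w | cy w = 0 ∧ η * Real.exp (-2 * Real.pi * α / β) < cx w ∧ cx w < η ∧
    0 < cz w ∧ cz w < η ∧ ‖cp w‖ < η ∧ ‖cm w‖ < η}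

/-- The auxiliary section `Σ₀⁺`. -/
def Sigma0Plus (α β η : ℝ) : Set (Coord N V) :=
  {w | cy w = 0 ∧ η * Real.exp (-2 * Real.pi * α / β) < cx w ∧ cx w < η ∧
    -η < cz w ∧ cz w < η ∧ ‖cp w‖ < η ∧ ‖cm w‖ < η}

/-- The Poincaré section `Σ₁ = F⁻ᵀ(Σ₀⁺) ∩ Ω`. -/
def Sigma1 (Φ : ℝ → Coord N V → Coord N V) (Ω : Set (Coord N V)) (α β η T : ℝ) :
    Set (Coord N V) :=
  (Φ (-T) '' Sigma0Plus α β η) ∩ Ω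

/-- The points `w⁺ = h τ` and `w⁻ = F⁻ᵀ(w⁺) = h (τ - T)` on the homoclinic orbit: `w⁺` lies on
the `(z = 0)`-boundary of `Σ₀` and `w⁻` has `z = η`, both on the parts of the orbit on which it
converges to `0` inside `Ω`, where the dynamics is linear. -/
structure IsSectionData (h : ℝ → Coord N V) (Ω : Set (Coord N V)) (α β η T τ : ℝ) : Prop where
  T_pos : 0 < T
  plus_y : cy (h τ) = 0
  plus_z : cz (h τ) = 0
  plus_vp : cp (h τ) = 0
  plus_x : cx (h τ) ∈ Ioo (η * Real.exp (-2 * Real.pi * α / β)) η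
  plus_vm : ‖cm (h τ)‖ < η
  minus_x : cx (h (τ - T)) = 0
  minus_y : cy (h (τ - T)) = 0
  minus_z : cz (h (τ - T)) = η
  minus_vm : cm (h (τ - T)) = 0
  forward : ∀ t, τ ≤ t → h t ∈ Ω
  backward : ∀ t, t ≤ τ - T → h t ∈ Ω

/-- The positive times at which the orbit of `w` is in `Σ₁`. -/
def hitTimes (Φ : ℝ → Coord N V → Coord N V) (Ω : Set (Coord N V)) (α β η T : ℝ)
    (w : Coord N V) : Set ℝ :=
  {t | 0 < t ∧ Φ t w ∈ Sigma1 Φ Ω α β η T}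

/-- `t_*(w)`, the smallest positive time at which the orbit of `w` is in `Σ₁` (for `w ∈ U₀`). -/
def tStar (Φ : ℝ → Coord N V → Coord N V) (Ω : Set (Coord N V)) (α β η T : ℝ)
    (w : Coord N V) : ℝ :=
  sInf (hitTimes Φ Ω α β η T w)

/-- `U₀`, the domain of `P₀¹`: there is a smallest hitting time. -/
def U0 (Φ : ℝ → Coord N V → Coord N V) (Ω : Set (Coord N V)) (α β η T : ℝ) :
    Set (Coord N V) :=
  {w | w ∈ Sigma0 α β η ∧ ∃ t, IsLeast (hitTimes Φ Ω α β η T w) t}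

/-- `P₀¹(w) = F^{t_*(w)}(w)`. -/
def P01 (Φ : ℝ → Coord N V → Coord N V) (Ω : Set (Coord N V)) (α β η T : ℝ)
    (w : Coord N V) : Coord N V :=
  Φ (tStar Φ Ω α β η T w) w

/-- The Poincaré map `P = P₁⁰ ∘ P₀¹`, where `P₁⁰ = Fᵀ`. -/
def P (Φ : ℝ → Coord N V → Coord N V) (Ω : Set (Coord N V)) (α β η T : ℝ)
    (w : Coord N V) : Coord N V :=
  Φ T (P01 Φ Ω α β η T w)

/-- `U`, the domain of the Poincaré map `P` from `Σ₀` to itself. -/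
def U (Φ : ℝ → Coord N V → Coord N V) (Ω : Set (Coord N V)) (α β η T : ℝ) :
    Set (Coord N V) :=
  {w | w ∈ U0 Φ Ω α β η T ∧ P Φ Ω α β η T w ∈ Sigma0 α β η}

/-! ### The conditions (A5) and (A6) -/

/-- For a linear map `D` (the derivative of `Fᵀ` at `w⁻`), the endomorphism
`(s, z, v⁺) ↦ (y, z, v⁺)`-components of `D (s a, s b, z, v⁺, 0)` of `ℝ × ℝ × ℝᴺ`. -/
def borderedMap (D : Coord N V →L[ℝ] Coord N V) (a b : ℝ) :
    (ℝ × ℝ × EuclideanSpace ℝ (Fin N)) →ₗ[ℝ] (ℝ × ℝ × EuclideanSpace ℝ (Fin N)) where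
  toFun q := (cy (D (q.1 * a, q.1 * b, q.2.1, q.2.2, 0)),
    cz (D (q.1 * a, q.1 * b, q.2.1, q.2.2, 0)), cp (D (q.1 * a, q.1 * b, q.2.1, q.2.2, 0)))
  map_add' q r := by
    have : (((q + r).1 * a, (q + r).1 * b, (q + r).2.1, (q + r).2.2, 0) : Coord N V) =
        (q.1 * a, q.1 * b, q.2.1, q.2.2, 0) + (r.1 * a, r.1 * b, r.2.1, r.2.2, 0) := by
      simp [add_mul]
    rw [this, map_add]
    rfl
  map_smul' k q := by
    have : (((k • q).1 * a, (k • q).1 * b, (k • q).2.1, (k • q).2.2, 0) : Coord N V) =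
        k • ((q.1 * a, q.1 * b, q.2.1, q.2.2, 0) : Coord N V) := by
      simp [mul_assoc]
    rw [this, map_smul]
    rfl

/-- `Δ₁`: the coefficient of `cos β t` in the solvability condition
`Δ₁ cos β t + Δ₂ sin β t = 0` (a bordered determinant) of the leading order system for
`(z, v⁺)`, which demands that the `y`, `z`, `v⁺`-components of
`D (x_* cos β t, x_* sin β t, z, v⁺, 0)` vanish. If the `(z, v⁺)`-block `C` of `D` were
invertible, this would be `det C` times the coefficient found by eliminating `(z, v⁺)` by means
of `C⁻¹`; but `C` annihilates the velocity of the homoclinic orbit at `w⁻`. -/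
def Delta1 (D : Coord N V →L[ℝ] Coord N V) (xs : ℝ) : ℝ :=
  xs * LinearMap.det (borderedMap D 1 0)

/-- `Δ₂`: the coefficient of `sin β t` in the same solvability condition. -/
def Delta2 (D : Coord N V →L[ℝ] Coord N V) (xs : ℝ) : ℝ :=
  xs * LinearMap.det (borderedMap D 0 1)

/-- (A5): `Δ₁` and `Δ₂` do not vanish simultaneously. -/
def A5 (D : Coord N V →L[ℝ] Coord N V) (xs : ℝ) : Prop :=
  Delta1 D xs ≠ 0 ∨ Delta2 D xs ≠ 0

/-- `φ = arctan (Δ₁ / Δ₂)`, with value `π / 2` if `Δ₂ = 0`. -/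
def phase (D : Coord N V →L[ℝ] Coord N V) (xs : ℝ) : ℝ :=
  open Classical in
  if Delta2 D xs = 0 then Real.pi / 2 else Real.arctan (Delta1 D xs / Delta2 D xs)

/-- (A6) at a fixed point with return time `t`: the `x`- and `v⁻`-directions of `Σ₀`, the image
of the tangent vector of the spiral `t ↦ e ^ (-α t) (cos β t, sin β t)`, and the images of the
vectors tangent to `Σ₁` in the `(z, v⁺)`-directions span the tangent space `{y = 0}` of `Σ₀`.
A vector `σ` is tangent to `Σ₁` at `w⁻` iff the `y`-component of `D σ` vanishes. -/
def A6 (D : Coord N V →L[ℝ] Coord N V) (α β t : ℝ) : Prop :=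
  (Submodule.span ℝ
    ({τ : Coord N V | cy τ = 0 ∧ cz τ = 0 ∧ cp τ = 0} ∪
      D '' {σ : Coord N V | cy (D σ) = 0 ∧ cm σ = 0 ∧
        ∃ s : ℝ, cx σ = s * (-α * Real.cos (β * t) - β * Real.sin (β * t)) ∧
          cy σ = s * (-α * Real.sin (β * t) + β * Real.cos (β * t))}) : Set (Coord N V)) =
    {τ | cy τ = 0}

/-! ### Fixed points, slabs, horseshoes -/

/-- `Ts ℓ`, `ℓ` large, is the sequence `T^(ℓ) = (ℓπ - φ)/β + o(1)` of return times of fixed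
points `p ℓ → w⁺` of the Poincaré map. -/
structure IsFixedPointSequence (Φ : ℝ → Coord N V → Coord N V) (Ω : Set (Coord N V))
    (α β η T : ℝ) (wplus : Coord N V) (φ : ℝ) (p : ℕ → Coord N V) (Ts : ℕ → ℝ) : Prop where
  fixed : ∀ᶠ ℓ in atTop, p ℓ ∈ U Φ Ω α β η T ∧ P Φ Ω α β η T (p ℓ) = p ℓ ∧
    tStar Φ Ω α β η T (p ℓ) = Ts ℓ
  time : Tendsto (fun ℓ : ℕ => Ts ℓ - ((ℓ : ℝ) * Real.pi - φ) / β) atTop (𝓝 0)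
  tendsto : Tendsto p atTop (𝓝 wplus)

/-- The slab `S_ℓ` in `Σ₀`; `wplus`, `wminus` are the origins of the coordinates on `Σ₀`
and `Σ₁`. -/
def slab (Φ : ℝ → Coord N V → Coord N V) (Ω : Set (Coord N V)) (α β γ η T : ℝ)
    (wplus wminus : Coord N V) (Ts : ℕ → ℝ) (ℓ : ℕ) : Set (Coord N V) :=
  {w | w ∈ U0 Φ Ω α β η T ∧
    η * Real.exp (-γ * (Ts (2 * (ℓ + 1)) - Real.pi / (2 * β))) ≤ cz w ∧
    cz w ≤ η * Real.exp (-γ * (Ts (2 * ℓ) - Real.pi / (2 * β))) ∧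
    |cx w - cx wplus| ≤ η * Real.exp (-(1 / 2) * α * Ts (2 * ℓ)) ∧
    ‖cm (P01 Φ Ω α β η T w)‖ ≤ η * Real.exp (-(1 / 2) * α * Ts (2 * ℓ)) ∧
    ‖cp (P01 Φ Ω α β η T w) - cp wminus‖ ≤ η * Real.exp (-(1 / 2) * α * Ts (2 * ℓ))}

/-- The doubly infinite sequences of two symbols. The product topology of the discrete
topologies has the sets `{a | ∀ k, |k| < j → a k = a' k}` as neighbourhood basis at `a'`. -/
abbrev Symbols : Type := ℤ → Fin 2

/-- The shift automorphism. -/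
def shift (a : Symbols) : Symbols := fun k => a (k + 1)

/-- There is a compact Cantor set `Λ ⊆ S`, contained in the domain `dom` of the map `f` and
invariant under it, on which `f` is topologically conjugate to the shift on two symbols. -/
def HasHorseshoe {X : Type*} [TopologicalSpace X] (f : X → X) (dom S : Set X) : Prop :=
  ∃ Λ : Set X, Λ ⊆ S ∧ Λ ⊆ dom ∧ Λ.Nonempty ∧ IsCompact Λ ∧ Perfect Λ ∧
    IsTotallyDisconnected Λ ∧ f '' Λ = Λ ∧
    ∃ φ : Symbols ≃ₜ Λ, ∀ a : Symbols, (φ (shift a) : X) = f (φ a)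

end Silnikov

end

/-!
The proof reduces the horseshoe to a contraction for sequences of transits past the equilibrium,
written as a boundary value problem, so that expanding directions are solved backwards in time.

Between two sections the flow is linear, so a transit that takes the time `t` is described by the
coordinates `x`, `v⁻` at its start and `z`, `v⁺` at its end; then `Φ T` leads back to `Σ₀`. With
`t = (mπ - φ) / β + θ`, the deviation from `w⁻` at the end of the transit has the size
`e ^ (-αt)`. At this scale the `x` and `y` components follow a circle, `v⁻` is negligible because
`S` decays faster than the spiral, and the `z` and `v⁺` coordinates at the start of the next transit
are negligible because `α < γ < lp`. The `y`, `z` and `v⁺` components of the return condition become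
in the limit a linear system for `(z, v⁺)` with a parameter `θ`. It is solvable where the bordered
determinant `Δ₁ cos βt + Δ₂ sin βt` vanishes; this happens at `θ = 0`, by the choice of the phase
`φ`. The zeros of this function are simple, so the derivative with respect to `(θ, z, v⁺)` is
invertible (`det_borderedMap_tangent_ne_zero`, `exists_leading_estimates`), and a Newton-type
iteration contracts (`exists_scaled_step_estimates`), separately for each transit up to small
couplings with its neighbours. The `x` and `v⁻` components of the return condition contract by
themselves.

The semigroup `S` is strongly continuous only, so that `S t v⁻` need not be Lipschitz in the transit
time. This is repaired by restricting `v⁻` to `lipschitzVectors`, on whose elements `S` is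
Lipschitz in time; this set is preserved because `Φ T` commutes with the flow, which is linear near
both ends (`exists_mem_lipschitzVectors`).

The contraction is carried out among the continuous functions on a compact space `K` with a
homeomorphism `χ` and a locally constant number `m` of half turns
(`exists_equivariant_solution`, `exists_transit_family`). A one-point space gives the fixed points;
the two-symbol shift with `m a = 2ℓ + a 0` gives the horseshoe, where continuity and equivariance of
the conjugacy hold by construction. Injectivity holds because the transit time determines the
current symbol and the return map is injective (`hasHorseshoe_of_transits`).

The first hitting time has to be identified with the transit time. A separately continuous flow is
jointly continuous (`continuous_uncurry_of_flow`), so orbits starting near `w⁻` follow the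
homoclinic orbit, which for small `η` does not meet `Σ₀⁺` before the time `T`
(`exists_section_scale`); in the linear region the range of `x` in `Σ₀` rules out a second
intersection (`not_lt_cx_linFlow`).
-/

noncomputable section

namespace Silnikov

/-! ### Joint continuity of separately continuous flows -/

section JointContinuity

variable {X : Type*} [PseudoMetricSpace X]

/-- Pointwise convergence of a sequence of continuous curves to a continuous curve is continuous
convergence at some time, by the Baire category theorem on the time line. -/
theorem exists_time_tendsto_diagonal {f : ℕ → ℝ → X} {g : ℝ → X} (hf : ∀ n, Continuous (f n))
    (hg : Continuous g) (hfg : ∀ t, Tendsto (fun n => f n t) atTop (𝓝 (g t))) :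
    ∃ s : ℝ, ∀ u : ℕ → ℝ, Tendsto u atTop (𝓝 s) →
      Tendsto (fun n => f n (u n)) atTop (𝓝 (g s)) := by
  let A : ℕ → ℕ → Set ℝ := fun k m => {t | ∀ n, m ≤ n → dist (f n t) (g t) ≤ 1 / ((k : ℝ) + 1)}
  have hA : ∀ k m, IsClosed (A k m) := by
    intro k m
    have : A k m = ⋂ (n : ℕ) (_ : m ≤ n), {t | dist (f n t) (g t) ≤ 1 / ((k : ℝ) + 1)} := by
      ext t; simp [A]
    rw [this]
    exact isClosed_iInter fun n => isClosed_iInter fun _ =>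
      isClosed_le ((hf n).dist hg) continuous_const
  have hU : ∀ k, ⋃ m, A k m = univ := by
    intro k
    refine eq_univ_of_forall fun t => ?_
    have h := (Metric.tendsto_atTop.1 (hfg t)) (1 / ((k : ℝ) + 1)) (by positivity)
    obtain ⟨m, hm⟩ := h
    exact mem_iUnion.2 ⟨m, fun n hn => (hm n hn).le⟩
  have hD : Dense (⋂ k, ⋃ m, interior (A k m)) :=
    dense_iInter_of_isOpen_nat (fun k => isOpen_iUnion fun m => isOpen_interior)
      (fun k => dense_iUnion_interior_of_closed (hA k) (hU k))
  obtain ⟨s, hs⟩ := hD.nonempty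
  refine ⟨s, fun u hu => Metric.tendsto_atTop.2 fun ε hε => ?_⟩
  obtain ⟨k, hk⟩ := exists_nat_one_div_lt (half_pos hε)
  obtain ⟨m, hm⟩ := mem_iUnion.1 (mem_iInter.1 hs k)
  have h1 : ∀ᶠ n in atTop, u n ∈ interior (A k m) := hu.eventually (isOpen_interior.mem_nhds hm)
  have h2 := Metric.tendsto_atTop.1 ((hg.tendsto s).comp hu) (ε / 2) (half_pos hε)
  obtain ⟨N₁, hN₁⟩ := eventually_atTop.1 h1
  obtain ⟨N₂, hN₂⟩ := h2
  refine ⟨max m (max N₁ N₂), fun n hn => ?_⟩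
  have a1 := interior_subset (hN₁ n (by omega)) n (by omega)
  have a2 := hN₂ n (by omega)
  calc dist (f n (u n)) (g s) ≤ dist (f n (u n)) (g (u n)) + dist (g (u n)) (g s) :=
        dist_triangle _ _ _
    _ < ε / 2 + ε / 2 := add_lt_add_of_le_of_lt (a1.trans hk.le) a2
    _ = ε := add_halves ε

/-- A flow that is continuous in the time and in the initial datum separately is jointly
continuous. -/
theorem continuous_uncurry_of_flow {Φ : ℝ → X → X} (hadd : ∀ s t w, Φ (s + t) w = Φ s (Φ t w))
    (htime : ∀ w, Continuous fun t => Φ t w) (hspace : ∀ t, Continuous (Φ t)) :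
    Continuous fun q : ℝ × X => Φ q.1 q.2 := by
  rw [continuous_iff_seqContinuous]
  intro q q₀ hq
  obtain ⟨s, hs⟩ := exists_time_tendsto_diagonal (f := fun n t => Φ t (q n).2)
    (g := fun t => Φ t q₀.2) (fun n => htime _) (htime _)
    (fun t => ((hspace t).tendsto _).comp ((continuous_snd.tendsto _).comp hq))
  have h1 : Tendsto (fun n => s - q₀.1 + (q n).1) atTop (𝓝 s) := by
    have := ((continuous_fst.tendsto q₀).comp hq).const_add (s - q₀.1)
    simpa using this
  have h2 := ((hspace (q₀.1 - s)).tendsto _).comp (hs _ h1)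
  have h3 : ∀ t w, Φ (q₀.1 - s) (Φ (s - q₀.1 + t) w) = Φ t w := by
    intro t w; rw [← hadd]; congr 1; ring
  simp only [Function.comp_def, h3] at h2
  have h4 : Φ (q₀.1 - s) (Φ s q₀.2) = Φ q₀.1 q₀.2 := by rw [← hadd]; congr 1; ring
  rw [h4] at h2
  exact h2

end JointContinuity

/-! ### The evolution operator as a flow -/

section Evolution

variable {H : Type*} [NormedAddCommGroup H] [InnerProductSpace ℝ H] [CompleteSpace H]
variable {L : H →ₗ.[ℝ] H} {Nl : H → (L.adjoint.domain →ₗ[ℝ] ℝ)} {F : ℝ → H → H}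

theorem IsSolution.comp_add_right {u : ℝ → H} (hu : IsSolution L Nl u) (c : ℝ) :
    IsSolution L Nl (fun t => u (t + c)) := by
  refine ⟨hu.1.comp (continuous_id.add continuous_const), fun φ s t => ⟨?_, ?_⟩⟩
  · have := ((hu.2 φ (s + c) (t + c)).1).comp_add_right c
    simpa using this
  · rw [(hu.2 φ (s + c) (t + c)).2,
      intervalIntegral.integral_comp_add_right
        (fun r => inner ℝ (u r) (L.adjoint φ) + Nl (u r) φ) c]

theorem isSolution_zero (h0 : Nl 0 = 0) : IsSolution L Nl (fun _ => 0) := by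
  refine ⟨continuous_const, fun φ s t => ⟨?_, ?_⟩⟩ <;> simp [h0]

theorem A2.add (h : A2 L Nl F) (s t : ℝ) (u : H) : F (s + t) u = F s (F t u) := by
  have h1 := h.unique _ ((h.solution u).comp_add_right t) s
  simpa using h1

theorem A2.zero (h : A2 L Nl F) (h0 : Nl 0 = 0) (t : ℝ) : F t 0 = 0 :=
  (h.unique _ (isSolution_zero h0) t).symm

end Evolution

/-! ### Bounds for the linear semigroups -/

section Semigroups

variable {V : Type*} [NormedAddCommGroup V] [InnerProductSpace ℝ V] [CompleteSpace V]

/-- A strongly continuous semigroup with exponential decay rate `l` for large times has it for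
all times, by the uniform boundedness principle. -/
theorem exists_semigroup_bound {S : ℝ → V →L[ℝ] V}
    (hS : ∀ v : V, ContinuousOn (fun t => S t v) (Ici 0)) {l : ℝ}
    (hb : ∃ c : ℝ, ∀ᶠ t in atTop, ‖S t‖ ≤ c * Real.exp (-l * t)) :
    ∃ M : ℝ, ∀ t, 0 ≤ t → ‖S t‖ ≤ M * Real.exp (-l * t) := by
  obtain ⟨c, hc⟩ := hb
  obtain ⟨t₀, ht₀⟩ := eventually_atTop.1 hc
  obtain ⟨C, hC⟩ : ∃ C, ∀ t : Icc (0 : ℝ) t₀, ‖Real.exp (l * t) • S t‖ ≤ C := by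
    refine banach_steinhaus fun v => ?_
    have hcont : ContinuousOn (fun t => Real.exp (l * t) • S t v) (Icc 0 t₀) :=
      ContinuousOn.smul (by fun_prop) ((hS v).mono Icc_subset_Ici_self)
    obtain ⟨B, hB⟩ := isCompact_Icc.exists_bound_of_continuousOn hcont
    exact ⟨B, fun t => hB t t.2⟩
  refine ⟨max c C, fun t ht => ?_⟩
  by_cases h : t ≤ t₀
  · have h1 := hC ⟨t, ht, h⟩
    simp only [norm_smul, Real.norm_eq_abs, Real.abs_exp] at h1
    have h2 : ‖S t‖ = (Real.exp (l * t) * ‖S t‖) * Real.exp (-l * t) := by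
      rw [mul_right_comm, ← Real.exp_add]; simp
    rw [h2]
    exact mul_le_mul_of_nonneg_right (h1.trans (le_max_right _ _)) (Real.exp_pos _).le
  · exact (ht₀ t (not_le.1 h).le).trans
      (mul_le_mul_of_nonneg_right (le_max_left _ _) (Real.exp_pos _).le)

variable {E : Type*} [NormedAddCommGroup E] [NormedSpace ℝ E]

theorem exp_zero_smul (Lp : E →L[ℝ] E) (p : E) : NormedSpace.exp ((0 : ℝ) • Lp) p = p := by
  simp [NormedSpace.exp_zero]

variable [CompleteSpace E]

theorem exp_smul_add (Lp : E →L[ℝ] E) (s t : ℝ) (p : E) :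
    NormedSpace.exp ((s + t) • Lp) p = NormedSpace.exp (s • Lp) (NormedSpace.exp (t • Lp) p) := by
  let _ : NormedAlgebra ℚ (E →L[ℝ] E) := NormedAlgebra.restrictScalars ℚ ℝ _
  rw [add_smul, NormedSpace.exp_add_of_commute ((Commute.refl Lp).smul_left s |>.smul_right t)]
  rfl

theorem hasDerivAt_exp_smul (Lp : E →L[ℝ] E) (t : ℝ) :
    HasDerivAt (fun t : ℝ => NormedSpace.exp (t • Lp)) (NormedSpace.exp (t • Lp) * Lp) t :=
  hasDerivAt_exp_smul_const (𝕂 := ℝ) Lp t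

theorem continuous_exp_smul (Lp : E →L[ℝ] E) :
    Continuous fun t : ℝ => NormedSpace.exp (t • Lp) :=
  continuous_iff_continuousAt.2 fun t => (hasDerivAt_exp_smul Lp t).continuousAt

theorem exists_exp_bound {Lp : E →L[ℝ] E} {l : ℝ}
    (hb : ∃ c : ℝ, ∀ᶠ t in atBot, ‖NormedSpace.exp (t • Lp)‖ ≤ c * Real.exp (l * t)) :
    ∃ M : ℝ, ∀ t : ℝ, 0 ≤ t → ‖NormedSpace.exp ((-t) • Lp)‖ ≤ M * Real.exp (-l * t) := by
  obtain ⟨c, hc⟩ := hb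
  obtain ⟨t₀, ht₀⟩ := eventually_atBot.1 hc
  have hcont : ContinuousOn
      (fun t : ℝ => Real.exp (l * t) • NormedSpace.exp ((-t) • Lp)) (Icc 0 (-t₀)) :=
    (Continuous.smul (f := fun t : ℝ => Real.exp (l * t)) (by fun_prop)
      ((continuous_exp_smul Lp).comp continuous_neg)).continuousOn
  obtain ⟨C, hC⟩ := isCompact_Icc.exists_bound_of_continuousOn hcont
  refine ⟨max c C, fun t ht => ?_⟩
  by_cases h : t ≤ -t₀
  · have h1 := hC t ⟨ht, h⟩
    simp only [norm_smul, Real.norm_eq_abs, Real.abs_exp] at h1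
    have h2 : ‖NormedSpace.exp ((-t) • Lp)‖ =
        (Real.exp (l * t) * ‖NormedSpace.exp ((-t) • Lp)‖) * Real.exp (-l * t) := by
      rw [mul_right_comm, ← Real.exp_add]; simp
    rw [h2]
    exact mul_le_mul_of_nonneg_right (h1.trans (le_max_right _ _)) (Real.exp_pos _).le
  · have h3 := ht₀ (-t) (by linarith)
    have h4 : l * -t = -l * t := by ring
    rw [h4] at h3
    exact h3.trans (mul_le_mul_of_nonneg_right (le_max_left _ _) (Real.exp_pos _).le)

end Semigroups

/-! ### The linear flow in coordinates -/

section LinearFlow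

variable {N : ℕ} {V : Type*} [NormedAddCommGroup V]

theorem norm_coord_lt_iff {w : Coord N V} {r : ℝ} :
    ‖w‖ < r ↔ |cx w| < r ∧ |cy w| < r ∧ |cz w| < r ∧ ‖cp w‖ < r ∧ ‖cm w‖ < r := by
  simp only [Prod.norm_def, sup_lt_iff, Real.norm_eq_abs, cx, cy, cz, cp, cm]

theorem norm_coord_le_iff {w : Coord N V} {r : ℝ} :
    ‖w‖ ≤ r ↔ |cx w| ≤ r ∧ |cy w| ≤ r ∧ |cz w| ≤ r ∧ ‖cp w‖ ≤ r ∧ ‖cm w‖ ≤ r := by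
  simp only [Prod.norm_def, sup_le_iff, Real.norm_eq_abs, cx, cy, cz, cp, cm]

theorem abs_cx_le (w : Coord N V) : |cx w| ≤ ‖w‖ := (norm_coord_le_iff.1 le_rfl).1
theorem abs_cy_le (w : Coord N V) : |cy w| ≤ ‖w‖ := (norm_coord_le_iff.1 le_rfl).2.1
theorem abs_cz_le (w : Coord N V) : |cz w| ≤ ‖w‖ := (norm_coord_le_iff.1 le_rfl).2.2.1
theorem norm_cp_le (w : Coord N V) : ‖cp w‖ ≤ ‖w‖ := (norm_coord_le_iff.1 le_rfl).2.2.2.1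
theorem norm_cm_le (w : Coord N V) : ‖cm w‖ ≤ ‖w‖ := (norm_coord_le_iff.1 le_rfl).2.2.2.2

theorem continuous_cx : Continuous (cx : Coord N V → ℝ) := continuous_fst
theorem continuous_cz : Continuous (cz : Coord N V → ℝ) :=
  continuous_fst.comp (continuous_snd.comp continuous_snd)
theorem continuous_cp : Continuous (cp : Coord N V → EuclideanSpace ℝ (Fin N)) :=
  continuous_fst.comp (continuous_snd.comp (continuous_snd.comp continuous_snd))
theorem continuous_cm : Continuous (cm : Coord N V → V) :=
  continuous_snd.comp (continuous_snd.comp (continuous_snd.comp continuous_snd))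

variable [InnerProductSpace ℝ V]
  {α β γ : ℝ} {Lp : EuclideanSpace ℝ (Fin N) →L[ℝ] EuclideanSpace ℝ (Fin N)}
  {S : ℝ → V →L[ℝ] V}

/-- A point of the plane `{y = 0}` with `0 < x < η` comes back to this plane, under the linear
flow, only after a multiple of half a turn, and to its part `x > 0` only when `x` has been
contracted by at least `e ^ (-2πα/β)`. So it does not return to the range of `x` in `Σ₀`. -/
theorem not_lt_cx_linFlow (hα : 0 < α) (hβ : 0 < β) {η s : ℝ} {w : Coord N V} (hη : 0 < η)
    (hy : cy w = 0) (hx : 0 < cx w) (hxη : cx w < η) (hs : 0 < s)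
    (hys : cy (linFlow α β γ Lp S s w) = 0) :
    ¬ η * Real.exp (-2 * Real.pi * α / β) < cx (linFlow α β γ Lp S s w) := by
  intro hlt
  have e1 : cx (linFlow α β γ Lp S s w) = Real.exp (-α * s) * (Real.cos (β * s) * cx w) := by
    simp only [linFlow, hy, mul_zero, sub_zero]; rfl
  have e2 : cy (linFlow α β γ Lp S s w) = Real.exp (-α * s) * (Real.sin (β * s) * cx w) := by
    simp only [linFlow, hy, mul_zero, add_zero]; rfl
  rw [e1] at hlt
  rw [e2] at hys
  have hsin : Real.sin (β * s) = 0 := by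
    rcases mul_eq_zero.1 hys with h | h
    · exact absurd h (Real.exp_pos _).ne'
    · rcases mul_eq_zero.1 h with h | h
      · exact h
      · exact absurd h hx.ne'
  have hcos : 0 < Real.cos (β * s) := by
    by_contra hc
    have h1 : Real.cos (β * s) * cx w ≤ 0 := mul_nonpos_of_nonpos_of_nonneg (not_lt.1 hc) hx.le
    have h2 := mul_nonpos_of_nonneg_of_nonpos (Real.exp_pos (-α * s)).le h1
    have h3 := mul_pos hη (Real.exp_pos (-2 * Real.pi * α / β))
    linarith
  obtain ⟨k, hk⟩ := Real.sin_eq_zero_iff.1 hsin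
  have hbs : 0 < β * s := mul_pos hβ hs
  have hk0 : 0 < k := by
    by_contra hk'
    have : (k : ℝ) ≤ 0 := by exact_mod_cast not_lt.1 hk'
    have := mul_nonpos_of_nonpos_of_nonneg this Real.pi_pos.le
    linarith
  have hk1 : k ≠ 1 := by
    rintro rfl
    rw [← hk] at hcos
    simp at hcos
    linarith
  have hk2 : (2 : ℝ) ≤ k := by exact_mod_cast (by omega : 2 ≤ k)
  have h2pi : 2 * Real.pi ≤ β * s := by
    rw [← hk]; exact mul_le_mul_of_nonneg_right hk2 Real.pi_pos.le
  have hs2 : 2 * Real.pi / β ≤ s := by rw [div_le_iff₀ hβ]; linarith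
  have hexp : Real.exp (-α * s) ≤ Real.exp (-2 * Real.pi * α / β) := by
    apply Real.exp_le_exp.2
    have := mul_le_mul_of_nonneg_left hs2 hα.le
    calc -α * s = -(α * s) := by ring
      _ ≤ -(α * (2 * Real.pi / β)) := by linarith
      _ = _ := by ring
  have h3 : Real.cos (β * s) * cx w ≤ η := by
    calc Real.cos (β * s) * cx w ≤ 1 * cx w :=
          mul_le_mul_of_nonneg_right (Real.cos_le_one _) hx.le
      _ ≤ η := by linarith
  have h4 : Real.exp (-α * s) * (Real.cos (β * s) * cx w) ≤
      Real.exp (-2 * Real.pi * α / β) * η :=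
    mul_le_mul hexp h3 (mul_pos hcos hx).le (Real.exp_pos _).le
  linarith

theorem continuousOn_linFlow (hS : ∀ v : V, ContinuousOn (fun t => S t v) (Ici 0))
    (w : Coord N V) : ContinuousOn (fun t => linFlow α β γ Lp S t w) (Ici 0) := by
  have hE : Continuous fun t : ℝ => NormedSpace.exp (t • Lp) (cp w) :=
    (continuous_exp_smul Lp).clm_apply continuous_const
  unfold linFlow
  refine ContinuousOn.prodMk (Continuous.continuousOn (by fun_prop))
    (ContinuousOn.prodMk (Continuous.continuousOn (by fun_prop))
      (ContinuousOn.prodMk (Continuous.continuousOn (by fun_prop))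
        (ContinuousOn.prodMk hE.continuousOn (hS _))))

theorem linFlow_zero (hS : S 0 = ContinuousLinearMap.id ℝ V) (w : Coord N V) :
    linFlow α β γ Lp S 0 w = w := by
  simp [linFlow, hS, exp_zero_smul, cx, cy, cz, cp, cm]

end LinearFlow

/-! ### Flows that are linear near an equilibrium -/

/-- A flow `Φ` of `C²` maps, continuous in time, with equilibrium `0`, that agrees with the linear
flow along orbit segments in the neighbourhood `Ω` of `0`. The semigroup `S` and the group
generated by `-Lp` decay with the rates `lm > α` and `lp > γ` and the constant `M`. -/
structure IsLocallyLinearFlow {N : ℕ} {V : Type*} [NormedAddCommGroup V] [InnerProductSpace ℝ V]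
    (Φ : ℝ → Coord N V → Coord N V) (Ω : Set (Coord N V)) (α β γ lm lp M : ℝ)
    (Lp : EuclideanSpace ℝ (Fin N) →L[ℝ] EuclideanSpace ℝ (Fin N)) (S : ℝ → V →L[ℝ] V) :
    Prop where
  α_pos : 0 < α
  β_pos : 0 < β
  α_lt_γ : α < γ
  α_lt_lm : α < lm
  γ_lt_lp : γ < lp
  one_le_M : 1 ≤ M
  zero : ∀ w, Φ 0 w = w
  add : ∀ s t w, Φ (s + t) w = Φ s (Φ t w)
  equilibrium : ∀ t, Φ t 0 = 0
  continuous_time : ∀ w, Continuous fun t => Φ t w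
  smooth : ∀ t, ContDiff ℝ 2 (Φ t)
  isOpen : IsOpen Ω
  zero_mem : (0 : Coord N V) ∈ Ω
  linear : ∀ (w : Coord N V) (t : ℝ), 0 ≤ t → (∀ s ∈ Icc 0 t, Φ s w ∈ Ω) →
    Φ t w = linFlow α β γ Lp S t w
  S_zero : S 0 = ContinuousLinearMap.id ℝ V
  S_add : ∀ s t : ℝ, 0 ≤ s → 0 ≤ t → S (s + t) = (S s).comp (S t)
  S_continuousOn : ∀ v : V, ContinuousOn (fun t => S t v) (Ici 0)
  S_bound : ∀ t, 0 ≤ t → ‖S t‖ ≤ M * Real.exp (-lm * t)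
  Lp_bound : ∀ t : ℝ, 0 ≤ t → ‖NormedSpace.exp ((-t) • Lp)‖ ≤ M * Real.exp (-lp * t)

section Flow

variable {N : ℕ} {V : Type*} [NormedAddCommGroup V] [InnerProductSpace ℝ V]
  {Φ : ℝ → Coord N V → Coord N V} {Ω : Set (Coord N V)} {α β γ lm lp M : ℝ}
  {Lp : EuclideanSpace ℝ (Fin N) →L[ℝ] EuclideanSpace ℝ (Fin N)} {S : ℝ → V →L[ℝ] V}

theorem A3.isLocallyLinearFlow [CompleteSpace V] {H : Type*} [NormedAddCommGroup H]
    [InnerProductSpace ℝ H] [CompleteSpace H] {L : H →ₗ.[ℝ] H}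
    {Nl : H → (L.adjoint.domain →ₗ[ℝ] ℝ)} {F : ℝ → H → H} {lamMinus lamPlus : ℝ} {Sm : Set ℕ}
    {μm : ℕ → ℂ} {μp : Fin N → ℂ} {κ : H ≃L[ℝ] Coord N V} {R : H ≃ H} {Lm : V →ₗ.[ℝ] V}
    (hA3 : A3 L F α β γ lamMinus lamPlus κ R Lp Lm S Ω)
    (hA1 : A1 L Nl α β γ lamMinus lamPlus Sm μm μp) (hA2 : A2 L Nl F) :
    ∃ M, IsLocallyLinearFlow (conjFlow F R κ) Ω α β γ lamMinus lamPlus M Lp S := by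
  obtain ⟨M₁, h₁⟩ := exists_semigroup_bound hA3.semigroup.continuousOn hA3.bound_minus
  obtain ⟨M₂, h₂⟩ := exists_exp_bound hA3.bound_plus
  have hR : R.symm 0 = 0 := by rw [Equiv.symm_apply_eq]; exact hA3.R_zero.symm
  refine ⟨max 1 (max M₁ M₂), ⟨hA1.α_pos, hA1.β_pos, hA1.α_lt_γ, hA1.α_lt, hA1.γ_lt,
    le_max_left _ _, fun w => ?_, fun s t w => ?_, fun t => ?_, fun w => ?_, fun t => ?_,
    hA3.Ω_open, hA3.zero_mem, hA3.linear, hA3.semigroup.zero, hA3.semigroup.add,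
    hA3.semigroup.continuousOn, fun t ht => ?_, fun t ht => ?_⟩⟩
  · simp [conjFlow, hA2.initial]
  · simp [conjFlow, hA2.add]
  · simp [conjFlow, hR, hA2.zero hA1.stationary, hA3.R_zero]
  · exact κ.continuous.comp (hA3.R_smooth.continuous.comp (hA2.solution _).1)
  · exact κ.contDiff.comp (hA3.R_smooth.comp ((hA2.smooth t).comp
      (hA3.R_symm_smooth.comp κ.symm.contDiff)))
  · exact (h₁ t ht).trans (mul_le_mul_of_nonneg_right
      ((le_max_left _ _).trans (le_max_right _ _)) (Real.exp_pos _).le)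
  · exact (h₂ t ht).trans (mul_le_mul_of_nonneg_right
      ((le_max_right _ _).trans (le_max_right _ _)) (Real.exp_pos _).le)

namespace IsLocallyLinearFlow

variable (hf : IsLocallyLinearFlow Φ Ω α β γ lm lp M Lp S)
include hf

theorem norm_S_le {t : ℝ} (ht : 0 ≤ t) : ‖S t‖ ≤ M := by
  refine (hf.S_bound t ht).trans ?_
  have h1 : Real.exp (-lm * t) ≤ 1 := Real.exp_le_one_iff.2 (by
    have := mul_nonneg (hf.α_pos.trans hf.α_lt_lm).le ht; linarith)
  exact mul_le_of_le_one_right (by linarith [hf.one_le_M]) h1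

theorem norm_exp_neg_le {t : ℝ} (ht : 0 ≤ t) : ‖NormedSpace.exp ((-t) • Lp)‖ ≤ M := by
  refine (hf.Lp_bound t ht).trans ?_
  have h1 : Real.exp (-lp * t) ≤ 1 := Real.exp_le_one_iff.2 (by
    have := mul_nonneg ((hf.α_pos.trans hf.α_lt_γ).trans hf.γ_lt_lp).le ht; linarith)
  exact mul_le_of_le_one_right (by linarith [hf.one_le_M]) h1

/-- Where the linear flow stays in `Ω`, it is the flow. -/
theorem eq_linFlow {w : Coord N V} {t : ℝ}
    (hw : ∀ s ∈ Icc 0 t, linFlow α β γ Lp S s w ∈ Ω) :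
    ∀ s ∈ Icc 0 t, Φ s w = linFlow α β γ Lp S s w := by
  have hmem : ∀ s ∈ Icc 0 t, Φ s w ∈ Ω := by
    by_contra hcon
    push Not at hcon
    let B : Set ℝ := Icc 0 t ∩ {s | Φ s w ∈ Ωᶜ}
    have hB : IsCompact B :=
      isCompact_Icc.inter_right (hf.isOpen.isClosed_compl.preimage (hf.continuous_time w))
    obtain ⟨s₁, hs₁, hleast⟩ := hB.exists_isLeast (let ⟨s, hs, h⟩ := hcon; ⟨s, hs, h⟩)
    have hbefore : ∀ s ∈ Ico 0 s₁, Φ s w = linFlow α β γ Lp S s w := by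
      intro s hs
      refine hf.linear w s hs.1 fun r hr => ?_
      by_contra hr'
      have := hleast ⟨⟨hr.1, hr.2.trans (hs.2.le.trans hs₁.1.2)⟩, hr'⟩
      linarith [hr.2, hs.2]
    have hs₁' : Φ s₁ w = linFlow α β γ Lp S s₁ w := by
      rcases hs₁.1.1.eq_or_lt with h0 | h0
      · rw [← h0, hf.zero, linFlow_zero hf.S_zero]
      · have hne : (𝓝[Ico 0 s₁] s₁).NeBot := by
          rw [← mem_closure_iff_nhdsWithin_neBot, closure_Ico h0.ne]
          exact ⟨h0.le, le_rfl⟩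
        have t1 : Tendsto (fun s => Φ s w) (𝓝[Ico 0 s₁] s₁) (𝓝 (Φ s₁ w)) :=
          ((hf.continuous_time w).tendsto s₁).mono_left nhdsWithin_le_nhds
        have t2 : Tendsto (fun s => linFlow α β γ Lp S s w) (𝓝[Ico 0 s₁] s₁)
            (𝓝 (linFlow α β γ Lp S s₁ w)) :=
          ((continuousOn_linFlow hf.S_continuousOn w) s₁ h0.le).mono_left
            (nhdsWithin_mono _ Ico_subset_Ici_self)
        refine tendsto_nhds_unique t1 (t2.congr' ?_)
        filter_upwards [self_mem_nhdsWithin] with s hs using (hbefore s hs).symm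
    exact hs₁.2 (hs₁' ▸ hw s₁ hs₁.1)
  intro s hs
  exact hf.linear w s hs.1 fun r hr => hmem r ⟨hr.1, hr.2.trans hs.2⟩

theorem continuous_uncurry : Continuous fun q : ℝ × Coord N V => Φ q.1 q.2 :=
  continuous_uncurry_of_flow hf.add hf.continuous_time fun t => (hf.smooth t).continuous

/-- Orbits stay close, uniformly on compact time intervals. -/
theorem exists_dist_lt (w : Coord N V) (T : ℝ) {ε : ℝ} (hε : 0 < ε) :
    ∃ δ > 0, ∀ σ, dist σ w < δ → ∀ r ∈ Icc 0 T, dist (Φ r σ) (Φ r w) < ε := by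
  have hopen : IsOpen {q : ℝ × Coord N V | dist (Φ q.1 q.2) (Φ q.1 w) < ε} :=
    isOpen_lt (hf.continuous_uncurry.dist ((hf.continuous_time w).comp continuous_fst))
      continuous_const
  obtain ⟨u, v, -, hv, hu, hwv, huv⟩ := generalized_tube_lemma (isCompact_Icc (a := 0) (b := T))
    (isCompact_singleton (x := w)) hopen (by
      rintro ⟨r, σ⟩ ⟨-, hσ⟩
      simp only [mem_singleton_iff] at hσ
      simpa [hσ] using hε)
  obtain ⟨δ, hδ, hδv⟩ := Metric.isOpen_iff.1 hv w (hwv rfl)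
  exact ⟨δ, hδ, fun σ hσ r hr => huv (mk_mem_prod (hu hr) (hδv hσ))⟩

theorem injective (t : ℝ) : Function.Injective (Φ t) := by
  intro u w h
  have := congrArg (Φ (-t)) h
  simpa [← hf.add, hf.zero] using this

theorem mem_image_neg_iff {T : ℝ} {A : Set (Coord N V)} {w : Coord N V} :
    w ∈ Φ (-T) '' A ↔ Φ T w ∈ A := by
  constructor
  · rintro ⟨a, ha, rfl⟩
    rwa [← hf.add, add_neg_cancel, hf.zero]
  · intro h
    exact ⟨_, h, by rw [← hf.add, neg_add_cancel, hf.zero]⟩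

/-! ### The homoclinic orbit in the linear region -/

/-- An orbit in the linear region that comes from `0` has vanishing `x` and `y` coordinates. -/
theorem cx_eq_zero_of_tendsto_atBot {h : ℝ → Coord N V} (horb : ∀ s t, h (s + t) = Φ s (h t))
    (hbot : Tendsto h atBot (𝓝 0)) {A : ℝ} (hA : ∀ t ≤ A, h t ∈ Ω) {b : ℝ} (hb : b ≤ A) :
    cx (h b) = 0 := by
  have hlin : ∀ t ≤ b, h b = linFlow α β γ Lp S (b - t) (h t) := by
    intro t ht
    have h1 : h b = Φ (b - t) (h t) := by rw [← horb]; congr 1; ring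
    rw [h1]
    refine hf.linear _ _ (by linarith) fun s hs => ?_
    rw [← horb]
    exact hA _ (by linarith [hs.2])
  have h2 : ∀ t ≤ b, |cx (h b)| ≤ 2 * ‖h t‖ := by
    intro t ht
    rw [hlin t ht]
    have e1 : |Real.exp (-α * (b - t))| ≤ 1 := by
      rw [Real.abs_exp, Real.exp_le_one_iff]
      have := mul_nonneg hf.α_pos.le (sub_nonneg.2 ht); linarith
    have e2 : |Real.cos (β * (b - t)) * cx (h t) - Real.sin (β * (b - t)) * cy (h t)| ≤
        2 * ‖h t‖ := by
      have a1 := mul_le_mul (Real.abs_cos_le_one (β * (b - t))) (abs_cx_le (h t)) (abs_nonneg _)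
        zero_le_one
      have a2 := mul_le_mul (Real.abs_sin_le_one (β * (b - t))) (abs_cy_le (h t)) (abs_nonneg _)
        zero_le_one
      rw [← abs_mul] at a1 a2
      have := abs_sub (Real.cos (β * (b - t)) * cx (h t)) (Real.sin (β * (b - t)) * cy (h t))
      linarith
    have e3 := mul_le_mul e1 e2 (abs_nonneg _) zero_le_one
    rw [← abs_mul, one_mul] at e3
    exact e3
  have h3 : Tendsto (fun t => 2 * ‖h t‖) atBot (𝓝 0) := by
    simpa using (hbot.norm).const_mul 2
  have h4 := ge_of_tendsto h3 (Filter.eventually_atBot.2 ⟨b, h2⟩)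
  exact abs_eq_zero.1 (le_antisymm h4 (abs_nonneg _))

/-- For small `η` the point `w⁻ = h (τ - T)` is close to `0`, and orbits starting near `w⁻` do not
meet `Σ₀⁺` before the time `T`: the homoclinic orbit is at first on the set `x = 0`, then away
from a neighbourhood of `0`, and finally in the linear region, where it meets `Σ₀⁺` only once. -/
theorem exists_section_scale {h : ℝ → Coord N V} (hA4 : A4 Φ h) {r₀ r₁ : ℝ} (hr₁ : 0 < r₁)
    (hr₁₀ : r₁ < r₀) (hball : Metric.ball 0 r₀ ⊆ Ω) :
    ∃ η₀ > 0, ∀ η, 0 < η → η < η₀ → ∀ T τ, IsSectionData h Ω α β η T τ →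
      ‖h (τ - T)‖ ≤ r₁ ∧ ∃ δ > 0, ∀ σ, dist σ (h (τ - T)) < δ → cy (Φ T σ) = 0 →
        η * Real.exp (-2 * Real.pi * α / β) < cx (Φ T σ) →
        ∀ r ∈ Ioo 0 T, Φ r σ ∉ Sigma0Plus α β η := by
  have hr₀ : 0 < r₀ := hr₁.trans hr₁₀
  have horb : ∀ s t, h (s + t) = Φ s (h t) := fun s t => by
    rw [hA4.orbit (s + t), hf.add, ← hA4.orbit t]
  have hne : ∀ t, h t ≠ 0 := by
    intro t ht
    obtain ⟨s, hs⟩ := hA4.pos_atBot.exists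
    have h1 : h s = 0 := by
      have := horb (s - t) t
      rw [sub_add_cancel, ht, hf.equilibrium] at this
      exact this
    rw [h1] at hs
    exact lt_irrefl _ hs
  obtain ⟨A, hA⟩ : ∃ A, ∀ t ≤ A, ‖h t‖ ≤ r₁ ∧ 0 < cz (h t) := by
    have h1 : ∀ᶠ t in atBot, ‖h t‖ < r₁ := by
      have := hA4.tendsto_atBot.norm
      rw [norm_zero] at this
      exact this.eventually (gt_mem_nhds hr₁)
    obtain ⟨A, hA⟩ := eventually_atBot.1 (h1.and hA4.pos_atBot)
    exact ⟨A, fun t ht => ⟨(hA t ht).1.le, (hA t ht).2⟩⟩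
  obtain ⟨B, hAB, hB⟩ : ∃ B, A ≤ B ∧ ∀ t, B ≤ t → ‖h t‖ < r₀ / 2 := by
    have h1 : ∀ᶠ t in atTop, ‖h t‖ < r₀ / 2 := by
      have := hA4.tendsto_atTop.norm
      rw [norm_zero] at this
      exact this.eventually (gt_mem_nhds (half_pos hr₀))
    obtain ⟨B, hB⟩ := eventually_atTop.1 h1
    exact ⟨max A B, le_max_left _ _, fun t ht => hB t ((le_max_right _ _).trans ht)⟩
  have hcont : Continuous h := by
    have : h = fun t => Φ t (h 0) := funext hA4.orbit
    rw [this]; exact hf.continuous_time _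
  obtain ⟨d, hd, hdle⟩ : ∃ d > 0, ∀ t ∈ Icc A B, d ≤ ‖h t‖ := by
    obtain ⟨t, -, ht⟩ := isCompact_Icc.exists_isMinOn (nonempty_Icc.2 hAB)
      (hcont.norm.continuousOn)
    exact ⟨‖h t‖, norm_pos_iff.2 (hne t), fun s hs => ht hs⟩
  have hAΩ : ∀ t ≤ A, h t ∈ Ω := fun t ht => hball (by
    rw [mem_ball_zero_iff]; exact ((hA t ht).1).trans_lt hr₁₀)
  refine ⟨min (cz (h A)) (d / 2), lt_min (hA A le_rfl).2 (half_pos hd),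
    fun η hη hηη T τ hsec => ?_⟩
  have hη1 := hηη.trans_le (min_le_left _ _)
  have hη2 := hηη.trans_le (min_le_right _ _)
  -- the coordinate `z` grows along the backward orbit of `w⁻`, so its value `η` fixes the time
  have hτA : τ - T ≤ A := by
    by_contra hcon
    push Not at hcon
    have h1 : h (τ - T) = Φ (τ - T - A) (h A) := by rw [← horb]; congr 1; ring
    have h2 : h (τ - T) = linFlow α β γ Lp S (τ - T - A) (h A) := by
      rw [h1]
      refine hf.linear _ _ (by linarith) fun s hs => ?_
      rw [← horb]
      exact hsec.backward _ (by linarith [hs.2])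
    have h3 : η = Real.exp (γ * (τ - T - A)) * cz (h A) := by
      rw [← hsec.minus_z, h2]; rfl
    have h4 : 1 ≤ Real.exp (γ * (τ - T - A)) := Real.one_le_exp
      (mul_nonneg (hf.α_pos.trans hf.α_lt_γ).le (by linarith))
    have h5 := mul_le_mul_of_nonneg_right h4 (hA A le_rfl).2.le
    linarith
  refine ⟨(hA _ hτA).1, ?_⟩
  have hm : 0 < η * Real.exp (-2 * Real.pi * α / β) := mul_pos hη (Real.exp_pos _)
  obtain ⟨δ, hδ, hclose⟩ := hf.exists_dist_lt (h (τ - T)) T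
    (lt_min (half_pos hr₀) (lt_min (half_pos hd) hm))
  refine ⟨δ, hδ, fun σ hσ hyσ hxσ r hr hmem => ?_⟩
  have hcl : ∀ s ∈ Icc 0 T, ‖Φ s σ - h (s + (τ - T))‖ <
      min (r₀ / 2) (min (d / 2) (η * Real.exp (-2 * Real.pi * α / β))) := by
    intro s hs
    rw [← dist_eq_norm, horb]; exact hclose σ hσ s hs
  have hr' := hcl r ⟨hr.1.le, hr.2.le⟩
  have hnorm : ‖Φ r σ‖ ≤ η := by
    obtain ⟨a1, a2, a3, a4, a5, a6, a7⟩ := hmem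
    refine norm_coord_le_iff.2 ⟨abs_le.2 ⟨by linarith, a3.le⟩, by rw [a1, abs_zero]; exact hη.le,
      abs_le.2 ⟨a4.le, a5.le⟩, a6.le, a7.le⟩
  rcases le_total (r + (τ - T)) A with hrA | hrA
  · have h0 := hf.cx_eq_zero_of_tendsto_atBot horb hA4.tendsto_atBot hAΩ hrA
    have h1 : cx (Φ r σ) = cx (Φ r σ - h (r + (τ - T))) := by
      change _ = cx (Φ r σ) - cx (h (r + (τ - T)))
      rw [h0, sub_zero]
    have h2 := (abs_cx_le (Φ r σ - h (r + (τ - T)))).trans_lt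
      (hr'.trans_le ((min_le_right _ _).trans (min_le_right _ _)))
    rw [← h1] at h2
    have := hmem.2.1
    linarith [le_abs_self (cx (Φ r σ))]
  rcases le_total (r + (τ - T)) B with hrB | hrB
  · have h1 := hdle _ ⟨hrA, hrB⟩
    have h2 := hr'.trans_le ((min_le_right _ _).trans (min_le_left _ _))
    have h3 := norm_sub_norm_le (h (r + (τ - T))) (Φ r σ)
    rw [norm_sub_rev] at h3
    linarith
  · have h1 : Φ T σ = linFlow α β γ Lp S (T - r) (Φ r σ) := by
      have e : Φ T σ = Φ (T - r) (Φ r σ) := by rw [← hf.add]; congr 1; ring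
      rw [e]
      refine hf.linear _ _ (by linarith [hr.2]) fun s hs => ?_
      rw [← hf.add]
      apply hball
      rw [mem_ball_zero_iff]
      have h2 := (hcl (s + r) ⟨by linarith [hs.1, hr.1], by linarith [hs.2]⟩).trans_le
        (min_le_left _ _)
      have h3 := hB (s + r + (τ - T)) (by linarith [hs.1])
      have h4 := norm_sub_norm_le (Φ (s + r) σ) (h (s + r + (τ - T)))
      linarith
    rw [h1] at hyσ hxσ
    exact not_lt_cx_linFlow hf.α_pos hf.β_pos hη hmem.1 (hm.trans hmem.2.1) hmem.2.2.1
      (by linarith [hr.2]) hyσ hxσ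

end IsLocallyLinearFlow

end Flow

/-! ### Transits and the Poincaré map -/

/-- The orbit of `w ∈ Σ₀` is linear up to the time `t`, at which it is in `Ω`; from there it
reaches `Σ₀` after the time `T`, without meeting `Σ₀⁺` before. -/
structure IsTransit {N : ℕ} {V : Type*} [NormedAddCommGroup V] [InnerProductSpace ℝ V]
    (Φ : ℝ → Coord N V → Coord N V) (Ω : Set (Coord N V)) (α β γ η T : ℝ)
    (Lp : EuclideanSpace ℝ (Fin N) →L[ℝ] EuclideanSpace ℝ (Fin N)) (S : ℝ → V →L[ℝ] V)
    (w : Coord N V) (t : ℝ) : Prop where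
  T_pos : 0 < T
  pos : 0 < t
  mem : w ∈ Sigma0 α β η
  linear : ∀ s ∈ Icc 0 t, Φ s w = linFlow α β γ Lp S s w
  exit_mem : Φ t w ∈ Ω
  next_mem : Φ T (Φ t w) ∈ Sigma0 α β η
  avoid : ∀ r ∈ Ioo 0 T, Φ r (Φ t w) ∉ Sigma0Plus α β η

section Transit

variable {N : ℕ} {V : Type*} [NormedAddCommGroup V] {α β η : ℝ}

theorem sigma0_subset_sigma0Plus :
    (Sigma0 α β η : Set (Coord N V)) ⊆ Sigma0Plus α β η :=
  fun _ ⟨a1, a2, a3, a4, a5, a6⟩ =>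
    ⟨a1, a2, a3, by linarith, a5, a6⟩

theorem sigma0Plus_pos {w : Coord N V} (hw : w ∈ Sigma0Plus α β η) : 0 < η := by
  obtain ⟨-, -, -, h1, h2, -⟩ := hw
  linarith

theorem cx_pos_of_mem {w : Coord N V} (hw : w ∈ Sigma0Plus α β η) : 0 < cx w :=
  (mul_pos (sigma0Plus_pos hw) (Real.exp_pos _)).trans hw.2.1

variable [InnerProductSpace ℝ V]
  {Φ : ℝ → Coord N V → Coord N V} {Ω : Set (Coord N V)} {γ lm lp M T : ℝ}
  {Lp : EuclideanSpace ℝ (Fin N) →L[ℝ] EuclideanSpace ℝ (Fin N)} {S : ℝ → V →L[ℝ] V}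

namespace IsTransit

variable {w w' : Coord N V} {t t' : ℝ}

theorem not_mem_sigma0Plus (hf : IsLocallyLinearFlow Φ Ω α β γ lm lp M Lp S)
    (h : IsTransit Φ Ω α β γ η T Lp S w t) {s : ℝ} (hs : 0 < s) (hst : s ≤ t) :
    Φ s w ∉ Sigma0Plus α β η := by
  intro hmem
  have hw := sigma0_subset_sigma0Plus h.mem
  rw [h.linear s ⟨hs.le, hst⟩] at hmem
  exact not_lt_cx_linFlow hf.α_pos hf.β_pos (sigma0Plus_pos hw) hw.1 (cx_pos_of_mem hw) hw.2.2.1 hs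
    hmem.1 hmem.2.1

theorem isLeast (hf : IsLocallyLinearFlow Φ Ω α β γ lm lp M Lp S)
    (h : IsTransit Φ Ω α β γ η T Lp S w t) : IsLeast (hitTimes Φ Ω α β η T w) t := by
  refine ⟨⟨h.pos, hf.mem_image_neg_iff.2 (sigma0_subset_sigma0Plus h.next_mem), h.exit_mem⟩, ?_⟩
  rintro s ⟨hs, hs', -⟩
  rw [hf.mem_image_neg_iff, ← hf.add] at hs'
  by_contra! hlt
  by_cases hTs : T + s ≤ t
  · exact h.not_mem_sigma0Plus hf (add_pos h.T_pos hs) hTs hs'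
  · refine h.avoid (T + s - t) ⟨by linarith, by linarith⟩ ?_
    rwa [← hf.add, sub_add_cancel]

theorem tStar_eq (hf : IsLocallyLinearFlow Φ Ω α β γ lm lp M Lp S)
    (h : IsTransit Φ Ω α β γ η T Lp S w t) : tStar Φ Ω α β η T w = t :=
  (h.isLeast hf).csInf_eq

theorem P01_eq (hf : IsLocallyLinearFlow Φ Ω α β γ lm lp M Lp S)
    (h : IsTransit Φ Ω α β γ η T Lp S w t) : P01 Φ Ω α β η T w = Φ t w := by
  rw [P01, h.tStar_eq hf]

theorem P_eq (hf : IsLocallyLinearFlow Φ Ω α β γ lm lp M Lp S)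
    (h : IsTransit Φ Ω α β γ η T Lp S w t) : P Φ Ω α β η T w = Φ T (Φ t w) := by
  rw [P, h.P01_eq hf]

theorem mem_U0 (hf : IsLocallyLinearFlow Φ Ω α β γ lm lp M Lp S)
    (h : IsTransit Φ Ω α β γ η T Lp S w t) : w ∈ U0 Φ Ω α β η T :=
  ⟨h.mem, t, h.isLeast hf⟩

theorem mem_U (hf : IsLocallyLinearFlow Φ Ω α β γ lm lp M Lp S)
    (h : IsTransit Φ Ω α β γ η T Lp S w t) : w ∈ U Φ Ω α β η T :=
  ⟨h.mem_U0 hf, by rw [h.P_eq hf]; exact h.next_mem⟩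

theorem eq_of_le (hf : IsLocallyLinearFlow Φ Ω α β γ lm lp M Lp S)
    (h : IsTransit Φ Ω α β γ η T Lp S w t) (h' : IsTransit Φ Ω α β γ η T Lp S w' t')
    (heq : Φ T (Φ t w) = Φ T (Φ t' w')) (hle : t ≤ t') : w = w' := by
  have h1 : w = Φ (t' - t) w' := by
    apply hf.injective t
    rw [← hf.add, add_sub_cancel]
    exact hf.injective T heq
  rcases hle.eq_or_lt with h2 | h2
  · rw [h1, h2, sub_self, hf.zero]
  · refine absurd (sigma0_subset_sigma0Plus h.mem) ?_
    rw [h1]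
    exact h'.not_mem_sigma0Plus hf (by linarith) (by linarith [h.pos])

/-- The orbit segments that precede a common point agree: the Poincaré map is injective on
transits. -/
theorem eq_of_next_eq (hf : IsLocallyLinearFlow Φ Ω α β γ lm lp M Lp S)
    (h : IsTransit Φ Ω α β γ η T Lp S w t) (h' : IsTransit Φ Ω α β γ η T Lp S w' t')
    (heq : Φ T (Φ t w) = Φ T (Φ t' w')) : w = w' := by
  rcases le_total t t' with hle | hle
  · exact h.eq_of_le hf h' heq hle
  · exact (h'.eq_of_le hf h heq.symm hle).symm

end IsTransit

end Transit

/-! ### Horseshoes from families of transits -/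

/-- The shift as a homeomorphism. -/
def shiftHomeomorph : Symbols ≃ₜ Symbols where
  toFun := shift
  invFun a k := a (k - 1)
  left_inv a := by funext k; simp [shift]
  right_inv a := by funext k; simp [shift]
  continuous_toFun := continuous_pi fun k => continuous_apply (k + 1)
  continuous_invFun := continuous_pi fun k => continuous_apply (k - 1)

theorem preperfect_univ_symbols : Preperfect (univ : Set Symbols) := by
  intro a _
  rw [accPt_iff_nhds]
  intro u hu
  let b : ℕ → Symbols := fun n => Function.update a n (a n + 1)
  have hb : Tendsto b atTop (𝓝 a) := by
    refine tendsto_pi_nhds.2 fun k => tendsto_const_nhds.congr' ?_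
    filter_upwards [eventually_gt_atTop k.natAbs] with n hn
    exact (Function.update_of_ne (by omega) _ _).symm
  obtain ⟨n, hn⟩ := (hb.eventually hu).exists
  refine ⟨b n, ⟨hn, mem_univ _⟩, fun h => ?_⟩
  have := congrFun h n
  simp [b] at this

section Horseshoe

variable {N : ℕ} {V : Type*} [NormedAddCommGroup V] [InnerProductSpace ℝ V]
  {Φ : ℝ → Coord N V → Coord N V} {Ω : Set (Coord N V)} {α β γ lm lp M η T : ℝ}
  {Lp : EuclideanSpace ℝ (Fin N) →L[ℝ] EuclideanSpace ℝ (Fin N)} {S : ℝ → V →L[ℝ] V}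

/-- A continuous shift-equivariant family of transits, whose transit times determine the current
symbol, is a horseshoe. -/
theorem hasHorseshoe_of_transits (hf : IsLocallyLinearFlow Φ Ω α β γ lm lp M Lp S)
    {A : Set (Coord N V)} {w : Symbols → Coord N V} {t : Symbols → ℝ} (hw : Continuous w)
    (htr : ∀ a, IsTransit Φ Ω α β γ η T Lp S (w a) (t a))
    (hnext : ∀ a, w (shift a) = Φ T (Φ (t a) (w a)))
    (ht : ∀ a a', t a = t a' → a 0 = a' 0) (hA : ∀ a, w a ∈ A) :
    HasHorseshoe (P Φ Ω α β η T) (U Φ Ω α β η T) A := by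
  have hP : ∀ a, P Φ Ω α β η T (w a) = w (shift a) := fun a => by
    rw [(htr a).P_eq hf, hnext]
  have hsymm : ∀ a, shift (shiftHomeomorph.symm a) = a := shiftHomeomorph.apply_symm_apply
  have hcur : ∀ a a', w a = w a' → a 0 = a' 0 := fun a a' h => by
    apply ht
    rw [← (htr a).tStar_eq hf, ← (htr a').tStar_eq hf, h]
  have hfwd : ∀ a a', w a = w a' → w (shift a) = w (shift a') := fun a a' h => by
    rw [← hP, ← hP, h]
  have hbwd : ∀ a a', w a = w a' → w (shiftHomeomorph.symm a) = w (shiftHomeomorph.symm a') :=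
    fun a a' h => (htr _).eq_of_next_eq hf (htr _) (by
      rw [← hnext, ← hnext, hsymm, hsymm, h])
  have hinj : Function.Injective w := by
    have h1 : ∀ (n : ℕ) (a a' : Symbols), w a = w a' → a n = a' n := by
      intro n
      induction n with
      | zero => exact hcur
      | succ n ih =>
          intro a a' h
          have := ih _ _ (hfwd a a' h)
          change a ((n : ℤ) + 1) = a' ((n : ℤ) + 1) at this
          rw [Nat.cast_succ]
          exact this
    have h2 : ∀ (n : ℕ) (a a' : Symbols), w a = w a' → a (-n) = a' (-n) := by
      intro n
      induction n with
      | zero => exact hcur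
      | succ n ih =>
          intro a a' h
          have := ih _ _ (hbwd a a' h)
          change a (-(n : ℤ) - 1) = a' (-(n : ℤ) - 1) at this
          rw [show (-((n + 1 : ℕ) : ℤ)) = -(n : ℤ) - 1 by push_cast; ring]
          exact this
    intro a a' h
    funext k
    obtain ⟨n, rfl | rfl⟩ := k.eq_nat_or_neg
    · exact h1 n a a' h
    · exact h2 n a a' h
  have hemb : IsClosedEmbedding w := hw.isClosedEmbedding hinj
  refine ⟨range w, range_subset_iff.2 hA, range_subset_iff.2 fun a => (htr a).mem_U hf,
    range_nonempty w, isCompact_range hw, ⟨hemb.isClosed_range, ?_⟩, ?_, ?_,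
    hemb.isEmbedding.toHomeomorph, fun a => ?_⟩
  · rintro _ ⟨a, rfl⟩
    have := (preperfect_univ_symbols a (mem_univ a)).map hw.continuousAt hinj
    rwa [map_principal, image_univ] at this
  · exact hemb.isEmbedding.isTotallyDisconnected_range.2 inferInstance
  · rw [← range_comp]
    have : P Φ Ω α β η T ∘ w = w ∘ shift := funext hP
    rw [this]
    exact shiftHomeomorph.surjective.range_comp w
  · exact (hP a).symm

end Horseshoe

/-! ### The bordered determinant -/

/-- The determinant of an endomorphism of `ℝ × E` is linear in the image of `(1, 0)`. -/
theorem det_eq_of_border {E : Type*} [AddCommGroup E] [Module ℝ E] [FiniteDimensional ℝ E]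
    {f g₁ g₂ : (ℝ × E) →ₗ[ℝ] (ℝ × E)} {a b : ℝ} (h₁ : ∀ q, g₁ (0, q) = f (0, q))
    (h₂ : ∀ q, g₂ (0, q) = f (0, q)) (h : f (1, 0) = a • g₁ (1, 0) + b • g₂ (1, 0)) :
    LinearMap.det f = a * LinearMap.det g₁ + b * LinearMap.det g₂ := by
  let e := (Module.Basis.singleton Unit ℝ).prod (Module.finBasis ℝ E)
  have hdet : ∀ g : (ℝ × E) →ₗ[ℝ] (ℝ × E), LinearMap.det g = e.det (g ∘ e) := fun g => by
    rw [Module.Basis.det_comp, Module.Basis.det_self, mul_one]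
  have e0 : e (Sum.inl ()) = (1, 0) := by ext <;> simp [e]
  have e1 : ∀ i, e (Sum.inr i) = (0, Module.finBasis ℝ E i) := fun i => by ext <;> simp [e]
  have hupd : ∀ g : (ℝ × E) →ₗ[ℝ] (ℝ × E), (∀ q, g (0, q) = f (0, q)) →
      (g ∘ e : Unit ⊕ _ → ℝ × E) = Function.update (f ∘ e) (Sum.inl ()) (g (1, 0)) := by
    intro g hg
    funext i
    rcases i with ⟨⟩ | i
    · simp [e0]
    · simp [e1, hg]
  rw [hdet f, hdet g₁, hdet g₂, hupd g₁ h₁, hupd g₂ h₂, hupd f fun _ => rfl, h,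
    AlternatingMap.map_update_add, AlternatingMap.map_update_smul, AlternatingMap.map_update_smul]
  simp only [Function.update_idem, smul_eq_mul]

section Bordered

variable {N : ℕ} {V : Type*} [NormedAddCommGroup V] [InnerProductSpace ℝ V]
  (D : Coord N V →L[ℝ] Coord N V)

theorem borderedMap_zero (a b : ℝ) (q : ℝ × EuclideanSpace ℝ (Fin N)) :
    borderedMap D a b (0, q) = borderedMap D 0 0 (0, q) := by
  simp [borderedMap]

theorem det_borderedMap (a b : ℝ) : LinearMap.det (borderedMap D a b) =
    a * LinearMap.det (borderedMap D 1 0) + b * LinearMap.det (borderedMap D 0 1) := by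
  refine det_eq_of_border (fun q => ?_) (fun q => ?_) ?_
  · rw [borderedMap_zero D 1 0, borderedMap_zero D a b]
  · rw [borderedMap_zero D 0 1, borderedMap_zero D a b]
  · have : ((a, b, 0, 0, 0) : Coord N V) = a • ((1, 0, 0, 0, 0) : Coord N V) +
        b • ((0, 1, 0, 0, 0) : Coord N V) := by simp
    simp only [borderedMap, LinearMap.coe_mk, AddHom.coe_mk, one_mul, Prod.fst_zero,
      Prod.snd_zero, mul_zero]
    rw [this, map_add, map_smul, map_smul]
    rfl

variable {D} {xs : ℝ}

/-- The phase solves `Δ₁ cos φ = Δ₂ sin φ`: the bordered determinant vanishes in the direction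
of the spiral at the angle `-φ`. -/
theorem phase_spec (hxs : xs ≠ 0) (hD : A5 D xs) :
    LinearMap.det (borderedMap D (Real.cos (phase D xs)) (-Real.sin (phase D xs))) = 0 ∧
    LinearMap.det (borderedMap D (Real.sin (phase D xs)) (Real.cos (phase D xs))) ≠ 0 := by
  rw [det_borderedMap D (Real.cos _), det_borderedMap D (Real.sin _)]
  have key : ∀ d₁ d₂ φ : ℝ, d₁ ≠ 0 ∨ d₂ ≠ 0 → (d₂ = 0 → φ = Real.pi / 2) →
      (d₂ ≠ 0 → φ = Real.arctan (d₁ / d₂)) → Real.cos φ * d₁ + -Real.sin φ * d₂ = 0 ∧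
      Real.sin φ * d₁ + Real.cos φ * d₂ ≠ 0 := by
    intro d₁ d₂ φ hd h0 h1
    by_cases h : d₂ = 0
    · rw [h0 h]
      simp_all
    · rw [h1 h]
      have hc := Real.cos_arctan_pos (d₁ / d₂)
      have hs : Real.sin (Real.arctan (d₁ / d₂)) =
          d₁ / d₂ * Real.cos (Real.arctan (d₁ / d₂)) := by
        have := Real.tan_arctan (d₁ / d₂)
        rw [Real.tan_eq_sin_div_cos, div_eq_iff hc.ne'] at this
        exact this
      rw [hs]
      generalize Real.cos (Real.arctan (d₁ / d₂)) = c at hc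
      constructor
      · field_simp; ring
      · have e : d₁ / d₂ * c * d₁ + c * d₂ = c * (d₁ ^ 2 + d₂ ^ 2) / d₂ := by field_simp
        rw [e]
        have : 0 < d₁ ^ 2 + d₂ ^ 2 := by positivity
        positivity
  simp only [A5, Delta1, Delta2, ne_eq, mul_eq_zero, hxs, false_or] at hD
  refine key _ _ _ hD (fun h => ?_) (fun h => ?_)
  · simp [phase, Delta2, h]
  · rw [phase, if_neg (by simp [Delta2, hxs, h]), Delta1, Delta2, mul_div_mul_left _ _ hxs]

/-- The derivative of the leading order system with respect to the transit time and `(z, v⁺)` is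
invertible. -/
theorem det_borderedMap_tangent_ne_zero (hxs : xs ≠ 0) (hD : A5 D xs) (α : ℝ) {β : ℝ}
    (hβ : β ≠ 0) : LinearMap.det (borderedMap D
      (xs * (-α * Real.cos (phase D xs) + β * Real.sin (phase D xs)))
      (xs * (α * Real.sin (phase D xs) + β * Real.cos (phase D xs)))) ≠ 0 := by
  obtain ⟨h1, h2⟩ := phase_spec hxs hD
  rw [det_borderedMap] at h1 h2 ⊢
  generalize LinearMap.det (borderedMap D 1 0) = d₁ at h1 h2 ⊢
  generalize LinearMap.det (borderedMap D 0 1) = d₂ at h1 h2 ⊢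
  have e : xs * (-α * Real.cos (phase D xs) + β * Real.sin (phase D xs)) * d₁ +
      xs * (α * Real.sin (phase D xs) + β * Real.cos (phase D xs)) * d₂ =
      xs * β * (Real.sin (phase D xs) * d₁ + Real.cos (phase D xs) * d₂) := by
    linear_combination (-α * xs) * h1
  rw [e]
  exact mul_ne_zero (mul_ne_zero hxs hβ) h2

/-- The leading order system has a solution at the angle `-φ`. -/
theorem exists_borderedMap_eq_zero (hxs : xs ≠ 0) (hD : A5 D xs) :
    ∃ q : ℝ × EuclideanSpace ℝ (Fin N),
      borderedMap D (Real.cos (phase D xs)) (-Real.sin (phase D xs)) (xs, q) = 0 := by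
  obtain ⟨h1, h2⟩ := phase_spec hxs hD
  obtain ⟨⟨s, q⟩, hq, hne⟩ := (LinearMap.ker _).ne_bot_iff.1 (LinearMap.bot_lt_ker_of_det_eq_zero h1).ne'
  have hs : s ≠ 0 := by
    rintro rfl
    rw [LinearMap.mem_ker, borderedMap_zero,
      ← borderedMap_zero D (Real.sin (phase D xs)) (Real.cos (phase D xs))] at hq
    have := (LinearMap.equivOfDetNeZero _ h2).injective
      (a₁ := (0, q)) (a₂ := 0) (by rw [map_zero]; exact hq)
    exact hne this
  refine ⟨(xs / s) • q, ?_⟩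
  have : ((xs, (xs / s) • q) : ℝ × ℝ × EuclideanSpace ℝ (Fin N)) = (xs / s) • (s, q) := by
    ext <;> simp [div_mul_cancel₀ _ hs]
  rw [this, map_smul, LinearMap.mem_ker.1 hq, smul_zero]

end Bordered

/-! ### Equivariant fixed points of nearest-neighbour contractions -/

/-- A contraction that couples the values of a function at neighbouring points of the orbits of
`χ`, and depends on the point through a locally constant symbol, has a fixed point among the
continuous functions. -/
theorem exists_equivariant_fixedPoint {K I E : Type*} [TopologicalSpace K] [CompactSpace K]
    [TopologicalSpace I] [DiscreteTopology I] [MetricSpace E] [CompleteSpace E] [Nonempty E]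
    (χ : K ≃ₜ K) {m : K → I} (hm : Continuous m) {f : I × I × I → E × E × E → E}
    (hf : ∀ i, LipschitzWith (1 / 2) (f i)) :
    ∃ ξ : C(K, E), ∀ a,
      ξ a = f (m (χ.symm a), m a, m (χ a)) (ξ (χ.symm a), ξ a, ξ (χ a)) := by
  have hcont : Continuous fun q : (I × I × I) × (E × E × E) => f q.1 q.2 :=
    continuous_prod_of_discrete_left.2 fun i => (hf i).continuous
  let Ψ : C(K, E) → C(K, E) := fun ξ =>
    ⟨fun a => f (m (χ.symm a), m a, m (χ a)) (ξ (χ.symm a), ξ a, ξ (χ a)),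
      hcont.comp (by fun_prop : Continuous fun a =>
        ((m (χ.symm a), m a, m (χ a)), (ξ (χ.symm a), ξ a, ξ (χ a))))⟩
  have hΨ : ContractingWith (1 / 2) Ψ := by
    refine ⟨NNReal.half_lt_self one_ne_zero, LipschitzWith.of_dist_le_mul fun ξ ξ' => ?_⟩
    refine (ContinuousMap.dist_le (by positivity)).2 fun a => ?_
    refine ((hf _).dist_le_mul _ _).trans ?_
    gcongr
    simp only [Prod.dist_eq]
    exact max_le (ContinuousMap.dist_apply_le_dist _)
      (max_le (ContinuousMap.dist_apply_le_dist _) (ContinuousMap.dist_apply_le_dist _))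
  have : Nonempty C(K, E) := ⟨ContinuousMap.const K (Classical.arbitrary E)⟩
  refine ⟨hΨ.fixedPoint, fun a => ?_⟩
  exact (DFunLike.congr_fun hΨ.fixedPoint_isFixedPt a).symm

/-- The form of the contraction for transits: `y` is determined by the preceding point of the
orbit, and `u` by the same point and, weakly, by the following one. The map `f` need not contract
strongly in `y`, because the `y`-step is a strong contraction. -/
theorem exists_equivariant_solution {K I Q Y : Type*} [TopologicalSpace K] [CompactSpace K]
    [TopologicalSpace I] [DiscreteTopology I] [NormedAddCommGroup Q] [CompleteSpace Q]
    [NormedAddCommGroup Y] [CompleteSpace Y]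
    (χ : K ≃ₜ K) {m : K → I} (hm : Continuous m) {BQ : Set Q} {BY : Set Y}
    (hBQ : IsClosed BQ) (hBY : IsClosed BY) (hneQ : BQ.Nonempty) (hneY : BY.Nonempty)
    {f : I → Q → Y → Q} {g : I → Q → Y → Y} {r : I → I → Q → Q} {C c : ℝ} (hC : 0 ≤ C)
    (hc : c ≤ 1 / 2) (hcC : C * c ≤ 1 / 8)
    (hg : ∀ i, ∀ u ∈ BQ, ∀ y ∈ BY, g i u y ∈ BY)
    (hgl : ∀ i, ∀ u ∈ BQ, ∀ y ∈ BY, ∀ u' ∈ BQ, ∀ y' ∈ BY,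
      ‖g i u y - g i u' y'‖ ≤ c * max ‖u - u'‖ ‖y - y'‖)
    (hfr : ∀ i j, ∀ u ∈ BQ, ∀ y ∈ BY, ∀ u' ∈ BQ, f i u y + r i j u' ∈ BQ)
    (hfl : ∀ i, ∀ u ∈ BQ, ∀ y ∈ BY, ∀ u' ∈ BQ, ∀ y' ∈ BY,
      ‖f i u y - f i u' y'‖ ≤ 1 / 4 * ‖u - u'‖ + C * ‖y - y'‖)
    (hrl : ∀ i j, ∀ u ∈ BQ, ∀ u' ∈ BQ, ‖r i j u - r i j u'‖ ≤ 1 / 8 * ‖u - u'‖) :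
    ∃ (u : K → Q) (y : K → Y), Continuous u ∧ Continuous y ∧ (∀ a, u a ∈ BQ) ∧
      (∀ a, y a ∈ BY) ∧ (∀ a, y (χ a) = g (m a) (u a) (y a)) ∧
      ∀ a, u a = f (m a) (u a) (y a) + r (m a) (m (χ a)) (u (χ a)) := by
  have : CompleteSpace BQ := hBQ.completeSpace_coe
  have : CompleteSpace BY := hBY.completeSpace_coe
  have : Nonempty BQ := hneQ.to_subtype
  have : Nonempty BY := hneY.to_subtype
  let F : I × I × I → (BQ × BY) × (BQ × BY) × (BQ × BY) → BQ × BY := fun i q =>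
    (⟨f i.2.1 q.2.1.1 (g i.1 q.1.1 q.1.2) + r i.2.1 i.2.2 q.2.2.1,
        hfr _ _ _ q.2.1.1.2 _ (hg _ _ q.1.1.2 _ q.1.2.2) _ q.2.2.1.2⟩,
      ⟨g i.1 q.1.1 q.1.2, hg _ _ q.1.1.2 _ q.1.2.2⟩)
  have hF : ∀ i, LipschitzWith (1 / 2) (F i) := by
    rintro ⟨i, j, k⟩
    rw [lipschitzWith_iff_dist_le_mul]
    rintro ⟨⟨u₁, y₁⟩, ⟨u₂, y₂⟩, ⟨u₃, y₃⟩⟩ ⟨⟨u₁', y₁'⟩, ⟨u₂', y₂'⟩, ⟨u₃', y₃'⟩⟩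
    simp only [F, Prod.dist_eq, Subtype.dist_eq, dist_eq_norm]
    set d := max (max ‖(u₁ : Q) - u₁'‖ ‖(y₁ : Y) - y₁'‖)
      (max (max ‖(u₂ : Q) - u₂'‖ ‖(y₂ : Y) - y₂'‖) (max ‖(u₃ : Q) - u₃'‖ ‖(y₃ : Y) - y₃'‖)) with hd
    have hd0 : 0 ≤ d := (norm_nonneg _).trans ((le_max_left _ _).trans (le_max_left _ _))
    have h1 : max ‖(u₁ : Q) - u₁'‖ ‖(y₁ : Y) - y₁'‖ ≤ d := le_max_left _ _
    have h2 : ‖(u₂ : Q) - u₂'‖ ≤ d :=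
      (le_max_left _ _).trans ((le_max_left _ _).trans (le_max_right _ _))
    have h3 : ‖(u₃ : Q) - u₃'‖ ≤ d :=
      (le_max_left _ _).trans ((le_max_right _ _).trans (le_max_right _ _))
    have hm0 : 0 ≤ max ‖(u₁ : Q) - u₁'‖ ‖(y₁ : Y) - y₁'‖ :=
      (norm_nonneg _).trans (le_max_left _ _)
    have hgd := hgl i u₁ u₁.2 y₁ y₁.2 u₁' u₁'.2 y₁' y₁'.2
    have hgd2 : ‖g i u₁ y₁ - g i u₁' y₁'‖ ≤ 1 / 2 * d :=
      hgd.trans ((mul_le_mul_of_nonneg_right hc hm0).trans (by linarith))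
    have hfd := hfl j u₂ u₂.2 _ (hg i u₁ u₁.2 y₁ y₁.2) u₂' u₂'.2 _ (hg i u₁' u₁'.2 y₁' y₁'.2)
    have hrd := hrl j k u₃ u₃.2 u₃' u₃'.2
    have hCg : C * ‖g i u₁ y₁ - g i u₁' y₁'‖ ≤ 1 / 8 * d := by
      refine (mul_le_mul_of_nonneg_left hgd hC).trans ?_
      rw [← mul_assoc]
      exact (mul_le_mul_of_nonneg_right hcC hm0).trans (by linarith)
    have hsum : ‖f j u₂ (g i u₁ y₁) + r j k u₃ - (f j u₂' (g i u₁' y₁') + r j k u₃')‖ ≤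
        1 / 2 * d := by
      rw [add_sub_add_comm]
      refine (norm_add_le _ _).trans ?_
      linarith
    have e : ((1 / 2 : NNReal) : ℝ) = 1 / 2 := by norm_num
    rw [e]
    exact max_le hsum hgd2
  obtain ⟨ξ, hξ⟩ := exists_equivariant_fixedPoint χ hm hF
  have hy : ∀ a, ((ξ a).2 : Y) = g (m (χ.symm a)) (ξ (χ.symm a)).1 (ξ (χ.symm a)).2 := fun a =>
    congrArg (fun q : BQ × BY => (q.2 : Y)) (hξ a)
  refine ⟨fun a => (ξ a).1, fun a => (ξ a).2, by fun_prop, by fun_prop, fun a => (ξ a).1.2,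
    fun a => (ξ a).2.2, fun a => ?_, fun a => ?_⟩
  · have := hy (χ a)
    rwa [χ.symm_apply_apply] at this
  · have : ((ξ a).1 : Q) = f (m a) (ξ a).1 (g (m (χ.symm a)) (ξ (χ.symm a)).1 (ξ (χ.symm a)).2) +
        r (m a) (m (χ a)) (ξ (χ a)).1 := congrArg (fun q : BQ × BY => (q.1 : Q)) (hξ a)
    rwa [← hy a] at this

/-! ### The scaled transit equations -/

section Scaled

variable {Q Y X : Type*} [NormedAddCommGroup Q] [NormedSpace ℝ Q]
  [NormedAddCommGroup Y] [NormedSpace ℝ Y] [NormedAddCommGroup X] [NormedSpace ℝ X]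

/-- A map whose derivative at `(u₀, y₀)` vanishes in the direction of the first factor is, near
this point, a weak contraction in the first variable. -/
theorem _root_.HasStrictFDerivAt.exists_norm_sub_le_of_comp_inl_eq_zero {f : Q × Y → X}
    {f' : Q × Y →L[ℝ] X} {u₀ : Q} {y₀ : Y} (hf : HasStrictFDerivAt f f' (u₀, y₀))
    (hf' : ∀ u, f' (u, 0) = 0) {ε : ℝ} (hε : 0 < ε) :
    ∃ C ≥ 0, ∃ δ > 0, ∀ u u' y y', ‖u - u₀‖ ≤ δ → ‖u' - u₀‖ ≤ δ → ‖y - y₀‖ ≤ δ →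
      ‖y' - y₀‖ ≤ δ → ‖f (u, y) - f (u', y')‖ ≤ ε * ‖u - u'‖ + C * ‖y - y'‖ := by
  have h1 := hf.isLittleO.def hε
  obtain ⟨δ, hδ, h2⟩ := Metric.eventually_nhds_iff.1 h1
  refine ⟨‖f'‖ + ε, by positivity, δ / 2, half_pos hδ, fun u u' y y' hu hu' hy hy' => ?_⟩
  have h3 := h2 (y := ((u, y), (u', y'))) (by
    simp only [dist_eq_norm]
    exact (max_le (max_le hu hy) (max_le hu' hy')).trans_lt (half_lt_self hδ))
  have h4 : ((u, y) : Q × Y) - (u', y') = (u - u', y - y') := rfl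
  have h5 : f' (u - u', y - y') = f' (0, y - y') := by
    have : ((u - u', y - y') : Q × Y) = (u - u', 0) + (0, y - y') := by simp
    rw [this, map_add, hf', zero_add]
  simp only [h4, h5] at h3
  have h6 : ‖f' (0, y - y')‖ ≤ ‖f'‖ * ‖y - y'‖ := by
    refine (f'.le_opNorm _).trans (le_of_eq ?_)
    simp [Prod.norm_def]
  have h7 : ‖((u - u', y - y') : Q × Y)‖ ≤ ‖u - u'‖ + ‖y - y'‖ := by
    simp only [Prod.norm_def]
    exact max_le (by linarith [norm_nonneg (y - y')]) (by linarith [norm_nonneg (u - u')])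
  have h8 := norm_add_le (f (u, y) - f (u', y') - f' (0, y - y')) (f' (0, y - y'))
  rw [sub_add_cancel] at h8
  have h9 := mul_le_mul_of_nonneg_left h7 hε.le
  linarith

/-- Estimates for one step of the Newton-type iteration that solves `pu (G (w₀ + e g)) = 0` for
`u`, where `g = g₀ u y + s u y` and `s` is small, and for the `y`-component of `G`. For small `e`,
`e⁻¹ pu (G (w₀ + e g))` is a `C¹`-small perturbation of `pu (D (g₀ u y))`. -/
theorem exists_scaled_step_estimates {G : X → X} {D : X →L[ℝ] X} {w₀ : X}
    (hG : HasStrictFDerivAt G D w₀) {pu : X →L[ℝ] Q} {py : X →L[ℝ] Y} {g₀ : Q → Y → X}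
    {u₀ : Q} {y₀ : Y} {B C δ₀ : ℝ} (hB : 0 ≤ B) (hC : 0 ≤ C)
    (hgB : ∀ u y, ‖u - u₀‖ ≤ δ₀ → ‖y - y₀‖ ≤ δ₀ → ‖g₀ u y‖ ≤ B)
    (hgL : ∀ u u' y y', ‖u - u₀‖ ≤ δ₀ → ‖u' - u₀‖ ≤ δ₀ → ‖y - y₀‖ ≤ δ₀ → ‖y' - y₀‖ ≤ δ₀ →
      ‖g₀ u y - g₀ u' y'‖ ≤ B * max ‖u - u'‖ ‖y - y'‖)
    (hlin : ∀ u u' y y', ‖u - u₀‖ ≤ δ₀ → ‖u' - u₀‖ ≤ δ₀ → ‖y - y₀‖ ≤ δ₀ → ‖y' - y₀‖ ≤ δ₀ →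
      ‖(u - pu (D (g₀ u y))) - (u' - pu (D (g₀ u' y')))‖ ≤ 1 / 8 * ‖u - u'‖ + C * ‖y - y'‖)
    (h₀ : pu (D (g₀ u₀ y₀)) = 0) (hu₀ : pu (G w₀) = 0) (hy₀ : py (G w₀) = y₀)
    {δ δ' c : ℝ} (hδ : 0 < δ) (hδδ₀ : δ ≤ δ₀) (hδ' : 0 < δ') (hδ'δ₀ : δ' ≤ δ₀)
    (hCδ' : C * δ' ≤ δ / 8) (hc : 0 < c) {ρ : ℝ} (hρ : 0 < ρ) :
    ∃ κ > 0, ∀ (e : ℝ) (s : Q → Y → X) (BY : Set Y), e ≠ 0 → |e| ≤ κ →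
      BY ⊆ Metric.closedBall y₀ δ' →
      (∀ u y, ‖u - u₀‖ ≤ δ → y ∈ BY → ‖s u y‖ ≤ κ) →
      (∀ u u' y y', ‖u - u₀‖ ≤ δ → ‖u' - u₀‖ ≤ δ → y ∈ BY → y' ∈ BY →
        ‖s u y - s u' y'‖ ≤ κ * max ‖u - u'‖ ‖y - y'‖) →
      (∀ u y, ‖u - u₀‖ ≤ δ → y ∈ BY →
        ‖e • (g₀ u y + s u y)‖ ≤ (B + 1) * |e| ∧ ‖e • (g₀ u y + s u y)‖ < ρ ∧
        ‖py (G (w₀ + e • (g₀ u y + s u y))) - y₀‖ ≤ δ' ∧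
        ‖u - pu (e⁻¹ • G (w₀ + e • (g₀ u y + s u y))) - u₀‖ ≤ δ / 2) ∧
      ∀ u u' y y', ‖u - u₀‖ ≤ δ → ‖u' - u₀‖ ≤ δ → y ∈ BY → y' ∈ BY →
        ‖py (G (w₀ + e • (g₀ u y + s u y))) - py (G (w₀ + e • (g₀ u' y' + s u' y')))‖ ≤
          c * max ‖u - u'‖ ‖y - y'‖ ∧
        ‖(u - pu (e⁻¹ • G (w₀ + e • (g₀ u y + s u y)))) -
          (u' - pu (e⁻¹ • G (w₀ + e • (g₀ u' y' + s u' y'))))‖ ≤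
          1 / 4 * ‖u - u'‖ + (C + 1) * ‖y - y'‖ := by
  set b := ‖pu‖ with hb
  have hb0 : 0 ≤ b := norm_nonneg _
  set ν := min δ 1 / 16 with hν
  have hν0 : 0 < ν := by positivity
  obtain ⟨μ, hμ0, hμ1, hμ⟩ : ∃ μ > 0, μ ≤ 1 ∧ b * (μ * (B + 1)) ≤ ν := by
    refine ⟨min 1 (ν / ((b + 1) * (B + 1))), by positivity, min_le_left _ _, ?_⟩
    calc b * (min 1 (ν / ((b + 1) * (B + 1))) * (B + 1))
        ≤ (b + 1) * (ν / ((b + 1) * (B + 1)) * (B + 1)) := by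
          gcongr
          · linarith
          · exact min_le_right _ _
      _ = ν := by field_simp
  obtain ⟨ρ', hρ'0, hρ'⟩ : ∃ ρ' > 0, ∀ p q, ‖p - w₀‖ < ρ' → ‖q - w₀‖ < ρ' →
      ‖G p - G q - D (p - q)‖ ≤ μ * ‖p - q‖ := by
    obtain ⟨ρ', h1, h2⟩ := Metric.eventually_nhds_iff.1 (hG.isLittleO.def hμ0)
    refine ⟨ρ', h1, fun p q hp hq => h2 (y := (p, q)) ?_⟩
    simp only [dist_eq_norm]
    exact max_lt hp hq
  set m := min c δ' / ((‖py‖ + 1) * ((‖D‖ + 1) * (B + 1))) with hm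
  have hm0 : 0 < m := by positivity
  set κ := min (min 1 m) (min (min ρ ρ' / (2 * (B + 1))) (ν / (b * ‖D‖ + 1))) with hκ
  have hκ0 : 0 < κ := by positivity
  have hκ1 : κ ≤ 1 := (min_le_left _ _).trans (min_le_left _ _)
  have hκm : κ ≤ m := (min_le_left _ _).trans (min_le_right _ _)
  have hκρ : κ * (B + 1) < min ρ ρ' := by
    have : κ ≤ min ρ ρ' / (2 * (B + 1)) := (min_le_right _ _).trans (min_le_left _ _)
    rw [le_div_iff₀ (by positivity)] at this
    have h2 : 0 < κ * (B + 1) := by positivity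
    linarith
  have hκν : b * (‖D‖ * κ) ≤ ν := by
    have : κ ≤ ν / (b * ‖D‖ + 1) := (min_le_right _ _).trans (min_le_right _ _)
    rw [le_div_iff₀ (by positivity)] at this
    linarith
  refine ⟨κ, hκ0, fun e s BY he0 he hBY hs hsL => ?_⟩
  have hyδ₀ : ∀ y ∈ BY, ‖y - y₀‖ ≤ δ' := fun y hy => by
    have := hBY hy; rwa [Metric.mem_closedBall, dist_eq_norm] at this
  have hgn : ∀ u y, ‖u - u₀‖ ≤ δ → y ∈ BY → ‖g₀ u y + s u y‖ ≤ B + 1 := fun u y hu hy =>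
    (norm_add_le _ _).trans (add_le_add (hgB u y (hu.trans hδδ₀) ((hyδ₀ y hy).trans hδ'δ₀))
      ((hs u y hu hy).trans hκ1))
  have hen : ∀ u y, ‖u - u₀‖ ≤ δ → y ∈ BY → ‖e • (g₀ u y + s u y)‖ ≤ (B + 1) * |e| := by
    intro u y hu hy
    rw [norm_smul, Real.norm_eq_abs, mul_comm]
    exact mul_le_mul_of_nonneg_right (hgn u y hu hy) (abs_nonneg _)
  have heρ : ∀ u y, ‖u - u₀‖ ≤ δ → y ∈ BY → ‖e • (g₀ u y + s u y)‖ < min ρ ρ' := by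
    intro u y hu hy
    refine (hen u y hu hy).trans_lt (lt_of_le_of_lt ?_ hκρ)
    rw [mul_comm]
    exact mul_le_mul_of_nonneg_right he (by positivity)
  have hball : ∀ u y, ‖u - u₀‖ ≤ δ → y ∈ BY → ‖w₀ + e • (g₀ u y + s u y) - w₀‖ < ρ' := by
    intro u y hu hy
    rw [add_sub_cancel_left]
    exact (heρ u y hu hy).trans_le (min_le_right _ _)
  -- `G` is Lipschitz with constant `‖D‖ + 1` near `w₀`
  have hGL : ∀ p q, ‖p - w₀‖ < ρ' → ‖q - w₀‖ < ρ' → ‖G p - G q‖ ≤ (‖D‖ + 1) * ‖p - q‖ := by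
    intro p q hp hq
    have h1 := hρ' p q hp hq
    have h2 := norm_add_le (G p - G q - D (p - q)) (D (p - q))
    rw [sub_add_cancel] at h2
    have h3 := D.le_opNorm (p - q)
    have h4 := mul_le_mul_of_nonneg_right hμ1 (norm_nonneg (p - q))
    linarith
  have hmκ : ‖py‖ * ((‖D‖ + 1) * (κ * (B + 1))) ≤ min c δ' := by
    calc ‖py‖ * ((‖D‖ + 1) * (κ * (B + 1)))
        ≤ (‖py‖ + 1) * ((‖D‖ + 1) * (m * (B + 1))) := by
          gcongr; linarith
      _ = min c δ' := by rw [hm]; field_simp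
  -- the remainder in the `u`-equation
  have hrem : ∀ p q r : X, ∀ k : ℝ, ‖p - w₀‖ < ρ' → ‖q - w₀‖ < ρ' →
      ‖p - q‖ ≤ |e| * ((B + 1) * k) → ‖r‖ ≤ κ * k → 0 ≤ k →
      ‖pu (e⁻¹ • (G p - G q - D (p - q)) + D r)‖ ≤ min δ 1 / 8 * k := by
    intro p q r k hp hq hpq hr hk
    have h1 : ‖e⁻¹ • (G p - G q - D (p - q))‖ ≤ μ * (B + 1) * k := by
      rw [norm_smul, norm_inv, Real.norm_eq_abs, inv_mul_le_iff₀ (abs_pos.2 he0)]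
      calc ‖G p - G q - D (p - q)‖ ≤ μ * ‖p - q‖ := hρ' p q hp hq
        _ ≤ μ * (|e| * ((B + 1) * k)) := by gcongr
        _ = |e| * (μ * (B + 1) * k) := by ring
    have h2 : ‖D r‖ ≤ ‖D‖ * κ * k := (D.le_opNorm r).trans (by
      rw [mul_assoc]; exact mul_le_mul_of_nonneg_left hr (norm_nonneg _))
    calc ‖pu (e⁻¹ • (G p - G q - D (p - q)) + D r)‖
        ≤ b * (μ * (B + 1) * k + ‖D‖ * κ * k) :=
          (pu.le_opNorm _).trans (mul_le_mul_of_nonneg_left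
            ((norm_add_le _ _).trans (add_le_add h1 h2)) hb0)
      _ = (b * (μ * (B + 1)) + b * (‖D‖ * κ)) * k := by ring
      _ ≤ (ν + ν) * k := by gcongr
      _ = min δ 1 / 8 * k := by rw [hν]; ring
  have hsub : ∀ u u' y y', (w₀ + e • (g₀ u y + s u y)) - (w₀ + e • (g₀ u' y' + s u' y')) =
      e • ((g₀ u y - g₀ u' y') + (s u y - s u' y')) := by
    intro u u' y y'
    rw [add_sub_add_left_eq_sub, ← smul_sub, add_sub_add_comm]
  have hinv : ∀ z : X, e⁻¹ • D (e • z) = D z := fun z => by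
    rw [map_smul, smul_smul, inv_mul_cancel₀ he0, one_smul]
  refine ⟨fun u y hu hy => ⟨hen u y hu hy, (heρ u y hu hy).trans_le (min_le_left _ _), ?_, ?_⟩,
    fun u u' y y' hu hu' hy hy' => ⟨?_, ?_⟩⟩
  · rw [← hy₀, ← map_sub]
    refine (py.le_opNorm _).trans (le_trans ?_ (hmκ.trans (min_le_right _ _)))
    refine mul_le_mul_of_nonneg_left ?_ (norm_nonneg _)
    refine (hGL _ w₀ (hball u y hu hy) (by simpa using hρ'0)).trans ?_
    refine mul_le_mul_of_nonneg_left ?_ (by positivity)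
    rw [add_sub_cancel_left, mul_comm κ]
    exact (hen u y hu hy).trans (mul_le_mul_of_nonneg_left he (by positivity))
  · have h1 := hlin u u₀ y y₀ (hu.trans hδδ₀) (by simpa using hδ.le.trans hδδ₀)
      ((hyδ₀ y hy).trans hδ'δ₀) (by simpa using hδ.le.trans hδδ₀)
    have h2 := hrem (w₀ + e • (g₀ u y + s u y)) w₀ (s u y) 1 (hball u y hu hy)
      (by simpa using hρ'0) (by
        rw [add_sub_cancel_left, mul_one, mul_comm |e|]; exact hen u y hu hy)
      (by rw [mul_one]; exact hs u y hu hy) zero_le_one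
    have h3 : u - pu (e⁻¹ • G (w₀ + e • (g₀ u y + s u y))) - u₀ =
        ((u - pu (D (g₀ u y))) - (u₀ - pu (D (g₀ u₀ y₀)))) -
        pu (e⁻¹ • (G (w₀ + e • (g₀ u y + s u y)) - G w₀ - D (w₀ + e • (g₀ u y + s u y) - w₀)) +
          D (s u y)) := by
      rw [add_sub_cancel_left, smul_sub, hinv, smul_sub, map_add D]
      simp only [map_add, map_sub, map_smul, hu₀, h₀, smul_zero]
      abel
    rw [h3]
    refine (norm_sub_le _ _).trans ?_
    have h4 : C * ‖y - y₀‖ ≤ δ / 8 := (mul_le_mul_of_nonneg_left (hyδ₀ y hy) hC).trans hCδ'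
    have h5 := min_le_left δ 1
    linarith
  · rw [← map_sub]
    have hk : 0 ≤ max ‖u - u'‖ ‖y - y'‖ := (norm_nonneg _).trans (le_max_left _ _)
    calc _ ≤ ‖py‖ * ((‖D‖ + 1) * (κ * ((B + 1) * max ‖u - u'‖ ‖y - y'‖))) := by
          refine (py.le_opNorm _).trans (mul_le_mul_of_nonneg_left ?_ (norm_nonneg _))
          refine (hGL _ _ (hball u y hu hy) (hball u' y' hu' hy')).trans
            (mul_le_mul_of_nonneg_left ?_ (by positivity))
          rw [hsub, norm_smul, Real.norm_eq_abs]
          refine mul_le_mul he ((norm_add_le _ _).trans ?_) (norm_nonneg _) hκ0.le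
          have h1 := hgL u u' y y' (hu.trans hδδ₀) (hu'.trans hδδ₀) ((hyδ₀ y hy).trans hδ'δ₀)
            ((hyδ₀ y' hy').trans hδ'δ₀)
          have h2 := (hsL u u' y y' hu hu' hy hy').trans (mul_le_mul_of_nonneg_right hκ1 hk)
          linarith
      _ = ‖py‖ * ((‖D‖ + 1) * (κ * (B + 1))) * max ‖u - u'‖ ‖y - y'‖ := by ring
      _ ≤ c * max ‖u - u'‖ ‖y - y'‖ :=
          mul_le_mul_of_nonneg_right (hmκ.trans (min_le_left _ _)) hk
  · have hk : 0 ≤ max ‖u - u'‖ ‖y - y'‖ := (norm_nonneg _).trans (le_max_left _ _)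
    have h1 := hlin u u' y y' (hu.trans hδδ₀) (hu'.trans hδδ₀)
      ((hyδ₀ y hy).trans hδ'δ₀) ((hyδ₀ y' hy').trans hδ'δ₀)
    have h2 := hrem (w₀ + e • (g₀ u y + s u y)) (w₀ + e • (g₀ u' y' + s u' y'))
      (s u y - s u' y') (max ‖u - u'‖ ‖y - y'‖) (hball u y hu hy) (hball u' y' hu' hy') (by
        rw [hsub, norm_smul, Real.norm_eq_abs]
        refine mul_le_mul_of_nonneg_left ((norm_add_le _ _).trans ?_) (abs_nonneg _)
        have h1 := hgL u u' y y' (hu.trans hδδ₀) (hu'.trans hδδ₀) ((hyδ₀ y hy).trans hδ'δ₀)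
            ((hyδ₀ y' hy').trans hδ'δ₀)
        have h2 := (hsL u u' y y' hu hu' hy hy').trans (mul_le_mul_of_nonneg_right hκ1 hk)
        linarith) (hsL u u' y y' hu hu' hy hy') hk
    have h3 : (u - pu (e⁻¹ • G (w₀ + e • (g₀ u y + s u y)))) -
        (u' - pu (e⁻¹ • G (w₀ + e • (g₀ u' y' + s u' y')))) =
        ((u - pu (D (g₀ u y))) - (u' - pu (D (g₀ u' y')))) -
        pu (e⁻¹ • (G (w₀ + e • (g₀ u y + s u y)) - G (w₀ + e • (g₀ u' y' + s u' y')) -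
          D (w₀ + e • (g₀ u y + s u y) - (w₀ + e • (g₀ u' y' + s u' y')))) +
          D (s u y - s u' y')) := by
      rw [hsub, smul_sub, hinv, map_add D]
      simp only [map_add, map_sub, map_smul, smul_sub]
      abel
    rw [h3]
    refine (norm_sub_le _ _).trans ?_
    have h5 : min δ 1 / 8 * max ‖u - u'‖ ‖y - y'‖ ≤ 1 / 8 * (‖u - u'‖ + ‖y - y'‖) := by
      refine mul_le_mul (by linarith [min_le_right δ 1]) ?_ hk (by norm_num)
      exact max_le (by linarith [norm_nonneg (y - y')]) (by linarith [norm_nonneg (u - u')])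
    linarith [norm_nonneg (y - y')]

end Scaled

/-! ### Lipschitz estimates in time -/

section Lipschitz

theorem _root_.HasDerivAt.exists_norm_sub_le_Icc {F : Type*} [NormedAddCommGroup F]
    [NormedSpace ℝ F] {f : ℝ → F} {f' : F} (hf : HasDerivAt f f' 0) :
    ∃ C ≥ 0, ∃ s > 0, ∀ r ∈ Icc 0 s, ‖f r - f 0‖ ≤ C * r := by
  obtain ⟨C, hC, h⟩ := hf.differentiableAt.isBigO_sub.exists_pos
  obtain ⟨s, hs, h2⟩ := Metric.eventually_nhds_iff.1 h.bound
  refine ⟨C, hC.le, s / 2, half_pos hs, fun r hr => ?_⟩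
  have := h2 (y := r) (by
    rw [Real.dist_eq, sub_zero, abs_of_nonneg hr.1]; linarith [hr.2])
  rwa [sub_zero, Real.norm_eq_abs, abs_of_nonneg hr.1] at this

variable {N : ℕ} {V : Type*} [NormedAddCommGroup V] [InnerProductSpace ℝ V]
  {Lp : EuclideanSpace ℝ (Fin N) →L[ℝ] EuclideanSpace ℝ (Fin N)} {S : ℝ → V →L[ℝ] V}

/-- In time, the linear flow is Lipschitz at `0` up to its `v⁻`-component. -/
theorem exists_norm_linFlow_sub_le (α β γ : ℝ)
    (Lp : EuclideanSpace ℝ (Fin N) →L[ℝ] EuclideanSpace ℝ (Fin N)) (S : ℝ → V →L[ℝ] V) :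
    ∃ C ≥ 0, ∃ s₁ > 0, ∀ r ∈ Icc 0 s₁, ∀ w : Coord N V,
      ‖linFlow α β γ Lp S r w - w‖ ≤ C * r * ‖w‖ + ‖S r (cm w) - cm w‖ := by
  have h1 : HasDerivAt (fun r : ℝ => Real.exp (-α * r) * Real.cos (β * r)) _ 0 :=
    DifferentiableAt.hasDerivAt (by fun_prop)
  have h2 : HasDerivAt (fun r : ℝ => Real.exp (-α * r) * Real.sin (β * r)) _ 0 :=
    DifferentiableAt.hasDerivAt (by fun_prop)
  have h3 : HasDerivAt (fun r : ℝ => Real.exp (γ * r)) _ 0 :=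
    DifferentiableAt.hasDerivAt (by fun_prop)
  obtain ⟨C, hC, s₁, hs₁, h⟩ :=
    (h1.prodMk (h2.prodMk (h3.prodMk (hasDerivAt_exp_smul Lp 0)))).exists_norm_sub_le_Icc
  refine ⟨2 * C, by positivity, s₁, hs₁, fun r hr w => ?_⟩
  have h4 := h r hr
  simp only [Prod.norm_def, sup_le_iff, Prod.fst_sub, Prod.snd_sub, Real.norm_eq_abs, mul_zero,
    Real.exp_zero, Real.cos_zero, Real.sin_zero, mul_one, sub_zero] at h4
  obtain ⟨a1, a2, a3, a4⟩ := h4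
  have hCr : 0 ≤ C * r := mul_nonneg hC hr.1
  have hw := norm_nonneg w
  have hS := norm_nonneg (S r (cm w) - cm w)
  have key : ∀ a x : ℝ, |a| ≤ C * r → |x| ≤ ‖w‖ → |a * x| ≤ C * r * ‖w‖ := by
    intro a x ha hx
    rw [abs_mul]; exact mul_le_mul ha hx (abs_nonneg _) hCr
  have hle : C * r * ‖w‖ ≤ 2 * C * r * ‖w‖ + ‖S r (cm w) - cm w‖ := by
    have := mul_nonneg hCr hw; linarith
  refine norm_coord_le_iff.2 ⟨?_, ?_, ?_, ?_, ?_⟩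
  · have e : cx (linFlow α β γ Lp S r w - w) =
        (Real.exp (-α * r) * Real.cos (β * r) - 1) * cx w -
        Real.exp (-α * r) * Real.sin (β * r) * cy w := by
      change Real.exp (-α * r) * (Real.cos (β * r) * cx w - Real.sin (β * r) * cy w) - cx w = _
      ring
    rw [e]
    have := abs_sub ((Real.exp (-α * r) * Real.cos (β * r) - 1) * cx w)
      (Real.exp (-α * r) * Real.sin (β * r) * cy w)
    linarith [key _ _ a1 (abs_cx_le w), key _ _ a2 (abs_cy_le w)]
  · have e : cy (linFlow α β γ Lp S r w - w) =
        Real.exp (-α * r) * Real.sin (β * r) * cx w +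
        (Real.exp (-α * r) * Real.cos (β * r) - 1) * cy w := by
      change Real.exp (-α * r) * (Real.sin (β * r) * cx w + Real.cos (β * r) * cy w) - cy w = _
      ring
    rw [e]
    have := abs_add_le (Real.exp (-α * r) * Real.sin (β * r) * cx w)
      ((Real.exp (-α * r) * Real.cos (β * r) - 1) * cy w)
    linarith [key _ _ a2 (abs_cx_le w), key _ _ a1 (abs_cy_le w)]
  · have e : cz (linFlow α β γ Lp S r w - w) = (Real.exp (γ * r) - 1) * cz w := by
      change Real.exp (γ * r) * cz w - cz w = _
      ring
    rw [e]
    exact (key _ _ a3 (abs_cz_le w)).trans hle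
  · have e : cp (linFlow α β γ Lp S r w - w) =
        (NormedSpace.exp (r • Lp) - NormedSpace.exp ((0 : ℝ) • Lp)) (cp w) := by
      change NormedSpace.exp (r • Lp) (cp w) - cp w = _
      rw [sub_apply, exp_zero_smul]
    rw [e]
    refine (ContinuousLinearMap.le_opNorm _ _).trans (le_trans ?_ hle)
    exact mul_le_mul a4 (norm_cp_le w) (norm_nonneg _) hCr
  · have e : cm (linFlow α β γ Lp S r w - w) = S r (cm w) - cm w := rfl
    rw [e]
    have := mul_nonneg hCr hw
    linarith

/-- The vectors along whose orbit the semigroup `S` is Lipschitz at time `0`, with constant `K`.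
The semigroup is strongly continuous only; on this set `S t v` is Lipschitz in `t` as well. -/
def lipschitzVectors (S : ℝ → V →L[ℝ] V) (s₀ K : ℝ) : Set V :=
  {v | ∀ r ∈ Icc 0 s₀, ‖S r v - v‖ ≤ K * r}

theorem isClosed_lipschitzVectors (s₀ K : ℝ) : IsClosed (lipschitzVectors S s₀ K) := by
  have : lipschitzVectors S s₀ K = ⋂ (r : ℝ) (_ : r ∈ Icc 0 s₀), {v | ‖S r v - v‖ ≤ K * r} := by
    ext v; simp [lipschitzVectors]
  rw [this]
  exact isClosed_iInter fun r => isClosed_iInter fun _ =>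
    isClosed_le (by fun_prop) continuous_const

/-- An operator family with a bounded derivative depends on the parameter and on the vector in a
Lipschitz way. -/
theorem norm_apply_sub_apply_le {F : Type*} [NormedAddCommGroup F] [NormedSpace ℝ F]
    {A A' : ℝ → F →L[ℝ] F} {B θ θ' : ℝ} {J : Set ℝ} (hJ : Convex ℝ J)
    (hA : ∀ r ∈ J, HasDerivAt A (A' r) r) (hB : ∀ r ∈ J, ‖A r‖ ≤ B) (hB' : ∀ r ∈ J, ‖A' r‖ ≤ B)
    (hθ : θ ∈ J) (hθ' : θ' ∈ J) (a a' : F) :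
    ‖A θ a - A θ' a'‖ ≤ B * (‖a'‖ * |θ - θ'| + ‖a - a'‖) := by
  have h1 : ‖A θ - A θ'‖ ≤ B * ‖θ - θ'‖ := hJ.norm_image_sub_le_of_norm_hasDerivWithin_le
    (fun r hr => (hA r hr).hasDerivWithinAt) hB' hθ' hθ
  have h2 : A θ a - A θ' a' = (A θ - A θ') a' + A θ (a - a') := by
    rw [sub_apply, map_sub]; abel
  rw [h2]
  refine (norm_add_le _ _).trans ?_
  have h3 := ((A θ - A θ').le_opNorm a').trans (mul_le_mul_of_nonneg_right h1 (norm_nonneg _))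
  have h4 := ((A θ).le_opNorm (a - a')).trans
    (mul_le_mul_of_nonneg_right (hB θ hθ) (norm_nonneg _))
  rw [Real.norm_eq_abs] at h3
  linarith

end Lipschitz

namespace IsLocallyLinearFlow

variable {N : ℕ} {V : Type*} [NormedAddCommGroup V] [InnerProductSpace ℝ V]
  {Φ : ℝ → Coord N V → Coord N V} {Ω : Set (Coord N V)} {α β γ lm lp M : ℝ}
  {Lp : EuclideanSpace ℝ (Fin N) →L[ℝ] EuclideanSpace ℝ (Fin N)} {S : ℝ → V →L[ℝ] V}
variable (hf : IsLocallyLinearFlow Φ Ω α β γ lm lp M Lp S)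
include hf

theorem norm_S_sub_S_le {s₀ K t₀ t t' : ℝ} (ht₀ : 0 ≤ t₀) (ht : t₀ ≤ t) (ht' : t₀ ≤ t')
    (htt : |t - t'| ≤ s₀) {v v' : V} (hv : v ∈ lipschitzVectors S s₀ K)
    (hv' : v' ∈ lipschitzVectors S s₀ K) :
    ‖S t v - S t' v'‖ ≤ M * Real.exp (-lm * t₀) * (K * |t - t'| + ‖v - v'‖) := by
  have hM : 0 ≤ M := zero_le_one.trans hf.one_le_M
  have key : ∀ t t' : ℝ, t₀ ≤ t → t ≤ t' → t' - t ≤ s₀ → ∀ v v' : V,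
      v' ∈ lipschitzVectors S s₀ K →
      ‖S t v - S t' v'‖ ≤ M * Real.exp (-lm * t₀) * (K * (t' - t) + ‖v - v'‖) := by
    intro t t' ht htt hs v v' hv'
    have h1 : S t' v' = S t (S (t' - t) v') := by
      have := hf.S_add t (t' - t) (ht₀.trans ht) (by linarith)
      rw [add_sub_cancel] at this
      rw [this]; rfl
    have h2 : ‖S t‖ ≤ M * Real.exp (-lm * t₀) := (hf.S_bound t (ht₀.trans ht)).trans
      (mul_le_mul_of_nonneg_left (Real.exp_le_exp.2 (by
        have := mul_le_mul_of_nonneg_left ht (hf.α_pos.trans hf.α_lt_lm).le; linarith)) hM)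
    rw [h1, ← map_sub]
    refine ((S t).le_opNorm _).trans (mul_le_mul h2 ?_ (norm_nonneg _) (by positivity))
    have h3 : v - S (t' - t) v' = (v - v') - (S (t' - t) v' - v') := by abel
    rw [h3]
    refine (norm_sub_le _ _).trans ?_
    linarith [hv' (t' - t) ⟨by linarith, hs⟩]
  rcases le_total t t' with h | h
  · rw [abs_sub_comm, abs_of_nonneg (by linarith)] at htt ⊢
    exact key t t' ht h htt v v' hv'
  · rw [abs_of_nonneg (by linarith)] at htt ⊢
    rw [norm_sub_rev, norm_sub_rev v]
    exact key t' t ht' h htt v' v hv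

/-- The `v⁻`-component of the image under `Φ T` of a point close to `w₀` whose own `v⁻`-component
is nearly constant along the orbit of `S` is a Lipschitz vector: near `w₀` and near `Φ T w₀` the
flow is linear, and `Φ T` commutes with it. -/
theorem exists_mem_lipschitzVectors {w₀ : Coord N V} {T r₂ s₁ C₁ : ℝ} (hs₁ : 0 < s₁)
    (hC₁ : 0 ≤ C₁)
    (hlin : ∀ w, ‖w‖ < r₂ → ∀ s ∈ Icc 0 s₁, Φ s w = linFlow α β γ Lp S s w)
    (hC : ∀ r ∈ Icc 0 s₁, ∀ w : Coord N V,
      ‖linFlow α β γ Lp S r w - w‖ ≤ C₁ * r * ‖w‖ + ‖S r (cm w) - cm w‖)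
    (hw₀ : ‖w₀‖ < r₂) (hTw₀ : ‖Φ T w₀‖ < r₂) :
    ∃ K ≥ 0, ∃ s₀ > 0, ∃ ρ > 0, ∃ Λ ≥ 0,
      (∀ σ, ‖σ - w₀‖ < ρ → ‖Φ T σ - Φ T w₀‖ ≤ Λ * ‖σ - w₀‖) ∧
      ∀ σ, ‖σ - w₀‖ < ρ → (∀ r ∈ Icc 0 s₀, ‖S r (cm σ) - cm σ‖ ≤ r) →
        cm (Φ T σ) ∈ lipschitzVectors S s₀ K := by
  have hr₂ : 0 < r₂ := (norm_nonneg _).trans_lt hw₀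
  obtain ⟨Λ, U, hU, hΛ⟩ :=
    ((hf.smooth T).contDiffAt (x := w₀)).of_le (by norm_num) |>.exists_lipschitzOnWith
  obtain ⟨ρ₁, hρ₁, hρU⟩ := Metric.mem_nhds_iff.1 hU
  have hc2 : ∀ᶠ σ in 𝓝 w₀, ‖σ‖ < r₂ ∧ ‖Φ T σ‖ < r₂ :=
    (continuous_norm.continuousAt.eventually (gt_mem_nhds hw₀)).and
      (((hf.smooth T).continuous.norm).continuousAt.eventually (gt_mem_nhds hTw₀))
  obtain ⟨ρ₂, hρ₂, hball⟩ := Metric.eventually_nhds_iff.1 hc2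
  set ρ := min ρ₁ ρ₂ / 2 with hρ
  have hρ0 : 0 < ρ := by positivity
  set s₀ := min s₁ (ρ / (C₁ * r₂ + 1)) with hs₀
  refine ⟨Λ * (C₁ * r₂ + 1), by positivity, s₀, by positivity, ρ, hρ0, Λ, Λ.2, ?_, ?_⟩
  · intro σ hσ
    have h1 := hΛ.dist_le_mul σ (hρU (by
      rw [Metric.mem_ball, dist_eq_norm]; linarith [min_le_left ρ₁ ρ₂])) w₀ (mem_of_mem_nhds hU)
    rwa [dist_eq_norm, dist_eq_norm] at h1
  intro σ hσ hσS r hr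
  have hrs₁ : r ∈ Icc 0 s₁ := ⟨hr.1, hr.2.trans (min_le_left _ _)⟩
  have hb := hball (y := σ) (by rw [dist_eq_norm]; linarith [min_le_right ρ₁ ρ₂])
  have h1 : ‖linFlow α β γ Lp S r σ - σ‖ ≤ (C₁ * r₂ + 1) * r := by
    have h2 := hC r hrs₁ σ
    have h3 := hσS r hr
    have h4 : C₁ * r * ‖σ‖ ≤ C₁ * r * r₂ :=
      mul_le_mul_of_nonneg_left hb.1.le (mul_nonneg hC₁ hr.1)
    linarith
  have h5 : (C₁ * r₂ + 1) * r ≤ ρ := by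
    have := hr.2.trans (min_le_right _ _)
    rwa [le_div_iff₀ (by positivity), mul_comm] at this
  have h6 : ‖linFlow α β γ Lp S r σ - w₀‖ < 2 * ρ := by
    have := norm_add_le (linFlow α β γ Lp S r σ - σ) (σ - w₀)
    rw [sub_add_sub_cancel] at this
    linarith
  have h7 : S r (cm (Φ T σ)) - cm (Φ T σ) =
      cm (Φ T (linFlow α β γ Lp S r σ) - Φ T σ) := by
    rw [← hlin σ hb.1 r hrs₁, ← hf.add, add_comm, hf.add, hlin _ hb.2 r hrs₁]
    rfl
  rw [h7]
  refine (norm_cm_le _).trans ?_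
  have h8 := hΛ.dist_le_mul (linFlow α β γ Lp S r σ) (hρU (by
    rw [Metric.mem_ball, dist_eq_norm]; linarith [min_le_left ρ₁ ρ₂])) σ (hρU (by
    rw [Metric.mem_ball, dist_eq_norm]; linarith [min_le_left ρ₁ ρ₂]))
  rw [dist_eq_norm, dist_eq_norm] at h8
  refine h8.trans ?_
  rw [mul_assoc]
  exact mul_le_mul_of_nonneg_left h1 Λ.2

end IsLocallyLinearFlow

/-! ### Asymptotics for large transit times -/

/-- The leading order transit times `(iπ - φ) / β`. -/
def leadingTime (β φ : ℝ) (i : ℕ) : ℝ := ((i : ℝ) * Real.pi - φ) / β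

/-- The scale `(-1) ^ i e ^ (-αt)` of the deviations from `w⁻` at the end of a transit with the
leading order time `t`. The sign accounts for the half turns of the spiral. -/
def leadingScale (α β φ : ℝ) (i : ℕ) : ℝ := (-1) ^ i * Real.exp (-α * leadingTime β φ i)

section Asymptotics

variable {α β φ : ℝ}

theorem leadingScale_ne_zero (i : ℕ) : leadingScale α β φ i ≠ 0 :=
  mul_ne_zero (pow_ne_zero _ (by norm_num)) (Real.exp_pos _).ne'

theorem abs_leadingScale (i : ℕ) :
    |leadingScale α β φ i| = Real.exp (-α * leadingTime β φ i) := by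
  rw [leadingScale, abs_mul, abs_pow, abs_neg, abs_one, one_pow, one_mul, Real.abs_exp]

theorem abs_inv_leadingScale (i : ℕ) :
    |(leadingScale α β φ i)⁻¹| = Real.exp (α * leadingTime β φ i) := by
  rw [abs_inv, abs_leadingScale, ← Real.exp_neg, neg_mul, neg_neg]

theorem leadingTime_succ (i : ℕ) :
    leadingTime β φ (i + 1) = leadingTime β φ i + Real.pi / β := by
  simp only [leadingTime]; push_cast; ring

theorem leadingTime_mono (hβ : 0 < β) : Monotone (leadingTime β φ) :=
  monotone_nat_of_le_succ fun i => by
    rw [leadingTime_succ]; linarith [div_pos Real.pi_pos hβ]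

theorem tendsto_leadingTime (hβ : 0 < β) : Tendsto (leadingTime β φ) atTop atTop := by
  have h1 : Tendsto (fun i : ℕ => (i : ℝ) * Real.pi) atTop atTop :=
    tendsto_natCast_atTop_atTop.atTop_mul_const Real.pi_pos
  exact (tendsto_atTop_add_const_right _ (-φ) h1).atTop_div_const hβ

theorem tendsto_exp_leadingTime (hβ : 0 < β) {c : ℝ} (hc : 0 < c) (B : ℝ) :
    Tendsto (fun i => B * Real.exp (-c * leadingTime β φ i)) atTop (𝓝 0) := by
  have h1 : Tendsto (fun i => -c * leadingTime β φ i) atTop atBot :=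
    (tendsto_leadingTime hβ).const_mul_atTop_of_neg (neg_neg_of_pos hc)
  simpa using (Real.tendsto_exp_atBot.comp h1).const_mul B

theorem cos_leadingTime_add (hβ : 0 < β) (i : ℕ) (θ : ℝ) :
    Real.cos (β * (leadingTime β φ i + θ)) = (-1) ^ i * Real.cos (β * θ - φ) := by
  rw [← Real.cos_add_nat_mul_pi, leadingTime]
  congr 1
  field_simp
  ring

theorem sin_leadingTime_add (hβ : 0 < β) (i : ℕ) (θ : ℝ) :
    Real.sin (β * (leadingTime β φ i + θ)) = (-1) ^ i * Real.sin (β * θ - φ) := by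
  rw [← Real.sin_add_nat_mul_pi, leadingTime]
  congr 1
  field_simp
  ring

end Asymptotics

/-- The `(y, z, v⁺)`-components of a point of `Σ₀` with the `(z, v⁺)`-components
`q` at the end of its transit of duration `t`. -/
def entryComponents {N : ℕ} (γ : ℝ)
    (Lp : EuclideanSpace ℝ (Fin N) →L[ℝ] EuclideanSpace ℝ (Fin N)) (t : ℝ)
    (q : ℝ × EuclideanSpace ℝ (Fin N)) : ℝ × ℝ × EuclideanSpace ℝ (Fin N) :=
  (0, Real.exp (-γ * t) * q.1, NormedSpace.exp ((-t) • Lp) q.2)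

namespace IsLocallyLinearFlow

variable {N : ℕ} {V : Type*} [NormedAddCommGroup V] [InnerProductSpace ℝ V]
  {Φ : ℝ → Coord N V → Coord N V} {Ω : Set (Coord N V)} {α β γ lm lp M : ℝ}
  {Lp : EuclideanSpace ℝ (Fin N) →L[ℝ] EuclideanSpace ℝ (Fin N)} {S : ℝ → V →L[ℝ] V}
variable (hf : IsLocallyLinearFlow Φ Ω α β γ lm lp M Lp S)
include hf

/-- The `v⁻`-components at the end of a transit are small, and Lipschitz with a small constant,
relative to the scale of the transit, because `S` decays faster than the spiral. -/
theorem eventually_scaled_S_le (φ : ℝ) {s₀ K b κ : ℝ} (hK : 0 ≤ K)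
    (hκ : 0 < κ) : ∀ᶠ i in atTop, ∀ θ θ' : ℝ, |θ| ≤ 1 → |θ'| ≤ 1 → |θ - θ'| ≤ s₀ →
      ∀ v ∈ lipschitzVectors S s₀ K, ∀ v' ∈ lipschitzVectors S s₀ K, ‖v‖ ≤ b →
      ‖(leadingScale α β φ i)⁻¹ • S (leadingTime β φ i + θ) v‖ ≤ κ ∧
      ‖S (leadingTime β φ i + θ)‖ * K ≤ 1 ∧
      ‖(leadingScale α β φ i)⁻¹ • S (leadingTime β φ i + θ) v -
        (leadingScale α β φ i)⁻¹ • S (leadingTime β φ i + θ') v'‖ ≤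
        κ * max |θ - θ'| ‖v - v'‖ := by
  have hM : 0 < M := zero_lt_one.trans_le hf.one_le_M
  have hlm : 0 < lm := hf.α_pos.trans hf.α_lt_lm
  have h1 := (tendsto_exp_leadingTime (φ := φ) hf.β_pos (sub_pos.2 hf.α_lt_lm)
    (M * Real.exp lm * (max b 0 + K + 1))).eventually (gt_mem_nhds hκ)
  have h2 := (tendsto_exp_leadingTime (φ := φ) hf.β_pos hlm
    (M * Real.exp lm * K)).eventually (gt_mem_nhds zero_lt_one)
  filter_upwards [h1, h2, (tendsto_leadingTime (φ := φ) hf.β_pos).eventually_ge_atTop 1]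
    with i h1 h2 hti θ θ' hθ hθ' hθθ v hv v' hv' hvb
  set t := leadingTime β φ i with ht
  have hθ1 := abs_le.1 hθ
  have hθ1' := abs_le.1 hθ'
  have e1 : M * Real.exp (-lm * (t - 1)) = M * Real.exp lm * Real.exp (-lm * t) := by
    rw [mul_assoc, ← Real.exp_add]; ring_nf
  have hSn : ‖S (t + θ)‖ ≤ M * Real.exp lm * Real.exp (-lm * t) := by
    rw [← e1]
    refine (hf.S_bound _ (by linarith)).trans (mul_le_mul_of_nonneg_left ?_ hM.le)
    refine Real.exp_le_exp.2 ?_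
    have := mul_le_mul_of_nonneg_left (by linarith : t - 1 ≤ t + θ) hlm.le
    linarith
  have e2 : Real.exp (α * t) * Real.exp (-lm * t) = Real.exp (-(lm - α) * t) := by
    rw [← Real.exp_add]; ring_nf
  refine ⟨?_, ?_, ?_⟩
  · rw [norm_smul, Real.norm_eq_abs, abs_inv_leadingScale]
    have h3 := ((S (t + θ)).le_opNorm v).trans (mul_le_mul hSn (hvb.trans (le_max_left b 0))
      (norm_nonneg _) (by positivity))
    calc Real.exp (α * t) * ‖S (t + θ) v‖
        ≤ Real.exp (α * t) * (M * Real.exp lm * Real.exp (-lm * t) * max b 0) :=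
          mul_le_mul_of_nonneg_left h3 (Real.exp_pos _).le
      _ = M * Real.exp lm * max b 0 * Real.exp (-(lm - α) * t) := by rw [← e2]; ring
      _ ≤ M * Real.exp lm * (max b 0 + K + 1) * Real.exp (-(lm - α) * t) := by
          gcongr; linarith
      _ ≤ κ := h1.le
  · calc ‖S (t + θ)‖ * K ≤ M * Real.exp lm * Real.exp (-lm * t) * K :=
          mul_le_mul_of_nonneg_right hSn hK
      _ = M * Real.exp lm * K * Real.exp (-lm * t) := by ring
      _ ≤ 1 := h2.le
  · rw [← smul_sub, norm_smul, Real.norm_eq_abs, abs_inv_leadingScale]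
    have h3 := hf.norm_S_sub_S_le (t₀ := t - 1) (t := t + θ) (t' := t + θ') (by linarith)
      (by linarith) (by linarith) (by rwa [add_sub_add_left_eq_sub]) hv hv'
    rw [add_sub_add_left_eq_sub, e1] at h3
    have hm0 : 0 ≤ max |θ - θ'| ‖v - v'‖ := (abs_nonneg _).trans (le_max_left _ _)
    have h4 : K * |θ - θ'| + ‖v - v'‖ ≤ (max b 0 + K + 1) * max |θ - θ'| ‖v - v'‖ := by
      have a1 := mul_le_mul_of_nonneg_left (le_max_left |θ - θ'| ‖v - v'‖) hK
      have a2 := le_max_right |θ - θ'| ‖v - v'‖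
      have a3 := mul_nonneg (le_max_right b 0) hm0
      linarith
    calc Real.exp (α * t) * ‖S (t + θ) v - S (t + θ') v'‖
        ≤ Real.exp (α * t) * (M * Real.exp lm * Real.exp (-lm * t) *
            ((max b 0 + K + 1) * max |θ - θ'| ‖v - v'‖)) :=
          mul_le_mul_of_nonneg_left (h3.trans (mul_le_mul_of_nonneg_left h4 (by positivity)))
            (Real.exp_pos _).le
      _ = M * Real.exp lm * (max b 0 + K + 1) * Real.exp (-(lm - α) * t) *
            max |θ - θ'| ‖v - v'‖ := by rw [← e2]; ring
      _ ≤ κ * max |θ - θ'| ‖v - v'‖ := mul_le_mul_of_nonneg_right h1.le hm0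

/-- The `(z, v⁺)`-components at the start of a transit are small, and Lipschitz with a small
constant, relative to the scale of the preceding transit. -/
theorem eventually_scaled_entryComponents_le (φ : ℝ) (q₀ : ℝ × EuclideanSpace ℝ (Fin N))
    {b κ : ℝ} (hb : 0 ≤ b) (hκ : 0 < κ) :
    ∀ᶠ j in atTop, ∀ i ≤ j + 1, ∀ θ θ' : ℝ, |θ| ≤ 1 → |θ'| ≤ 1 →
      ∀ q q' : ℝ × EuclideanSpace ℝ (Fin N), ‖q‖ ≤ b → ‖q'‖ ≤ b →
      ‖(leadingScale α β φ i)⁻¹ • entryComponents γ Lp (leadingTime β φ j + θ)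
        (q₀ + leadingScale α β φ j • q)‖ ≤ κ ∧
      ‖(leadingScale α β φ i)⁻¹ • entryComponents γ Lp (leadingTime β φ j + θ)
          (q₀ + leadingScale α β φ j • q) -
        (leadingScale α β φ i)⁻¹ • entryComponents γ Lp (leadingTime β φ j + θ')
          (q₀ + leadingScale α β φ j • q')‖ ≤ κ * ‖(θ, q) - (θ', q')‖ := by
  have hM : 0 < M := zero_lt_one.trans_le hf.one_le_M
  have hγ : 0 < γ := hf.α_pos.trans hf.α_lt_γ
  set A := M * Real.exp γ * (1 + γ + ‖Lp‖) with hA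
  have hA0 : 0 < A := by positivity
  set A₂ := Real.exp (α * (Real.pi / β)) * (A * (‖q₀‖ + b + 1)) with hA₂
  have h1 := (tendsto_exp_leadingTime (φ := φ) hf.β_pos (sub_pos.2 hf.α_lt_γ) A₂).eventually
    (gt_mem_nhds hκ)
  filter_upwards [h1, (tendsto_leadingTime (φ := φ) hf.β_pos).eventually_ge_atTop 1]
    with j h1 htj i hij θ θ' hθ hθ' q q' hq hq'
  set t := leadingTime β φ j with ht
  set e := leadingScale α β φ j with he
  have he1 : |e| ≤ 1 := by
    rw [he, abs_leadingScale, Real.exp_le_one_iff]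
    have := mul_nonneg hf.α_pos.le (zero_le_one.trans htj); linarith
  have hei : |(leadingScale α β φ i)⁻¹| ≤ Real.exp (α * (Real.pi / β)) * Real.exp (α * t) := by
    rw [abs_inv_leadingScale, ← Real.exp_add]
    apply Real.exp_le_exp.2
    have h2 := leadingTime_mono (φ := φ) hf.β_pos hij
    rw [leadingTime_succ] at h2
    have := mul_le_mul_of_nonneg_left h2 hf.α_pos.le
    linarith
  have hqn : ∀ q : ℝ × EuclideanSpace ℝ (Fin N), ‖q‖ ≤ b → ‖q₀ + e • q‖ ≤ ‖q₀‖ + b := by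
    intro q hq
    refine (norm_add_le _ _).trans (add_le_add le_rfl ?_)
    rw [norm_smul, Real.norm_eq_abs]
    exact (mul_le_mul he1 hq (norm_nonneg _) zero_le_one).trans (by rw [one_mul])
  have hJ : Convex ℝ (Icc (-1 : ℝ) 1) := convex_Icc _ _
  have eA : Real.exp (-γ * (t - 1)) = Real.exp γ * Real.exp (-γ * t) := by
    rw [← Real.exp_add]; ring_nf
  -- the factor `e ^ (-γt)` of `z`
  have hz : ∀ θ θ' : ℝ, |θ| ≤ 1 → |θ'| ≤ 1 → ∀ a a' : ℝ,
      |Real.exp (-γ * (t + θ)) * a - Real.exp (-γ * (t + θ')) * a'| ≤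
        A * Real.exp (-γ * t) * (|a'| * |θ - θ'| + |a - a'|) := by
    intro θ θ' hθ hθ' a a'
    have hexp : ∀ r ∈ Icc (-1 : ℝ) 1, Real.exp (-γ * (t + r)) ≤ Real.exp γ * Real.exp (-γ * t) := by
      intro r hr
      rw [← eA]
      refine Real.exp_le_exp.2 ?_
      have := mul_le_mul_of_nonneg_left (by linarith [hr.1] : t - 1 ≤ t + r) hγ.le
      linarith
    have hAge : Real.exp γ * Real.exp (-γ * t) * (1 + γ) ≤ A * Real.exp (-γ * t) := by
      rw [hA]
      calc Real.exp γ * Real.exp (-γ * t) * (1 + γ)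
          = 1 * (Real.exp γ * Real.exp (-γ * t)) * (1 + γ + 0) := by ring
        _ ≤ M * (Real.exp γ * Real.exp (-γ * t)) * (1 + γ + ‖Lp‖) := by
            gcongr
            · exact hf.one_le_M
            · exact norm_nonneg _
        _ = _ := by ring
    have hd : ∀ r ∈ Icc (-1 : ℝ) 1, HasDerivAt
        (fun r : ℝ => Real.exp (-γ * (t + r)) • ContinuousLinearMap.id ℝ ℝ)
        ((Real.exp (-γ * (t + r)) * (-γ)) • ContinuousLinearMap.id ℝ ℝ) r := by
      intro r _
      have : HasDerivAt (fun r : ℝ => Real.exp (-γ * (t + r)))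
          (Real.exp (-γ * (t + r)) * (-γ)) r := by
        have := (((hasDerivAt_id r).const_add t).const_mul (-γ)).exp
        simpa using this
      exact this.smul_const (ContinuousLinearMap.id ℝ ℝ : ℝ →L[ℝ] ℝ)
    have := norm_apply_sub_apply_le (B := A * Real.exp (-γ * t)) hJ hd (fun r hr => ?_)
      (fun r hr => ?_) (abs_le.1 hθ) (abs_le.1 hθ') a a'
    · simpa using this
    · rw [norm_smul, ContinuousLinearMap.norm_id, mul_one, Real.norm_eq_abs, Real.abs_exp]
      refine (hexp r hr).trans (le_trans ?_ hAge)
      exact le_mul_of_one_le_right (by positivity) (by linarith)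
    · rw [norm_smul, ContinuousLinearMap.norm_id, mul_one, Real.norm_eq_abs, abs_mul, Real.abs_exp,
        abs_neg, abs_of_pos hγ]
      refine (mul_le_mul_of_nonneg_right (hexp r hr) hγ.le).trans (le_trans ?_ hAge)
      exact mul_le_mul_of_nonneg_left (by linarith) (by positivity)
  -- the factor `e ^ (-tLp)` of `v⁺`
  have hp : ∀ θ θ' : ℝ, |θ| ≤ 1 → |θ'| ≤ 1 → ∀ a a' : EuclideanSpace ℝ (Fin N),
      ‖NormedSpace.exp ((-(t + θ)) • Lp) a - NormedSpace.exp ((-(t + θ')) • Lp) a'‖ ≤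
        A * Real.exp (-γ * t) * (‖a'‖ * |θ - θ'| + ‖a - a'‖) := by
    intro θ θ' hθ hθ' a a'
    have hexp : ∀ r ∈ Icc (-1 : ℝ) 1, ‖NormedSpace.exp ((-(t + r)) • Lp)‖ ≤
        M * (Real.exp γ * Real.exp (-γ * t)) := by
      intro r hr
      refine (hf.Lp_bound (t + r) (by linarith [hr.1])).trans
        (mul_le_mul_of_nonneg_left ?_ hM.le)
      rw [← eA]
      refine Real.exp_le_exp.2 ?_
      have h2 := mul_le_mul_of_nonneg_left (by linarith [hr.1] : t - 1 ≤ t + r) hγ.le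
      have h3 := mul_le_mul_of_nonneg_right hf.γ_lt_lp.le (by linarith [hr.1] : 0 ≤ t + r)
      linarith
    have hd : ∀ r ∈ Icc (-1 : ℝ) 1, HasDerivAt
        (fun r : ℝ => NormedSpace.exp ((-(t + r)) • Lp))
        ((-1 : ℝ) • (NormedSpace.exp ((-(t + r)) • Lp) * Lp)) r := by
      intro r _
      have h2 : HasDerivAt (fun r : ℝ => -(t + r)) (-1) r := by
        exact ((hasDerivAt_id' r).const_add t).fun_neg
      exact (hasDerivAt_exp_smul Lp (-(t + r))).scomp r h2
    have hAge : M * (Real.exp γ * Real.exp (-γ * t)) * (1 + ‖Lp‖) ≤ A * Real.exp (-γ * t) := by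
      rw [hA]
      calc M * (Real.exp γ * Real.exp (-γ * t)) * (1 + ‖Lp‖)
          ≤ M * (Real.exp γ * Real.exp (-γ * t)) * (1 + γ + ‖Lp‖) := by
            gcongr; linarith
        _ = _ := by ring
    refine norm_apply_sub_apply_le hJ hd (fun r hr => ?_)
      (fun r hr => ?_) (abs_le.1 hθ) (abs_le.1 hθ') a a'
    · refine (hexp r hr).trans (le_trans ?_ hAge)
      exact le_mul_of_one_le_right (by positivity) (by linarith [norm_nonneg Lp])
    · rw [norm_smul, norm_neg, norm_one, one_mul]
      refine (norm_mul_le _ _).trans ((mul_le_mul_of_nonneg_right (hexp r hr)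
        (norm_nonneg _)).trans (le_trans ?_ hAge))
      exact mul_le_mul_of_nonneg_left (by linarith) (by positivity)
  -- combination of the two components
  have hcomb : ∀ θ θ' : ℝ, |θ| ≤ 1 → |θ'| ≤ 1 → ∀ a a' : ℝ × EuclideanSpace ℝ (Fin N),
      ‖entryComponents γ Lp (t + θ) a - entryComponents γ Lp (t + θ') a'‖ ≤
        A * Real.exp (-γ * t) * (‖a'‖ * |θ - θ'| + ‖a - a'‖) := by
    intro θ θ' hθ hθ' a a'
    have hA1 : 0 ≤ A * Real.exp (-γ * t) := by positivity
    have n1 : |a'.1| ≤ ‖a'‖ := norm_fst_le a'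
    have n2 : ‖a'.2‖ ≤ ‖a'‖ := norm_snd_le a'
    have n3 : |a.1 - a'.1| ≤ ‖a - a'‖ := norm_fst_le (a - a')
    have n4 : ‖a.2 - a'.2‖ ≤ ‖a - a'‖ := norm_snd_le (a - a')
    have h0 := abs_nonneg (θ - θ')
    simp only [entryComponents, Prod.norm_def, Prod.mk_sub_mk, sub_self, norm_zero, sup_le_iff]
    refine ⟨by positivity, (hz θ θ' hθ hθ' _ _).trans ?_, (hp θ θ' hθ hθ' _ _).trans ?_⟩
    · exact mul_le_mul_of_nonneg_left (add_le_add (mul_le_mul_of_nonneg_right n1 h0) n3) hA1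
    · exact mul_le_mul_of_nonneg_left (add_le_add (mul_le_mul_of_nonneg_right n2 h0) n4) hA1
  have eE : Real.exp (α * t) * Real.exp (-γ * t) = Real.exp (-(γ - α) * t) := by
    rw [← Real.exp_add]; ring_nf
  have hfin : ∀ x : ℝ × ℝ × EuclideanSpace ℝ (Fin N), ∀ k : ℝ, 0 ≤ k →
      ‖x‖ ≤ A * Real.exp (-γ * t) * ((‖q₀‖ + b + 1) * k) →
      ‖(leadingScale α β φ i)⁻¹ • x‖ ≤ κ * k := by
    intro x k hk hx
    rw [norm_smul, Real.norm_eq_abs]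
    calc |(leadingScale α β φ i)⁻¹| * ‖x‖
        ≤ (Real.exp (α * (Real.pi / β)) * Real.exp (α * t)) *
          (A * Real.exp (-γ * t) * ((‖q₀‖ + b + 1) * k)) :=
          mul_le_mul hei hx (norm_nonneg _) (by positivity)
      _ = A₂ * Real.exp (-(γ - α) * t) * k := by rw [← eE, hA₂]; ring
      _ ≤ κ * k := mul_le_mul_of_nonneg_right h1.le hk
  constructor
  · have h2 := hcomb θ θ hθ hθ (q₀ + e • q) 0
    have h3 : entryComponents γ Lp (t + θ) 0 = 0 := by simp [entryComponents]
    rw [h3, sub_zero, sub_self, abs_zero, mul_zero, zero_add, sub_zero] at h2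
    have := hfin _ 1 zero_le_one (h2.trans (mul_le_mul_of_nonneg_left (by
      linarith [hqn q hq]) (by positivity)))
    rwa [mul_one] at this
  · rw [← smul_sub]
    refine hfin _ _ (norm_nonneg _) ((hcomb θ θ' hθ hθ' _ _).trans
      (mul_le_mul_of_nonneg_left ?_ (by positivity)))
    have m1 : |θ - θ'| ≤ ‖(θ, q) - (θ', q')‖ := norm_fst_le ((θ, q) - (θ', q'))
    have m2 : ‖q - q'‖ ≤ ‖(θ, q) - (θ', q')‖ := norm_snd_le ((θ, q) - (θ', q'))
    have m3 : ‖q₀ + e • q - (q₀ + e • q')‖ ≤ ‖(θ, q) - (θ', q')‖ := by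
      rw [add_sub_add_left_eq_sub, ← smul_sub, norm_smul, Real.norm_eq_abs]
      exact (mul_le_mul he1 m2 (norm_nonneg _) zero_le_one).trans (by rw [one_mul])
    have m4 := mul_le_mul (hqn q' hq') m1 (abs_nonneg _) (by positivity)
    linarith

end IsLocallyLinearFlow

/-! ### The leading order system -/

section Leading

variable {N : ℕ} {V : Type*} [NormedAddCommGroup V] [InnerProductSpace ℝ V]

/-- The components of a point that the linear flow expands or that a section prescribes:
`y`, `z` and `v⁺`. -/
def transverseComponents (N : ℕ) (V : Type*) [NormedAddCommGroup V] [InnerProductSpace ℝ V] :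
    Coord N V →L[ℝ] ℝ × ℝ × EuclideanSpace ℝ (Fin N) :=
  let p₁ := ContinuousLinearMap.snd ℝ ℝ (ℝ × ℝ × EuclideanSpace ℝ (Fin N) × V)
  let p₂ := (ContinuousLinearMap.snd ℝ ℝ (ℝ × EuclideanSpace ℝ (Fin N) × V)).comp p₁
  let p₃ := (ContinuousLinearMap.snd ℝ ℝ (EuclideanSpace ℝ (Fin N) × V)).comp p₂
  ((ContinuousLinearMap.fst ℝ ℝ _).comp p₁).prod
    (((ContinuousLinearMap.fst ℝ ℝ _).comp p₂).prod
      ((ContinuousLinearMap.fst ℝ (EuclideanSpace ℝ (Fin N)) V).comp p₃))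

/-- The contracted components `x` and `v⁻` of a point of `Σ₀`. -/
def stableComponents (N : ℕ) (V : Type*) [NormedAddCommGroup V] [InnerProductSpace ℝ V] :
    Coord N V →L[ℝ] ℝ × V :=
  (ContinuousLinearMap.fst ℝ ℝ (ℝ × ℝ × EuclideanSpace ℝ (Fin N) × V)).prod
    ((ContinuousLinearMap.snd ℝ (EuclideanSpace ℝ (Fin N)) V).comp
      ((ContinuousLinearMap.snd ℝ ℝ (EuclideanSpace ℝ (Fin N) × V)).comp
        ((ContinuousLinearMap.snd ℝ ℝ (ℝ × EuclideanSpace ℝ (Fin N) × V)).comp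
          (ContinuousLinearMap.snd ℝ ℝ (ℝ × ℝ × EuclideanSpace ℝ (Fin N) × V)))))

theorem transverseComponents_apply (w : Coord N V) :
    transverseComponents N V w = (cy w, cz w, cp w) := rfl

/-- The deviation from `w⁻`, divided by its scale and up to the `v⁻`-component, at the end of a
transit that starts with the coordinate `x`. The unknown `u = (θ, z, v⁺)` consists of the
deviation of the transit time and the scaled deviations of `z` and `v⁺`. -/
def leadingDeviation (V : Type*) [NormedAddCommGroup V] (α β φ : ℝ)
    (u : ℝ × ℝ × EuclideanSpace ℝ (Fin N)) (x : ℝ) : Coord N V :=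
  (Real.exp (-α * u.1) * Real.cos (β * u.1 - φ) * x,
    Real.exp (-α * u.1) * Real.sin (β * u.1 - φ) * x, u.2.1, u.2.2, 0)

theorem contDiff_leadingDeviation (α β φ : ℝ) :
    ContDiff ℝ 1 fun q : (ℝ × ℝ × EuclideanSpace ℝ (Fin N)) × (ℝ × V) =>
      leadingDeviation V α β φ q.1 q.2.1 := by
  unfold leadingDeviation
  fun_prop

theorem hasFDerivAt_leadingDeviation (α β φ x : ℝ) (q : ℝ × EuclideanSpace ℝ (Fin N)) :
    ∃ L : (ℝ × ℝ × EuclideanSpace ℝ (Fin N)) →L[ℝ] Coord N V,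
      HasFDerivAt (fun u => leadingDeviation V α β φ u x) L (0, q) ∧ ∀ u, L u =
        (u.1 * (x * (-α * Real.cos φ + β * Real.sin φ)),
          u.1 * (x * (α * Real.sin φ + β * Real.cos φ)), u.2.1, u.2.2, 0) := by
  let p₁ := ContinuousLinearMap.fst ℝ ℝ (ℝ × EuclideanSpace ℝ (Fin N))
  let p₂ := ContinuousLinearMap.snd ℝ ℝ (ℝ × EuclideanSpace ℝ (Fin N))
  have he : HasDerivAt (fun θ : ℝ => Real.exp (-α * θ)) (-α) 0 := by
    simpa using ((hasDerivAt_id (0 : ℝ)).const_mul (-α)).exp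
  have hb : HasDerivAt (fun θ : ℝ => β * θ - φ) β 0 := by
    simpa using ((hasDerivAt_id (0 : ℝ)).const_mul β).sub_const φ
  have h1 := (he.mul hb.cos).mul_const x
  have h2 := (he.mul hb.sin).mul_const x
  have h1' := h1.comp_hasFDerivAt_of_eq (x := ((0 : ℝ), q)) p₁.hasFDerivAt rfl
  have h2' := h2.comp_hasFDerivAt_of_eq (x := ((0 : ℝ), q)) p₁.hasFDerivAt rfl
  have h3 : HasFDerivAt (fun u : ℝ × ℝ × EuclideanSpace ℝ (Fin N) => u.2.1)
      ((ContinuousLinearMap.fst ℝ ℝ _).comp p₂) (0, q) :=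
    ((ContinuousLinearMap.fst ℝ ℝ (EuclideanSpace ℝ (Fin N))).comp p₂).hasFDerivAt
  have h4 : HasFDerivAt (fun u : ℝ × ℝ × EuclideanSpace ℝ (Fin N) => u.2.2)
      ((ContinuousLinearMap.snd ℝ ℝ _).comp p₂) (0, q) :=
    ((ContinuousLinearMap.snd ℝ ℝ (EuclideanSpace ℝ (Fin N))).comp p₂).hasFDerivAt
  refine ⟨_, h1'.prodMk (h2'.prodMk (h3.prodMk (h4.prodMk (hasFDerivAt_const (0 : V) _)))),
    fun u => ?_⟩
  simp only [ContinuousLinearMap.prod_apply, mul_zero, zero_sub, Real.exp_zero, Real.cos_neg,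
    Real.sin_neg, neg_neg, one_mul]
  refine Prod.ext ?_ (Prod.ext ?_ rfl)
  · simp [p₁]; ring
  · simp [p₁]; ring

/-- The data for the Newton-type iteration: under the nondegeneracy condition on the bordered
determinants, the leading order system has a solution `(0, q)` at which its derivative with
respect to `u` is an isomorphism `A`. -/
theorem exists_leading_estimates (α : ℝ) {β xs : ℝ} (hβ : β ≠ 0) (hxs : xs ≠ 0) (vs : V)
    {D : Coord N V →L[ℝ] Coord N V} (hD : A5 D xs) :
    ∃ (A : (ℝ × ℝ × EuclideanSpace ℝ (Fin N)) ≃L[ℝ] (ℝ × ℝ × EuclideanSpace ℝ (Fin N)))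
      (q₀ : ℝ × EuclideanSpace ℝ (Fin N)) (B C δ₀ : ℝ), 0 ≤ B ∧ 0 ≤ C ∧ 0 < δ₀ ∧
      transverseComponents N V (D (leadingDeviation V α β (phase D xs) (0, q₀) xs)) = 0 ∧
      ∀ u u' : ℝ × ℝ × EuclideanSpace ℝ (Fin N), ∀ y y' : ℝ × V,
        ‖u - (0, q₀)‖ ≤ δ₀ → ‖u' - (0, q₀)‖ ≤ δ₀ → ‖y - (xs, vs)‖ ≤ δ₀ → ‖y' - (xs, vs)‖ ≤ δ₀ →
        ‖leadingDeviation V α β (phase D xs) u y.1‖ ≤ B ∧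
        ‖leadingDeviation V α β (phase D xs) u y.1 -
          leadingDeviation V α β (phase D xs) u' y'.1‖ ≤ B * max ‖u - u'‖ ‖y - y'‖ ∧
        ‖(u - A.symm (transverseComponents N V
              (D (leadingDeviation V α β (phase D xs) u y.1)))) -
          (u' - A.symm (transverseComponents N V
              (D (leadingDeviation V α β (phase D xs) u' y'.1))))‖ ≤
          1 / 8 * ‖u - u'‖ + C * ‖y - y'‖ := by
  set φ := phase D xs with hφ
  have hdet := det_borderedMap_tangent_ne_zero hxs hD α hβ
  obtain ⟨q₀, hq₀⟩ := exists_borderedMap_eq_zero hxs hD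
  rw [← hφ] at hdet hq₀
  let A := (LinearMap.equivOfDetNeZero _ hdet).toContinuousLinearEquiv
  have hA : ∀ u, A u = borderedMap D (xs * (-α * Real.cos φ + β * Real.sin φ))
      (xs * (α * Real.sin φ + β * Real.cos φ)) u := fun u => rfl
  let g : (ℝ × ℝ × EuclideanSpace ℝ (Fin N)) × (ℝ × V) → Coord N V := fun q =>
    leadingDeviation V α β φ q.1 q.2.1
  have hg : ContDiff ℝ 1 g := contDiff_leadingDeviation α β φ
  let Ψ : Coord N V →L[ℝ] (ℝ × ℝ × EuclideanSpace ℝ (Fin N)) :=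
    (A.symm : _ →L[ℝ] _).comp ((transverseComponents N V).comp D)
  let f : (ℝ × ℝ × EuclideanSpace ℝ (Fin N)) × (ℝ × V) → ℝ × ℝ × EuclideanSpace ℝ (Fin N) :=
    fun q => q.1 - Ψ (g q)
  have hfc : ContDiff ℝ 1 f := contDiff_fst.sub (Ψ.contDiff.comp hg)
  have hfs := (hfc.contDiffAt (x := (((0 : ℝ), q₀), (xs, vs)))).hasStrictFDerivAt one_ne_zero
  have hf' : ∀ u, fderiv ℝ f ((0, q₀), (xs, vs)) (u, 0) = 0 := by
    intro u
    obtain ⟨L, hL, hLu⟩ := hasFDerivAt_leadingDeviation (V := V) α β φ xs q₀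
    have h1 : HasFDerivAt (fun u => f (u, (xs, vs)))
        (ContinuousLinearMap.id ℝ _ - Ψ.comp L) (0, q₀) :=
      (hasFDerivAt_id _).sub (Ψ.hasFDerivAt.comp _ hL)
    have h2 : HasFDerivAt (fun u => f (u, (xs, vs)))
        ((fderiv ℝ f ((0, q₀), (xs, vs))).comp (ContinuousLinearMap.inl ℝ _ _)) (0, q₀) :=
      HasFDerivAt.comp (g := f) (f := fun u => (u, (xs, vs))) ((0 : ℝ), q₀) hfs.hasFDerivAt
        (hasFDerivAt_prodMk_left _ _)
    have h3 := DFunLike.congr_fun (h1.unique h2) u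
    change u - Ψ (L u) = fderiv ℝ f ((0, q₀), (xs, vs)) (u, 0) at h3
    rw [← h3, hLu]
    have h4 : Ψ (u.1 * (xs * (-α * Real.cos φ + β * Real.sin φ)),
        u.1 * (xs * (α * Real.sin φ + β * Real.cos φ)), u.2.1, u.2.2, 0) = A.symm (A u) := rfl
    rw [h4, A.symm_apply_apply, sub_self]
  obtain ⟨C, hC, δ₁, hδ₁, hCf⟩ :=
    hfs.exists_norm_sub_le_of_comp_inl_eq_zero hf' (by norm_num : (0 : ℝ) < 1 / 8)
  obtain ⟨Λ, U, hU, hΛ⟩ :=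
    (hg.contDiffAt (x := (((0 : ℝ), q₀), (xs, vs)))).exists_lipschitzOnWith
  obtain ⟨δ₂, hδ₂, hδU⟩ := Metric.mem_nhds_iff.1 hU
  have hbd : ∀ᶠ q in 𝓝 (((0 : ℝ), q₀), (xs, vs)), ‖g q‖ < ‖g ((0, q₀), (xs, vs))‖ + 1 :=
    hg.continuous.norm.continuousAt.eventually (gt_mem_nhds (lt_add_one _))
  obtain ⟨δ₃, hδ₃, hbd⟩ := Metric.eventually_nhds_iff.1 hbd
  have hdist : ∀ (u : ℝ × ℝ × EuclideanSpace ℝ (Fin N)) (y : ℝ × V) (r : ℝ),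
      ‖u - (0, q₀)‖ < r → ‖y - (xs, vs)‖ < r → dist (u, y) ((0, q₀), (xs, vs)) < r := by
    intro u y r hu hy
    rw [Prod.dist_eq, dist_eq_norm, dist_eq_norm]
    exact max_lt hu hy
  set δ₀ := min δ₁ (min δ₂ δ₃ / 2) with hδ₀
  have hm := half_lt_self (lt_min hδ₂ hδ₃)
  have hd2 : δ₀ < δ₂ := (min_le_right _ _).trans_lt (hm.trans_le (min_le_left _ _))
  have hd3 : δ₀ < δ₃ := (min_le_right _ _).trans_lt (hm.trans_le (min_le_right _ _))
  have hd1 : δ₀ ≤ δ₁ := min_le_left _ _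
  refine ⟨A, q₀, max Λ (‖g ((0, q₀), (xs, vs))‖ + 1), C, δ₀, le_max_of_le_left Λ.2, hC,
    by positivity, ?_, fun u u' y y' hu hu' hy hy' => ⟨?_, ?_, ?_⟩⟩
  · rw [← hq₀]
    simp only [leadingDeviation, borderedMap, LinearMap.coe_mk, AddHom.coe_mk,
      transverseComponents_apply]
    simp [mul_comm xs]
  · exact (hbd (hdist u y _ (hu.trans_lt hd3) (hy.trans_lt hd3))).le.trans (le_max_right _ _)
  · have h1 := hΛ.dist_le_mul (u, y) (hδU (hdist u y _ (hu.trans_lt hd2) (hy.trans_lt hd2)))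
      (u', y') (hδU (hdist u' y' _ (hu'.trans_lt hd2) (hy'.trans_lt hd2)))
    rw [Prod.dist_eq, dist_eq_norm, dist_eq_norm, dist_eq_norm] at h1
    exact h1.trans (mul_le_mul_of_nonneg_right (le_max_left _ _)
      ((norm_nonneg _).trans (le_max_left _ _)))
  · exact hCf u u' y y' (hu.trans hd1) (hu'.trans hd1) (hy.trans hd1) (hy'.trans hd1)

end Leading

/-! ### Points with a prescribed transit -/

section Entry

variable {N : ℕ} {V : Type*} [NormedAddCommGroup V] [InnerProductSpace ℝ V]
  {Φ : ℝ → Coord N V → Coord N V} {Ω : Set (Coord N V)} {α β γ lm lp M : ℝ}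
  {Lp : EuclideanSpace ℝ (Fin N) →L[ℝ] EuclideanSpace ℝ (Fin N)} {S : ℝ → V →L[ℝ] V}

/-- The point of the plane `{y = 0}` with given coordinates `x` and `v⁻`, which arrives with the
`(z, v⁺)`-components `q` after the time `t`. -/
def entryPoint (γ : ℝ) (Lp : EuclideanSpace ℝ (Fin N) →L[ℝ] EuclideanSpace ℝ (Fin N)) (t x : ℝ)
    (q : ℝ × EuclideanSpace ℝ (Fin N)) (v : V) : Coord N V :=
  (x, 0, Real.exp (-γ * t) * q.1, NormedSpace.exp ((-t) • Lp) q.2, v)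

theorem linFlow_entryPoint (s t x : ℝ) (q : ℝ × EuclideanSpace ℝ (Fin N)) (v : V) :
    linFlow α β γ Lp S s (entryPoint γ Lp t x q v) =
      (Real.exp (-α * s) * (Real.cos (β * s) * x), Real.exp (-α * s) * (Real.sin (β * s) * x),
        Real.exp (-γ * (t - s)) * q.1, NormedSpace.exp ((-(t - s)) • Lp) q.2, S s v) := by
  have h1 : Real.exp (-γ * (t - s)) = Real.exp (γ * s) * Real.exp (-γ * t) := by
    rw [← Real.exp_add]; ring_nf
  have h2 : -(t - s) = s + -t := by ring
  simp only [linFlow, entryPoint, cx, cy, cz, cp, cm, mul_zero, sub_zero, add_zero, h1, h2,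
    exp_smul_add, mul_assoc]

theorem norm_linFlow_entryPoint_lt (hf : IsLocallyLinearFlow Φ Ω α β γ lm lp M Lp S)
    {s t x r : ℝ} {q : ℝ × EuclideanSpace ℝ (Fin N)} {v : V} (hs : s ∈ Icc 0 t) (hx : |x| < r)
    (hq : ‖q‖ < r) (hv : ‖v‖ < r) :
    ‖linFlow α β γ Lp S s (entryPoint γ Lp t x q v)‖ < M * r := by
  have hr : 0 < r := (norm_nonneg _).trans_lt hq
  have hM : 0 < M := zero_lt_one.trans_le hf.one_le_M
  have hrM : r ≤ M * r := le_mul_of_one_le_left hr.le hf.one_le_M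
  have hq1 : |q.1| < r := (norm_fst_le q).trans_lt hq
  have hq2 : ‖q.2‖ < r := (norm_snd_le q).trans_lt hq
  have he : |Real.exp (-α * s)| ≤ 1 := by
    rw [Real.abs_exp, Real.exp_le_one_iff]
    have := mul_nonneg hf.α_pos.le hs.1; linarith
  have htrig : ∀ c : ℝ, |c| ≤ 1 → |Real.exp (-α * s) * (c * x)| < M * r := by
    intro c hc
    rw [abs_mul, abs_mul]
    calc _ ≤ 1 * (1 * |x|) := mul_le_mul he
          (mul_le_mul_of_nonneg_right hc (abs_nonneg _)) (by positivity) zero_le_one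
      _ < M * r := by linarith
  rw [linFlow_entryPoint]
  refine norm_coord_lt_iff.2 ⟨htrig _ (Real.abs_cos_le_one _), htrig _ (Real.abs_sin_le_one _),
    ?_, ?_, ?_⟩
  · simp only [cz]
    rw [abs_mul]
    refine (mul_le_of_le_one_left (abs_nonneg _) ?_).trans_lt (hq1.trans_le hrM)
    rw [Real.abs_exp, Real.exp_le_one_iff]
    have := mul_nonneg (hf.α_pos.trans hf.α_lt_γ).le (sub_nonneg.2 hs.2); linarith
  · exact (ContinuousLinearMap.le_opNorm _ _).trans_lt
      ((mul_le_mul_of_nonneg_right (hf.norm_exp_neg_le (sub_nonneg.2 hs.2))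
        (norm_nonneg _)).trans_lt (mul_lt_mul_of_pos_left hq2 hM))
  · exact (ContinuousLinearMap.le_opNorm _ _).trans_lt
      ((mul_le_mul_of_nonneg_right (hf.norm_S_le hs.1) (norm_nonneg _)).trans_lt
        (mul_lt_mul_of_pos_left hv hM))

end Entry

/-! ### Families of transits -/

namespace IsLocallyLinearFlow

variable {N : ℕ} {V : Type*} [NormedAddCommGroup V] [InnerProductSpace ℝ V]
  {Φ : ℝ → Coord N V → Coord N V} {Ω : Set (Coord N V)} {α β γ lm lp M : ℝ}
  {Lp : EuclideanSpace ℝ (Fin N) →L[ℝ] EuclideanSpace ℝ (Fin N)} {S : ℝ → V →L[ℝ] V}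

theorem S_comm (hf : IsLocallyLinearFlow Φ Ω α β γ lm lp M Lp S) {r t : ℝ} (hr : 0 ≤ r)
    (ht : 0 ≤ t) (v : V) : S r (S t v) = S t (S r v) := by
  have h1 := DFunLike.congr_fun (hf.S_add r t hr ht) v
  have h2 := DFunLike.congr_fun (hf.S_add t r ht hr) v
  rw [add_comm] at h2
  exact h1.symm.trans h2

variable [CompleteSpace V]

/-- Over any compact dynamical system `χ : K → K`, and for any locally constant choice of
consecutive large numbers `m a` of half turns, there is a continuous family of points of `Σ₀`
with transit times close to `(m a * π - φ) / β`, on which the return map acts as `χ`. -/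
theorem exists_transit_family (hf : IsLocallyLinearFlow Φ Ω α β γ lm lp M Lp S)
    {r₀ r₂ s₁ C₁ η T δs : ℝ} (hball : Metric.ball 0 r₀ ⊆ Ω) (hMr : M * r₂ ≤ r₀) (hs₁ : 0 < s₁)
    (hC₁ : 0 ≤ C₁) (hlin : ∀ w, ‖w‖ < r₂ → ∀ s ∈ Icc 0 s₁, Φ s w = linFlow α β γ Lp S s w)
    (hC : ∀ r ∈ Icc 0 s₁, ∀ w : Coord N V,
      ‖linFlow α β γ Lp S r w - w‖ ≤ C₁ * r * ‖w‖ + ‖S r (cm w) - cm w‖)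
    (hT : 0 < T) (hη : 0 < η) {w₀ : Coord N V} (hx₀ : cx w₀ = 0) (hy₀ : cy w₀ = 0)
    (hz₀ : cz w₀ = η) (hv₀ : cm w₀ = 0) (hy₁ : cy (Φ T w₀) = 0) (hz₁ : cz (Φ T w₀) = 0)
    (hp₁ : cp (Φ T w₀) = 0)
    (hx₁ : cx (Φ T w₀) ∈ Ioo (η * Real.exp (-2 * Real.pi * α / β)) η)
    (hv₁ : ‖cm (Φ T w₀)‖ < η) (hw₀ : ‖w₀‖ < r₂) (hw₁ : ‖Φ T w₀‖ < r₂)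
    (hA5 : A5 (fderiv ℝ (Φ T) w₀) (cx (Φ T w₀))) (hδs : 0 < δs)
    (havoid : ∀ σ, dist σ w₀ < δs → cy (Φ T σ) = 0 →
        η * Real.exp (-2 * Real.pi * α / β) < cx (Φ T σ) →
        ∀ r ∈ Ioo 0 T, Φ r σ ∉ Sigma0Plus α β η) :
    ∃ C ≥ 0, ∀ δ > 0, ∀ᶠ n : ℕ in atTop, ∀ (K : Type) [TopologicalSpace K] [CompactSpace K]
      (χ : K ≃ₜ K) (m : K → ℕ), Continuous m → (∀ a, m a = n ∨ m a = n + 1) →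
      ∃ (w : K → Coord N V) (t : K → ℝ), Continuous w ∧ ∀ a,
        IsTransit Φ Ω α β γ η T Lp S (w a) (t a) ∧ w (χ a) = Φ T (Φ (t a) (w a)) ∧
        |t a - leadingTime β (phase (fderiv ℝ (Φ T) w₀) (cx (Φ T w₀))) (m a)| ≤ δ ∧
        ‖w a - Φ T w₀‖ ≤ C * Real.exp
          (-α * leadingTime β (phase (fderiv ℝ (Φ T) w₀) (cx (Φ T w₀))) n) ∧
        ‖Φ (t a) (w a) - w₀‖ ≤ C * Real.exp
          (-α * leadingTime β (phase (fderiv ℝ (Φ T) w₀) (cx (Φ T w₀))) n) := by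
  set D := fderiv ℝ (Φ T) w₀ with hD
  set w₁ := Φ T w₀ with hw₁def
  set xs := cx w₁ with hxs
  set vs := cm w₁ with hvs
  set ps := cp w₀ with hps
  set φ := phase D xs with hφ
  have hm : 0 < η * Real.exp (-2 * Real.pi * α / β) := mul_pos hη (Real.exp_pos _)
  have hxs0 : 0 < xs := hm.trans hx₁.1
  have hr₂ : 0 < r₂ := (norm_nonneg _).trans_lt hw₀
  have hr₂₀ : r₂ ≤ r₀ := (le_mul_of_one_le_left hr₂.le hf.one_le_M).trans hMr
  have hG : HasStrictFDerivAt (Φ T) D w₀ :=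
    (hf.smooth T).contDiffAt.hasStrictFDerivAt two_ne_zero
  obtain ⟨A, q₀, B, C, δ₀, hB, hC0, hδ₀, hlead0, hlead⟩ :=
    exists_leading_estimates α hf.β_pos.ne' hxs0.ne' vs hA5
  rw [← hφ] at hlead0 hlead
  obtain ⟨K, hK, s₀, hs₀, ρ₁, hρ₁, Λ, hΛ, hLip, hmemLip⟩ :=
    hf.exists_mem_lipschitzVectors hs₁ hC₁ hlin hC hw₀ hw₁
  -- a neighbourhood of `w₀` in which the open conditions on transits hold
  obtain ⟨ρ₂, hρ₂, hopen⟩ : ∃ ρ₂ > 0, ∀ σ, ‖σ - w₀‖ < ρ₂ → ‖σ‖ < r₂ ∧ ‖Φ T σ‖ < r₂ ∧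
      0 < cz σ ∧ cx (Φ T σ) ∈ Ioo (η * Real.exp (-2 * Real.pi * α / β)) η ∧ cz (Φ T σ) < η ∧
      ‖cp (Φ T σ)‖ < η ∧ ‖cm (Φ T σ)‖ < η := by
    have hcT : Continuous (Φ T) := (hf.smooth T).continuous
    have e : ∀ᶠ σ in 𝓝 w₀, ‖σ‖ < r₂ ∧ ‖Φ T σ‖ < r₂ ∧
        0 < cz σ ∧ cx (Φ T σ) ∈ Ioo (η * Real.exp (-2 * Real.pi * α / β)) η ∧ cz (Φ T σ) < η ∧
        ‖cp (Φ T σ)‖ < η ∧ ‖cm (Φ T σ)‖ < η := by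
      refine (continuous_norm.continuousAt.eventually (gt_mem_nhds hw₀)).and
        ((hcT.norm.continuousAt.eventually (gt_mem_nhds hw₁)).and
        ((continuous_cz.continuousAt.eventually (lt_mem_nhds (by rw [hz₀]; exact hη))).and
        (((continuous_cx.comp hcT).continuousAt.eventually (Ioo_mem_nhds hx₁.1 hx₁.2)).and
        (((continuous_cz.comp hcT).continuousAt.eventually (gt_mem_nhds ?_)).and
        ((((continuous_cp.comp hcT).norm).continuousAt.eventually (gt_mem_nhds ?_)).and
        (((continuous_cm.comp hcT).norm).continuousAt.eventually (gt_mem_nhds ?_)))))))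
      · simpa [← hw₁def, hz₁] using hη
      · simpa [← hw₁def, hp₁] using hη
      · exact hv₁
    obtain ⟨ρ₂, hρ₂, h⟩ := Metric.eventually_nhds_iff.1 e
    exact ⟨ρ₂, hρ₂, fun σ hσ => h (by rwa [dist_eq_norm])⟩
  set ρ := min ρ₁ (min ρ₂ δs) with hρ
  have hρ0 : 0 < ρ := by positivity
  refine ⟨(Λ + 1) * (B + 1), by positivity, fun δ hδ => ?_⟩
  set δ₁ := min δ (min δ₀ (min 1 (s₀ / 2))) with hδ₁
  have hδ₁0 : 0 < δ₁ := by positivity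
  have hδ₁δ : δ₁ ≤ δ := min_le_left _ _
  have hδ₁δ₀ : δ₁ ≤ δ₀ := (min_le_right _ _).trans (min_le_left _ _)
  have hδ₁1 : δ₁ ≤ 1 := (min_le_right _ _).trans ((min_le_right _ _).trans (min_le_left _ _))
  have hδ₁s : δ₁ ≤ s₀ / 2 := (min_le_right _ _).trans ((min_le_right _ _).trans (min_le_right _ _))
  set δ₂ := δ₁ / (8 * (C + 1)) with hδ₂
  have hδ₂0 : 0 < δ₂ := by positivity
  have hδ₂1 : δ₂ ≤ δ₁ := div_le_self hδ₁0.le (by linarith)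
  have hCδ₂ : C * δ₂ ≤ δ₁ / 8 := by
    have : (C + 1) * δ₂ = δ₁ / 8 := by rw [hδ₂]; field_simp
    linarith
  set c := min (1 / 2) (1 / (8 * (C + 1))) with hc
  have hc0 : 0 < c := by positivity
  have hcC : (C + 1) * c ≤ 1 / 8 := by
    calc (C + 1) * c ≤ (C + 1) * (1 / (8 * (C + 1))) :=
          mul_le_mul_of_nonneg_left (min_le_right _ _) (by linarith)
      _ = 1 / 8 := by field_simp
  let A' : (ℝ × ℝ × EuclideanSpace ℝ (Fin N)) →L[ℝ] (ℝ × ℝ × EuclideanSpace ℝ (Fin N)) := A.symm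
  let pu : Coord N V →L[ℝ] (ℝ × ℝ × EuclideanSpace ℝ (Fin N)) :=
    A'.comp (transverseComponents N V)
  let py := stableComponents N V
  let u₀ : ℝ × ℝ × EuclideanSpace ℝ (Fin N) := (0, q₀)
  let y₀ : ℝ × V := (xs, vs)
  let g₀ : ℝ × ℝ × EuclideanSpace ℝ (Fin N) → ℝ × V → Coord N V := fun u y =>
    leadingDeviation V α β φ u y.1
  have hy₀' : ‖y₀ - (xs, vs)‖ ≤ δ₀ := by simpa [y₀] using hδ₀.le
  have hTw₀ : transverseComponents N V (Φ T w₀) = 0 := by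
    rw [transverseComponents_apply, ← hw₁def, hy₁, hz₁, hp₁]; rfl
  obtain ⟨κ, hκ, hstep⟩ := exists_scaled_step_estimates hG (pu := pu) (py := py) (g₀ := g₀)
    (u₀ := u₀) (y₀ := y₀) hB hC0
    (fun u y hu hy => (hlead u u y y hu hu hy hy).1)
    (fun u u' y y' hu hu' hy hy' => (hlead u u' y y' hu hu' hy hy').2.1)
    (fun u u' y y' hu hu' hy hy' => (hlead u u' y y' hu hu' hy hy').2.2)
    (by change A' (transverseComponents N V (D (leadingDeviation V α β φ (0, q₀) xs))) = 0
        rw [hlead0, map_zero])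
    (by change A' (transverseComponents N V (Φ T w₀)) = 0
        rw [hTw₀, map_zero])
    rfl hδ₁0 hδ₁δ₀ hδ₂0 (hδ₂1.trans hδ₁δ₀) hCδ₂ hc0 hρ0
  set κ' := min (δ₁ / 2) (1 / 8) / (‖A'‖ + 1) with hκ'
  have hκ'0 : 0 < κ' := by positivity
  have hAκ : ‖A'‖ * κ' ≤ min (δ₁ / 2) (1 / 8) := by
    calc ‖A'‖ * κ' ≤ (‖A'‖ + 1) * κ' := mul_le_mul_of_nonneg_right (by linarith) hκ'0.le
      _ = _ := by rw [hκ']; field_simp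
  have hscale : ∀ᶠ i in atTop, |leadingScale α β φ i| ≤ κ := by
    have := (tendsto_exp_leadingTime (φ := φ) hf.β_pos hf.α_pos 1).eventually (gt_mem_nhds hκ)
    filter_upwards [this] with i hi
    rw [abs_leadingScale]; linarith
  obtain ⟨n₀, hn₀⟩ := eventually_atTop.1 ((hscale.and
    ((tendsto_leadingTime (φ := φ) hf.β_pos).eventually_ge_atTop 2)).and
    ((hf.eventually_scaled_S_le φ (s₀ := s₀) (b := ‖vs‖ + 1) hK hκ).and
    (hf.eventually_scaled_entryComponents_le φ (η, ps) (b := ‖q₀‖ + 1) (by positivity) hκ'0)))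
  filter_upwards [eventually_ge_atTop n₀] with n hn K' _ _ χ m hmc hmn
  let I := {i : ℕ // n ≤ i ∧ i ≤ n + 1}
  let BQ : Set (ℝ × ℝ × EuclideanSpace ℝ (Fin N)) := Metric.closedBall u₀ δ₁
  let BY : Set (ℝ × V) := Metric.closedBall y₀ δ₂ ∩ {y | y.2 ∈ lipschitzVectors S s₀ K}
  let e : I → ℝ := fun i => leadingScale α β φ i
  let tb : I → ℝ := fun i => leadingTime β φ i
  let s : I → ℝ × ℝ × EuclideanSpace ℝ (Fin N) → ℝ × V → Coord N V := fun i u y =>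
    (0, 0, 0, 0, (e i)⁻¹ • S (tb i + u.1) y.2)
  let σ : I → ℝ × ℝ × EuclideanSpace ℝ (Fin N) → ℝ × V → Coord N V := fun i u y =>
    w₀ + e i • (g₀ u y + s i u y)
  let r : I → I → ℝ × ℝ × EuclideanSpace ℝ (Fin N) → ℝ × ℝ × EuclideanSpace ℝ (Fin N) :=
    fun i j u => A' ((e i)⁻¹ • entryComponents γ Lp (tb j + u.1) ((η, ps) + e j • u.2))
  have he0 : ∀ i, e i ≠ 0 := fun i => leadingScale_ne_zero _
  have hBQ : ∀ {u}, u ∈ BQ → ‖u - u₀‖ ≤ δ₁ := fun hu => by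
    rwa [Metric.mem_closedBall, dist_eq_norm] at hu
  have hBQ1 : ∀ {u}, u ∈ BQ → |u.1| ≤ δ₁ := fun {u} hu => by
    have h1 : |u.1 - 0| ≤ ‖u - u₀‖ := norm_fst_le (u - u₀)
    rw [sub_zero] at h1
    exact h1.trans (hBQ hu)
  have hBQ2 : ∀ {u}, u ∈ BQ → ‖u.2‖ ≤ ‖q₀‖ + 1 := fun {u} hu => by
    have h1 : ‖u.2 - q₀‖ ≤ ‖u - u₀‖ := norm_snd_le (u - u₀)
    have h2 := norm_le_norm_add_norm_sub' u.2 q₀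
    linarith [hBQ hu]
  have hBQd : ∀ {u u'}, u ∈ BQ → u' ∈ BQ → |u.1 - u'.1| ≤ s₀ := fun hu hu' => by
    have := abs_sub (_ : ℝ) _ |>.trans (add_le_add (hBQ1 hu) (hBQ1 hu'))
    linarith
  have hBYv : ∀ {y}, y ∈ BY → ‖y.2‖ ≤ ‖vs‖ + 1 := fun {y} hy => by
    have h1 : ‖y.2 - vs‖ ≤ ‖y - y₀‖ := norm_snd_le (y - y₀)
    have h2 := norm_le_norm_add_norm_sub' y.2 vs
    have h3 := hy.1
    rw [Metric.mem_closedBall, dist_eq_norm] at h3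
    linarith
  have hsn : ∀ i u y, (‖s i u y‖ : ℝ) = ‖(e i)⁻¹ • S (tb i + u.1) y.2‖ := fun i u y => by
    simp only [s, Prod.norm_def, norm_zero]
    simp
  have hSi : ∀ i : I, ∀ u ∈ BQ, ∀ u' ∈ BQ, ∀ y ∈ BY, ∀ y' ∈ BY,
      ‖(e i)⁻¹ • S (tb i + u.1) y.2‖ ≤ κ ∧ ‖S (tb i + u.1)‖ * K ≤ 1 ∧
      ‖(e i)⁻¹ • S (tb i + u.1) y.2 - (e i)⁻¹ • S (tb i + u'.1) y'.2‖ ≤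
        κ * max |u.1 - u'.1| ‖y.2 - y'.2‖ := fun i u hu u' hu' y hy y' hy' =>
    (hn₀ i (hn.trans i.2.1)).2.1 u.1 u'.1 ((hBQ1 hu).trans hδ₁1) ((hBQ1 hu').trans hδ₁1)
      (hBQd hu hu') y.2 hy.2 y'.2 hy'.2 (hBYv hy)
  have hst := fun i : I => hstep (e i) (s i) BY (he0 i) (hn₀ i (hn.trans i.2.1)).1.1
    inter_subset_left
    (fun u y hu hy => by
      have hu' : u ∈ BQ := by rwa [Metric.mem_closedBall, dist_eq_norm]
      rw [hsn]; exact (hSi i u hu' u hu' y hy y hy).1)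
    (fun u u' y y' hu hu' hy hy' => by
      have hu1 : u ∈ BQ := by rwa [Metric.mem_closedBall, dist_eq_norm]
      have hu1' : u' ∈ BQ := by rwa [Metric.mem_closedBall, dist_eq_norm]
      have h1 : ‖s i u y - s i u' y'‖ =
          ‖(e i)⁻¹ • S (tb i + u.1) y.2 - (e i)⁻¹ • S (tb i + u'.1) y'.2‖ := by
        simp only [s, Prod.norm_def, Prod.mk_sub_mk, sub_self, norm_zero]
        simp
      rw [h1]
      refine (hSi i u hu1 u' hu1' y hy y' hy').2.2.trans (mul_le_mul_of_nonneg_left ?_ hκ.le)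
      exact max_le_max (norm_fst_le (u - u')) (norm_snd_le (y - y')))
  have htb : ∀ i : I, 2 ≤ tb i := fun i => (hn₀ i (hn.trans i.2.1)).1.2
  have htpos : ∀ i : I, ∀ u ∈ BQ, 0 < tb i + u.1 := fun i u hu => by
    have := (abs_le.1 (hBQ1 hu)).1
    linarith [htb i]
  have hcmσ : ∀ i u y, cm (σ i u y) = S (tb i + u.1) y.2 := fun i u y => by
    change cm w₀ + e i • ((0 : V) + (e i)⁻¹ • S (tb i + u.1) y.2) = _
    rw [hv₀, zero_add, zero_add, smul_smul, mul_inv_cancel₀ (he0 i), one_smul]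
  have hσρ : ∀ i, ∀ u ∈ BQ, ∀ y ∈ BY, ‖σ i u y - w₀‖ < ρ := fun i u hu y hy => by
    have := ((hst i).1 u y (hBQ hu) hy).2.1
    simpa [σ] using this
  have hR := fun (i j : I) (u u' : ℝ × ℝ × EuclideanSpace ℝ (Fin N)) (hu : u ∈ BQ)
      (hu' : u' ∈ BQ) => (hn₀ j (hn.trans j.2.1)).2.2 i (by have := i.2.2; have := j.2.1; omega)
    u.1 u'.1 ((hBQ1 hu).trans hδ₁1) ((hBQ1 hu').trans hδ₁1) u.2 u'.2 (hBQ2 hu) (hBQ2 hu')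
  have hvsL : vs ∈ lipschitzVectors S s₀ K := by
    refine hmemLip w₀ (by simpa using hρ₁) fun r hr => ?_
    rw [hv₀, map_zero, sub_zero, norm_zero]; exact hr.1
  obtain ⟨u, y, huc, hyc, hu, hy, hyeq, hueq⟩ := exists_equivariant_solution χ
    (m := fun a => (⟨m a, by have := hmn a; omega⟩ : I)) (by fun_prop) (BQ := BQ) (BY := BY)
    Metric.isClosed_closedBall
    (Metric.isClosed_closedBall.inter ((isClosed_lipschitzVectors s₀ K).preimage continuous_snd))
    ⟨u₀, Metric.mem_closedBall_self hδ₁0.le⟩ ⟨y₀, Metric.mem_closedBall_self hδ₂0.le, hvsL⟩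
    (f := fun i u y => u - pu ((e i)⁻¹ • Φ T (σ i u y))) (g := fun i u y => py (Φ T (σ i u y)))
    (r := r) (C := C + 1) (c := c) (by linarith) (min_le_left _ _) hcC
    (fun i u hu y hy => by
      refine ⟨?_, ?_⟩
      · rw [Metric.mem_closedBall, dist_eq_norm]
        exact ((hst i).1 u y (hBQ hu) hy).2.2.1
      · change cm (Φ T (σ i u y)) ∈ lipschitzVectors S s₀ K
        refine hmemLip _ ((hσρ i u hu y hy).trans_le (min_le_left _ _)) fun r hr => ?_
        rw [hcmσ, hf.S_comm hr.1 (htpos i u hu).le, ← map_sub]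
        refine (ContinuousLinearMap.le_opNorm _ _).trans ?_
        have h1 := mul_le_mul_of_nonneg_left (hy.2 r hr) (norm_nonneg (S (tb i + u.1)))
        have h2 := mul_le_mul_of_nonneg_right (hSi i u hu u hu y hy y hy).2.1 hr.1
        linarith)
    (fun i u hu y hy u' hu' y' hy' => ((hst i).2 u u' y y' (hBQ hu) (hBQ hu') hy hy').1)
    (fun i j u hu y hy u' hu' => by
      rw [Metric.mem_closedBall, dist_eq_norm, add_sub_right_comm]
      refine (norm_add_le _ _).trans ?_
      have h1 := ((hst i).1 u y (hBQ hu) hy).2.2.2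
      have h2 : ‖r i j u'‖ ≤ δ₁ / 2 := (A'.le_opNorm _).trans
        ((mul_le_mul_of_nonneg_left (hR i j u' u' hu' hu').1 (norm_nonneg _)).trans
          (hAκ.trans (min_le_left _ _)))
      linarith)
    (fun i u hu y hy u' hu' y' hy' => ((hst i).2 u u' y y' (hBQ hu) (hBQ hu') hy hy').2)
    (fun i j u hu u' hu' => by
      rw [← map_sub]
      refine (A'.le_opNorm _).trans
        ((mul_le_mul_of_nonneg_left (hR i j u u' hu hu').2 (norm_nonneg _)).trans ?_)
      rw [← mul_assoc]
      exact mul_le_mul_of_nonneg_right (hAκ.trans (min_le_right _ _)) (norm_nonneg _))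
  set mI : K' → I := fun a => ⟨m a, by have := hmn a; omega⟩ with hmI
  have hmIc : Continuous mI := by fun_prop
  let t : K' → ℝ := fun a => tb (mI a) + (u a).1
  let q : K' → ℝ × EuclideanSpace ℝ (Fin N) := fun a => (η, ps) + e (mI a) • (u a).2
  let w : K' → Coord N V := fun a => entryPoint γ Lp (t a) (y a).1 (q a) (y a).2
  have htc : Continuous t := by
    have : Continuous tb := continuous_of_discreteTopology
    fun_prop
  have hqc : Continuous q := by
    have : Continuous e := continuous_of_discreteTopology
    fun_prop
  have hwc : Continuous w := by
    have h1 : Continuous fun a => NormedSpace.exp ((-(t a)) • Lp) (q a).2 :=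
      ((continuous_exp_smul Lp).comp htc.neg).clm_apply (by fun_prop)
    change Continuous fun a => ((y a).1, (0 : ℝ), Real.exp (-γ * t a) * (q a).1,
      NormedSpace.exp ((-(t a)) • Lp) (q a).2, (y a).2)
    fun_prop
  have hexit : ∀ a, linFlow α β γ Lp S (t a) (w a) = σ (mI a) (u a) (y a) := by
    intro a
    have h1 : Real.exp (-α * (tb (mI a) + (u a).1)) =
        Real.exp (-α * tb (mI a)) * Real.exp (-α * (u a).1) := by
      rw [← Real.exp_add]; ring_nf
    rw [linFlow_entryPoint, sub_self]
    refine Prod.ext ?_ (Prod.ext ?_ (Prod.ext ?_ (Prod.ext ?_ ?_)))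
    · change _ = cx w₀ + e (mI a) * (Real.exp (-α * (u a).1) * Real.cos (β * (u a).1 - φ) *
        (y a).1 + 0)
      change Real.exp (-α * (tb (mI a) + (u a).1)) *
        (Real.cos (β * (leadingTime β φ (m a) + (u a).1)) * (y a).1) = _
      rw [hx₀, h1, cos_leadingTime_add hf.β_pos]
      change _ = 0 + (-1) ^ (m a) * Real.exp (-α * tb (mI a)) * _
      ring
    · change _ = cy w₀ + e (mI a) * (Real.exp (-α * (u a).1) * Real.sin (β * (u a).1 - φ) *
        (y a).1 + 0)
      change Real.exp (-α * (tb (mI a) + (u a).1)) *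
        (Real.sin (β * (leadingTime β φ (m a) + (u a).1)) * (y a).1) = _
      rw [hy₀, h1, sin_leadingTime_add hf.β_pos]
      change _ = 0 + (-1) ^ (m a) * Real.exp (-α * tb (mI a)) * _
      ring
    · change Real.exp (-γ * 0) * (η + e (mI a) * (u a).2.1) =
        cz w₀ + e (mI a) * ((u a).2.1 + 0)
      rw [hz₀, mul_zero, Real.exp_zero, one_mul, add_zero]
    · change NormedSpace.exp ((-(0 : ℝ)) • Lp) (ps + e (mI a) • (u a).2.2) =
        ps + e (mI a) • ((u a).2.2 + 0)
      rw [neg_zero, exp_zero_smul, add_zero]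
    · exact (hcmσ (mI a) (u a) (y a)).symm
  have hnext : ∀ a, Φ T (σ (mI a) (u a) (y a)) = w (χ a) := by
    intro a
    have h1 := hyeq a
    have h2 : A' ((e (mI a))⁻¹ • transverseComponents N V (Φ T (σ (mI a) (u a) (y a)))) =
        A' ((e (mI a))⁻¹ • entryComponents γ Lp (t (χ a)) (q (χ a))) := by
      have h3 : u a = u a - A' (transverseComponents N V ((e (mI a))⁻¹ •
          Φ T (σ (mI a) (u a) (y a)))) +
          A' ((e (mI a))⁻¹ • entryComponents γ Lp (t (χ a)) (q (χ a))) := hueq a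
      rw [map_smul] at h3
      have h4 := congrArg (fun x => x - u a +
        A' ((e (mI a))⁻¹ • transverseComponents N V (Φ T (σ (mI a) (u a) (y a))))) h3
      simp only [sub_self, zero_add] at h4
      rw [h4]; abel
    have h3 := smul_right_injective _ (inv_ne_zero (he0 (mI a))) (A.symm.injective h2)
    have h4 : (cx (Φ T (σ (mI a) (u a) (y a))), cm (Φ T (σ (mI a) (u a) (y a)))) = y (χ a) :=
      h1.symm
    have h5 : (cy (Φ T (σ (mI a) (u a) (y a))), cz (Φ T (σ (mI a) (u a) (y a))),
      cp (Φ T (σ (mI a) (u a) (y a)))) = entryComponents γ Lp (t (χ a)) (q (χ a)) := h3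
    have h6 := congrArg Prod.fst h4
    have h7 := congrArg Prod.snd h4
    have h8 := congrArg Prod.fst h5
    have h9 := congrArg (fun p => p.2.1) h5
    have h10 := congrArg (fun p => p.2.2) h5
    exact Prod.ext h6 (Prod.ext h8 (Prod.ext h9 (Prod.ext h10 h7)))
  have hσw : ∀ a, ‖σ (mI a) (u a) (y a) - w₀‖ < ρ := fun a => hσρ _ _ (hu a) _ (hy a)
  have hop := fun a => hopen _ ((hσw a).trans_le ((min_le_right _ _).trans (min_le_left _ _)))
  have ht0 : ∀ a, 0 < t a := fun a => htpos _ _ (hu a)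
  have hprev : ∀ a, w a = Φ T (σ (mI (χ.symm a)) (u (χ.symm a)) (y (χ.symm a))) := fun a => by
    rw [hnext, χ.apply_symm_apply]
  have hqz : ∀ a, cz (σ (mI a) (u a) (y a)) = (q a).1 := fun a => by
    rw [← hexit a, linFlow_entryPoint, sub_self, mul_zero, Real.exp_zero, one_mul]; rfl
  have hqp : ∀ a, cp (σ (mI a) (u a) (y a)) = (q a).2 := fun a => by
    rw [← hexit a, linFlow_entryPoint, sub_self, neg_zero, exp_zero_smul]; rfl
  have hwS : ∀ a, w a ∈ Sigma0 α β η := by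
    intro a
    obtain ⟨-, -, -, h4, h5, h6, h7⟩ := hop (χ.symm a)
    rw [← hprev a] at h4 h5 h6 h7
    refine ⟨rfl, h4.1, h4.2, ?_, h5, h6, h7⟩
    have := (hop a).2.2.1
    rw [hqz] at this
    exact mul_pos (Real.exp_pos _) this
  have hnorm : ∀ a, ∀ s ∈ Icc 0 (t a), linFlow α β γ Lp S s (w a) ∈ Ω := by
    intro a s hs
    apply hball
    rw [mem_ball_zero_iff]
    have h2 := (hop (χ.symm a)).2.1
    rw [← hprev a] at h2
    refine (norm_linFlow_entryPoint_lt hf hs ((abs_cx_le (w a)).trans_lt h2) ?_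
      ((norm_cm_le (w a)).trans_lt h2)).trans_le hMr
    have h3 := (hop a).1
    rw [Prod.norm_def, sup_lt_iff, ← hqz, ← hqp]
    exact ⟨(abs_cz_le _).trans_lt h3, (norm_cp_le _).trans_lt h3⟩
  have hflow : ∀ a, ∀ s ∈ Icc 0 (t a), Φ s (w a) = linFlow α β γ Lp S s (w a) := fun a =>
    hf.eq_linFlow (hnorm a)
  have hend : ∀ a, Φ (t a) (w a) = σ (mI a) (u a) (y a) := fun a => by
    rw [hflow a _ ⟨(ht0 a).le, le_rfl⟩, hexit]
  have hscl : ∀ a, ‖σ (mI a) (u a) (y a) - w₀‖ ≤ (B + 1) * Real.exp (-α * leadingTime β φ n) := by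
    intro a
    have h1 := ((hst (mI a)).1 _ _ (hBQ (hu a)) (hy a)).1
    have h2 : |e (mI a)| ≤ Real.exp (-α * leadingTime β φ n) := by
      change |leadingScale α β φ (m a)| ≤ _
      rw [abs_leadingScale]
      apply Real.exp_le_exp.2
      have := mul_le_mul_of_nonneg_left
        (leadingTime_mono (φ := φ) hf.β_pos (mI a).2.1) hf.α_pos.le
      change α * leadingTime β φ n ≤ α * leadingTime β φ (m a) at this
      linarith
    have h3 : σ (mI a) (u a) (y a) - w₀ = e (mI a) • (g₀ (u a) (y a) + s (mI a) (u a) (y a)) :=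
      add_sub_cancel_left _ _
    rw [h3]
    exact h1.trans (mul_le_mul_of_nonneg_left h2 (by linarith))
  have hE := Real.exp_pos (-α * leadingTime β φ n)
  refine ⟨w, t, hwc, fun a => ⟨⟨hT, ht0 a, hwS a, hflow a, ?_, ?_, ?_⟩, ?_, ?_, ?_, ?_⟩⟩
  · rw [hflow a _ ⟨(ht0 a).le, le_rfl⟩]
    exact hnorm a _ ⟨(ht0 a).le, le_rfl⟩
  · rw [hend, hnext]; exact hwS _
  · rw [hend]
    have h1 := hwS (χ a)
    rw [← hnext] at h1
    refine havoid _ ?_ h1.1 h1.2.1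
    rw [dist_eq_norm]
    exact (hσw a).trans_le ((min_le_right _ _).trans (min_le_right _ _))
  · rw [hend, hnext]
  · have h1 : t a - leadingTime β φ (m a) = (u a).1 := add_sub_cancel_left _ _
    rw [h1]
    exact (hBQ1 (hu a)).trans hδ₁δ
  · rw [hprev a]
    refine (hLip _ ((hσw _).trans_le (min_le_left _ _))).trans ?_
    calc _ ≤ Λ * ((B + 1) * Real.exp (-α * leadingTime β φ n)) :=
          mul_le_mul_of_nonneg_left (hscl _) hΛ
      _ ≤ (Λ + 1) * ((B + 1) * Real.exp (-α * leadingTime β φ n)) :=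
          mul_le_mul_of_nonneg_right (by linarith) (by positivity)
      _ = _ := by ring
  · rw [hend]
    refine (hscl a).trans (mul_le_mul_of_nonneg_right ?_ hE.le)
    exact le_mul_of_one_le_left (by linarith) (by linarith)

end IsLocallyLinearFlow

/-! ### Fixed points and slabs -/

/-- Diagonal choice: near-minimizers of `f n` on `{x | R n x}`. -/
theorem exists_seq_tendsto_zero {X : Type*} [Nonempty X] {R : ℕ → X → Prop} {f : ℕ → X → ℝ}
    (hf : ∀ n x, 0 ≤ f n x) (h : ∀ δ > 0, ∀ᶠ n in atTop, ∃ x, R n x ∧ f n x ≤ δ) :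
    ∃ x : ℕ → X, (∀ᶠ n in atTop, R n (x n)) ∧ Tendsto (fun n => f n (x n)) atTop (𝓝 0) := by
  let A : ℕ → Set ℝ := fun n => f n '' {x | R n x}
  have hA : ∀ n, BddBelow (A n) := fun n => ⟨0, by rintro _ ⟨x, -, rfl⟩; exact hf n x⟩
  have hex : ∀ n, ∃ x, (A n).Nonempty → R n x ∧ f n x < sInf (A n) + 1 / ((n : ℝ) + 1) := by
    intro n
    by_cases hn : (A n).Nonempty
    · obtain ⟨_, ⟨x, hx, rfl⟩, h2⟩ := exists_lt_of_csInf_lt hn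
        (lt_add_of_pos_right (sInf (A n)) (by positivity : (0 : ℝ) < 1 / ((n : ℝ) + 1)))
      exact ⟨x, fun _ => ⟨hx, h2⟩⟩
    · exact ⟨Classical.arbitrary X, fun h => absurd h hn⟩
  choose x hx using hex
  refine ⟨x, ?_, ?_⟩
  · filter_upwards [h 1 one_pos] with n hn
    obtain ⟨y, hy, -⟩ := hn
    exact (hx n ⟨_, y, hy, rfl⟩).1
  · refine Metric.tendsto_atTop'.2 fun ε hε => ?_
    have h1 := tendsto_one_div_add_atTop_nhds_zero_nat (𝕜 := ℝ) |>.eventually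
      (gt_mem_nhds (half_pos hε))
    obtain ⟨n₀, hn₀⟩ := eventually_atTop.1 ((h (ε / 2) (half_pos hε)).and h1)
    refine ⟨n₀, fun n hn => ?_⟩
    obtain ⟨⟨y, hy, hyε⟩, h2⟩ := hn₀ n hn.le
    have h3 := (hx n ⟨_, y, hy, rfl⟩).2
    have h4 := csInf_le (hA n) ⟨y, hy, rfl⟩
    rw [Real.dist_eq, sub_zero, abs_of_nonneg (hf _ _)]
    linarith

section Slab

variable {N : ℕ} {V : Type*} [NormedAddCommGroup V] [InnerProductSpace ℝ V]
  {Φ : ℝ → Coord N V → Coord N V} {Ω : Set (Coord N V)} {α β γ lm lp M η T : ℝ}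
  {Lp : EuclideanSpace ℝ (Fin N) →L[ℝ] EuclideanSpace ℝ (Fin N)} {S : ℝ → V →L[ℝ] V}

/-- The transits with leading order times of indices `2ℓ` and `2ℓ + 1` start in the slab `S_ℓ`. -/
theorem IsTransit.eventually_mem_slab (hf : IsLocallyLinearFlow Φ Ω α β γ lm lp M Lp S)
    (hη : 0 < η) {φ C : ℝ} {w₀ w₁ : Coord N V} (hz₀ : cz w₀ = η) (hv₀ : cm w₀ = 0)
    {Ts : ℕ → ℝ} (hTs : Tendsto (fun ℓ => Ts ℓ - leadingTime β φ ℓ) atTop (𝓝 0)) :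
    ∀ᶠ ℓ in atTop, ∀ i t w, (i = 2 * ℓ ∨ i = 2 * ℓ + 1) → IsTransit Φ Ω α β γ η T Lp S w t →
      |t - leadingTime β φ i| ≤ Real.pi / (8 * β) →
      ‖w - w₁‖ ≤ C * Real.exp (-α * leadingTime β φ (2 * ℓ)) →
      ‖Φ t w - w₀‖ ≤ C * Real.exp (-α * leadingTime β φ (2 * ℓ)) →
      w ∈ slab Φ Ω α β γ η T w₁ w₀ Ts ℓ := by
  set d := Real.pi / (8 * β) with hd
  have hd0 : 0 < d := div_pos Real.pi_pos (mul_pos (by norm_num) hf.β_pos)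
  have hd8 : Real.pi / β = 8 * d := by rw [hd]; have := hf.β_pos.ne'; field_simp
  have hd4 : Real.pi / (2 * β) = 4 * d := by rw [hd]; have := hf.β_pos.ne'; field_simp; norm_num
  have hγ : 0 < γ := hf.α_pos.trans hf.α_lt_γ
  have hα := hf.α_pos
  set k := Real.exp (-γ * (2 * d)) with hk
  have hk1 : k < 1 := Real.exp_lt_one_iff.2 (by have := mul_pos hγ hd0; linarith)
  have hk0 : 0 < k := Real.exp_pos _
  have h2ℓ : Tendsto (fun ℓ : ℕ => 2 * ℓ) atTop atTop :=
    tendsto_id.const_mul_atTop' (by norm_num)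
  have hE1 := ((tendsto_exp_leadingTime (φ := φ) hf.β_pos hα C).comp h2ℓ).eventually
    (gt_mem_nhds (mul_pos hη (sub_pos.2 hk1)))
  have hE2 := ((tendsto_exp_leadingTime (φ := φ) hf.β_pos (half_pos hα) C).comp h2ℓ).eventually
    (gt_mem_nhds (mul_pos hη (Real.exp_pos (-(1 / 2) * α * d))))
  have hT1 : ∀ᶠ ℓ in atTop, |Ts ℓ - leadingTime β φ ℓ| ≤ d := by
    filter_upwards [Metric.tendsto_nhds.1 hTs d hd0] with ℓ hℓ
    rw [Real.dist_eq, sub_zero] at hℓ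
    exact hℓ.le
  have hT2 := h2ℓ.eventually hT1
  have hT3 := ((tendsto_add_atTop_nat 1)).eventually hT2
  filter_upwards [hE1, hE2, hT2, hT3] with ℓ hE1 hE2 hT2 hT3 i t w hi htr ht hw hσ
  simp only [Function.comp_apply] at hE1 hE2
  have hL2 : leadingTime β φ (2 * (ℓ + 1)) = leadingTime β φ (2 * ℓ) + 16 * d := by
    rw [show 2 * (ℓ + 1) = 2 * ℓ + 1 + 1 by ring, leadingTime_succ, leadingTime_succ, hd8]; ring
  rw [hL2] at hT3
  have htl : leadingTime β φ (2 * ℓ) - d ≤ t ∧ t ≤ leadingTime β φ (2 * ℓ) + 9 * d := by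
    have h1 := abs_le.1 ht
    rcases hi with rfl | rfl
    · constructor <;> linarith
    · rw [leadingTime_succ, hd8] at h1
      constructor <;> linarith
  set l := leadingTime β φ (2 * ℓ) with hl
  obtain ⟨hT2a, hT2b⟩ := abs_le.1 hT2
  obtain ⟨hT3a, hT3b⟩ := abs_le.1 hT3
  have hcz : cz w = Real.exp (-γ * t) * cz (Φ t w) := by
    rw [htr.linear t ⟨htr.pos.le, le_rfl⟩]
    change cz w = Real.exp (-γ * t) * (Real.exp (γ * t) * cz w)
    rw [← mul_assoc, ← Real.exp_add]; simp
  have hζ : |cz (Φ t w) - η| < η * (1 - k) := by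
    rw [← hz₀]
    exact (abs_cz_le (Φ t w - w₀)).trans_lt (hσ.trans_lt (by rw [hz₀]; exact hE1))
  obtain ⟨hζ1, hζ2⟩ := abs_lt.1 hζ
  have hsmall : C * Real.exp (-α * l) ≤ η * Real.exp (-(1 / 2) * α * Ts (2 * ℓ)) := by
    have e1 : Real.exp (-α * l) = Real.exp (-(α / 2) * l) * Real.exp (-(α / 2) * l) := by
      rw [← Real.exp_add]; ring_nf
    have e2 : Real.exp (-(1 / 2) * α * d) * Real.exp (-(α / 2) * l) ≤
        Real.exp (-(1 / 2) * α * Ts (2 * ℓ)) := by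
      rw [← Real.exp_add]
      apply Real.exp_le_exp.2
      have := mul_le_mul_of_nonneg_left hT2b (half_pos hα).le
      linarith
    calc C * Real.exp (-α * l) = C * Real.exp (-(α / 2) * l) * Real.exp (-(α / 2) * l) := by
          rw [e1]; ring
      _ ≤ η * Real.exp (-(1 / 2) * α * d) * Real.exp (-(α / 2) * l) :=
          mul_le_mul_of_nonneg_right hE2.le (Real.exp_pos _).le
      _ ≤ _ := by rw [mul_assoc]; exact mul_le_mul_of_nonneg_left e2 hη.le
  have hP := htr.P01_eq hf
  refine ⟨htr.mem_U0 hf, ?_, ?_, ?_, ?_, ?_⟩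
  · rw [hcz, hd4]
    have e1 : Real.exp (-γ * (Ts (2 * (ℓ + 1)) - 4 * d)) ≤ Real.exp (-γ * t) * k := by
      rw [hk, ← Real.exp_add]
      apply Real.exp_le_exp.2
      have := mul_le_mul_of_nonneg_left
        (by linarith : t + 2 * d ≤ Ts (2 * (ℓ + 1)) - 4 * d) hγ.le
      linarith
    have hk2 : k * η ≤ cz (Φ t w) := by linarith
    calc η * Real.exp (-γ * (Ts (2 * (ℓ + 1)) - 4 * d)) ≤ η * (Real.exp (-γ * t) * k) :=
          mul_le_mul_of_nonneg_left e1 hη.le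
      _ = Real.exp (-γ * t) * (k * η) := by ring
      _ ≤ _ := mul_le_mul_of_nonneg_left hk2 (Real.exp_pos _).le
  · rw [hcz, hd4]
    have e1 : Real.exp (-γ * t) ≤ Real.exp (-γ * (Ts (2 * ℓ) - 4 * d)) * k := by
      rw [hk, ← Real.exp_add]
      apply Real.exp_le_exp.2
      have := mul_le_mul_of_nonneg_left
        (by linarith : Ts (2 * ℓ) - 4 * d + 2 * d ≤ t) hγ.le
      linarith
    have hk2 : k * cz (Φ t w) ≤ η := by
      -- `k * (2 - k) ≤ 1`
      have h1 : cz (Φ t w) ≤ η * (2 - k) := by linarith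
      have h2 := mul_le_mul_of_nonneg_left h1 hk0.le
      have h3 : 0 ≤ η * (1 - k) ^ 2 := by positivity
      linarith
    have hζ0 : 0 ≤ cz (Φ t w) := by
      have := mul_pos hη hk0; linarith
    calc Real.exp (-γ * t) * cz (Φ t w)
        ≤ Real.exp (-γ * (Ts (2 * ℓ) - 4 * d)) * k * cz (Φ t w) :=
          mul_le_mul_of_nonneg_right e1 hζ0
      _ = Real.exp (-γ * (Ts (2 * ℓ) - 4 * d)) * (k * cz (Φ t w)) := by ring
      _ ≤ Real.exp (-γ * (Ts (2 * ℓ) - 4 * d)) * η :=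
          mul_le_mul_of_nonneg_left hk2 (Real.exp_pos _).le
      _ = _ := mul_comm _ _
  · exact (abs_cx_le (w - w₁)).trans (hw.trans hsmall)
  · rw [hP, ← sub_zero (cm (Φ t w)), ← hv₀]
    exact (norm_cm_le (Φ t w - w₀)).trans (hσ.trans hsmall)
  · rw [hP]
    exact (norm_cp_le (Φ t w - w₀)).trans (hσ.trans hsmall)

end Slab

end Silnikov

end

theorem mainTheorem1
    {H : Type*} [NormedAddCommGroup H] [InnerProductSpace ℝ H] [CompleteSpace H]
    {V : Type*} [NormedAddCommGroup V] [InnerProductSpace ℝ V] [CompleteSpace V]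
    {N : ℕ}
    (L : H →ₗ.[ℝ] H) (Nl : H → (L.adjoint.domain →ₗ[ℝ] ℝ)) (F : ℝ → H → H)
    (α β γ lamMinus lamPlus : ℝ) (Sm : Set ℕ) (μm : ℕ → ℂ) (μp : Fin N → ℂ)
    (κ : H ≃L[ℝ] Silnikov.Coord N V) (R : H ≃ H)
    (Lp : EuclideanSpace ℝ (Fin N) →L[ℝ] EuclideanSpace ℝ (Fin N))
    (Lm : V →ₗ.[ℝ] V) (S : ℝ → V →L[ℝ] V) (Ω : Set (Silnikov.Coord N V))
    (h : ℝ → Silnikov.Coord N V) (Φ : ℝ → Silnikov.Coord N V → Silnikov.Coord N V)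
    (hΦ : Φ = Silnikov.conjFlow F R κ)
    (hA1 : Silnikov.A1 L Nl α β γ lamMinus lamPlus Sm μm μp)
    (hA2 : Silnikov.A2 L Nl F)
    (hA3 : Silnikov.A3 L F α β γ lamMinus lamPlus κ R Lp Lm S Ω)
    (hA4 : Silnikov.A4 Φ h) :
    -- `η` is a sufficiently small constant
    ∃ η₀ : ℝ, 0 < η₀ ∧ ∀ η : ℝ, 0 < η → η < η₀ →
      Silnikov.Sigma0 α β η ⊆ Ω ∧
      ∀ T τ : ℝ, Silnikov.IsSectionData h Ω α β η T τ →
      -- (A5)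
      Silnikov.A5 (fderiv ℝ (Φ T) (h (τ - T))) (Silnikov.cx (h τ)) →
      -- the fixed points defining the times `T^(ℓ)` exist
      (∃ (p : ℕ → Silnikov.Coord N V) (Ts : ℕ → ℝ),
        Silnikov.IsFixedPointSequence Φ Ω α β η T (h τ)
          (Silnikov.phase (fderiv ℝ (Φ T) (h (τ - T))) (Silnikov.cx (h τ))) p Ts) ∧
      ∀ (p : ℕ → Silnikov.Coord N V) (Ts : ℕ → ℝ),
        Silnikov.IsFixedPointSequence Φ Ω α β η T (h τ)
          (Silnikov.phase (fderiv ℝ (Φ T) (h (τ - T))) (Silnikov.cx (h τ))) p Ts →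
        -- (A6)
        (∀ᶠ ℓ : ℕ in Filter.atTop,
          Silnikov.A6 (fderiv ℝ (Φ T) (h (τ - T))) α β (Ts (2 * ℓ))) →
        ∃ ℓ₀ : ℕ, ∀ ℓ : ℕ, ℓ₀ ≤ ℓ →
          Silnikov.HasHorseshoe (Silnikov.P Φ Ω α β η T) (Silnikov.U Φ Ω α β η T)
            (Silnikov.slab Φ Ω α β γ η T (h τ) (h (τ - T)) Ts ℓ) := by
  open Silnikov in
  subst hΦ
  obtain ⟨M, hf⟩ := hA3.isLocallyLinearFlow hA1 hA2
  set Φ := conjFlow F R κ with hΦ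
  obtain ⟨r₀, hr₀, hball⟩ := Metric.isOpen_iff.1 hf.isOpen 0 hf.zero_mem
  obtain ⟨C₁, hC₁, s₁, hs₁, hC⟩ := exists_norm_linFlow_sub_le α β γ Lp S
  have hM : 0 < M := zero_lt_one.trans_le hf.one_le_M
  have hB : 0 < C₁ * s₁ + M + 2 := by positivity
  -- points of norm less than `r₂` stay in `Ω` up to the time `s₁`
  obtain ⟨r₂, hr₂, hBr₂⟩ : ∃ r₂ > 0, (C₁ * s₁ + M + 2) * r₂ = r₀ :=
    ⟨r₀ / (C₁ * s₁ + M + 2), by positivity, by field_simp⟩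
  have hCs : 0 ≤ C₁ * s₁ * r₂ := by positivity
  have hMr2 : 0 < M * r₂ := by positivity
  have hMr : M * r₂ ≤ r₀ := by linarith
  have hr₂₀ : r₂ < r₀ := by linarith
  have hlin : ∀ w, ‖w‖ < r₂ → ∀ s ∈ Icc 0 s₁, Φ s w = linFlow α β γ Lp S s w := by
    intro w hw
    refine hf.eq_linFlow fun s hs => hball ?_
    rw [mem_ball_zero_iff]
    have h1 := hC s hs w
    have h2 := norm_add_le (linFlow α β γ Lp S s w - w) w
    rw [sub_add_cancel] at h2
    have h3 := norm_sub_le (S s (cm w)) (cm w)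
    have h4 : ‖S s (cm w)‖ ≤ M * ‖w‖ := ((S s).le_opNorm _).trans
      (mul_le_mul (hf.norm_S_le hs.1) (norm_cm_le w) (norm_nonneg _) hM.le)
    have h5 : C₁ * s * ‖w‖ ≤ C₁ * s₁ * ‖w‖ := by
      have := hs.2
      gcongr
    have h6 := norm_cm_le w
    have h7 : (C₁ * s₁ + M + 2) * ‖w‖ < r₀ := by
      rw [← hBr₂]; exact mul_lt_mul_of_pos_left hw hB
    linarith
  obtain ⟨η₀, hη₀, hscale⟩ := hf.exists_section_scale hA4 (half_pos hr₂)
    (by linarith : r₂ / 2 < r₀) hball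
  refine ⟨min η₀ r₂, lt_min hη₀ hr₂, fun η hη hηlt => ⟨fun w hw => hball ?_,
    fun T τ hsec hA5 => ?_⟩⟩
  · rw [mem_ball_zero_iff]
    have hηr : η < r₀ := (hηlt.trans_le (min_le_right _ _)).trans hr₂₀
    have hx := cx_pos_of_mem (sigma0_subset_sigma0Plus hw)
    obtain ⟨a1, a2, a3, a4, a5, a6, a7⟩ := hw
    exact norm_coord_lt_iff.2 ⟨abs_lt.2 ⟨by linarith, by linarith⟩, by rw [a1, abs_zero]; exact hr₀,
      abs_lt.2 ⟨by linarith, by linarith⟩, a6.trans hηr, a7.trans hηr⟩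
  obtain ⟨hw₀, δs, hδs, havoid⟩ := hscale η hη (hηlt.trans_le (min_le_left _ _)) T τ hsec
  have hnext : h τ = Φ T (h (τ - T)) := by
    rw [hA4.orbit τ, hA4.orbit (τ - T), ← hf.add]; congr 1; ring
  have hplus_y := hsec.plus_y
  have hplus_z := hsec.plus_z
  have hplus_vp := hsec.plus_vp
  have hplus_x := hsec.plus_x
  have hplus_vm := hsec.plus_vm
  rw [hnext] at hplus_y hplus_z hplus_vp hplus_x hplus_vm hA5 ⊢
  have hm : 0 < η * Real.exp (-2 * Real.pi * α / β) := mul_pos hη (Real.exp_pos _)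
  have hw₁ : ‖Φ T (h (τ - T))‖ < r₂ := by
    have hηr : η < r₂ := hηlt.trans_le (min_le_right _ _)
    exact norm_coord_lt_iff.2 ⟨abs_lt.2 ⟨by linarith [hplus_x.1], by linarith [hplus_x.2]⟩,
      by rw [hplus_y, abs_zero]; exact hr₂, by rw [hplus_z, abs_zero]; exact hr₂,
      by rw [hplus_vp, norm_zero]; exact hr₂, hplus_vm.trans hηr⟩
  obtain ⟨C, -, hfam⟩ := hf.exists_transit_family hball hMr hs₁ hC₁ hlin hC hsec.T_pos hη
    hsec.minus_x hsec.minus_y hsec.minus_z hsec.minus_vm hplus_y hplus_z hplus_vp hplus_x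
    hplus_vm (by linarith : ‖h (τ - T)‖ < r₂) hw₁ hA5 hδs havoid
  set φ := phase (fderiv ℝ (Φ T) (h (τ - T))) (cx (Φ T (h (τ - T)))) with hφ
  refine ⟨?_, fun p Ts hseq _ => ?_⟩
  · obtain ⟨x, hx, hx0⟩ := exists_seq_tendsto_zero (X := Coord N V × ℝ)
      (R := fun n x => IsTransit Φ Ω α β γ η T Lp S x.1 x.2 ∧ x.1 = Φ T (Φ x.2 x.1) ∧
        ‖x.1 - Φ T (h (τ - T))‖ ≤ C * Real.exp (-α * leadingTime β φ n))
      (f := fun n x => |x.2 - leadingTime β φ n|) (fun _ _ => abs_nonneg _) (fun δ hδ => by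
        filter_upwards [hfam δ hδ] with n hn
        obtain ⟨w, t, -, hwt⟩ := hn Unit (Homeomorph.refl Unit) (fun _ => n) continuous_const
          (fun _ => Or.inl rfl)
        obtain ⟨h1, h2, h3, h4, -⟩ := hwt ()
        exact ⟨(w (), t ()), ⟨h1, h2, h4⟩, h3⟩)
    refine ⟨fun n => (x n).1, fun n => (x n).2, ?_, ?_, ?_⟩
    · filter_upwards [hx] with n hn
      exact ⟨hn.1.mem_U hf, by rw [hn.1.P_eq hf]; exact hn.2.1.symm, hn.1.tStar_eq hf⟩
    · exact (tendsto_zero_iff_abs_tendsto_zero _).2 hx0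
    · refine tendsto_iff_norm_sub_tendsto_zero.2 (squeeze_zero' (Eventually.of_forall fun _ =>
        norm_nonneg _) ?_ (tendsto_exp_leadingTime (φ := φ) hf.β_pos hf.α_pos C))
      filter_upwards [hx] with n hn using hn.2.2
  · have hd0 : 0 < Real.pi / (8 * β) := div_pos Real.pi_pos (mul_pos (by norm_num) hf.β_pos)
    have h2ℓ : Tendsto (fun ℓ : ℕ => 2 * ℓ) atTop atTop :=
      tendsto_id.const_mul_atTop' (by norm_num)
    have hslab := IsTransit.eventually_mem_slab (T := T) (C := C) hf hη (w₁ := Φ T (h (τ - T)))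
      hsec.minus_z hsec.minus_vm hseq.time
    refine eventually_atTop.1 ?_
    filter_upwards [h2ℓ.eventually (hfam _ hd0), hslab] with ℓ hℓ hslab
    have hval : ∀ a : Symbols, 2 * ℓ + (a 0 : ℕ) = 2 * ℓ ∨ 2 * ℓ + (a 0 : ℕ) = 2 * ℓ + 1 :=
      fun a => by have := (a 0).isLt; omega
    obtain ⟨w, t, hwc, hwt⟩ := hℓ Symbols shiftHomeomorph (fun a => 2 * ℓ + (a 0 : ℕ))
      ((continuous_of_discreteTopology (f := fun k : Fin 2 => 2 * ℓ + (k : ℕ))).comp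
        (continuous_apply 0)) hval
    refine hasHorseshoe_of_transits hf hwc (fun a => (hwt a).1) (fun a => (hwt a).2.1)
      (fun a a' htt => ?_)
      (fun a => hslab _ _ _ (hval a) (hwt a).1 (hwt a).2.2.1 (hwt a).2.2.2.1 (hwt a).2.2.2.2)
    -- equal transit times are close to the same leading order time
    have h1 := abs_le.1 (hwt a).2.2.1
    have h2 := abs_le.1 (hwt a').2.2.1
    rw [htt] at h1
    have hd8 : Real.pi / β = 8 * (Real.pi / (8 * β)) := by
      have := hf.β_pos.ne'; field_simp
    have hs := leadingTime_succ (β := β) (φ := φ) (2 * ℓ)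
    have key : ∀ k k' : Fin 2, k ≠ k' → (k = 0 ∧ k' = 1) ∨ (k = 1 ∧ k' = 0) := by decide
    by_contra hne
    rcases key _ _ hne with ⟨e1, e2⟩ | ⟨e1, e2⟩
    · simp only [e1, e2, Fin.val_zero, Fin.val_one, add_zero] at h1 h2
      linarith
    · simp only [e1, e2, Fin.val_zero, Fin.val_one, add_zero] at h1 h2
      linarith
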